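/- **Control theorem for Bianchi modular symbols.** Let $K$ be an imaginary quadratic field with ring of integers $\mathcal O_K$ and class number $h$, let $p$ be a prime, and let $L/\mathbb Q_p$ be a finite extension into which $K$ has two distinct embeddings $\sigma_1,\sigma_2:K\to L$. Let $v_p$ be the valuation on $L$ with $v_p(p)=1$ (and $v_p(0)=\infty$) and $\mathcal O_L$ its valuation ring. Let $\mathfrak n$ be a nonzero ideal of $\mathcal O_K$ divisible by $(p)$, and let $I_1,\dots,I_h$ be integral ideals coprime to $\mathfrak n$ that represent the ideal classes of $K$. Put $$\Gamma_i=\left\{\begin{pmatrix}a&b\\c&d\end{pmatrix}\in \mathrm{SL}_2(K): a,d\in 1+\mathfrak n,\ b\in I_i,\ c\in \mathfrak n I_i^{-1}\right\}.$$ *Coefficients.* Let $k\ge 0$ be an integer. Let $\mathcal A_{k,k}(L)$ be the completed tensor product of two copies of the $L$-Banach space of rigid analytic functions on the closed unit disc over $L$, that is, the space of power series $f(x,y)=\sum a_{ij}x^iy^j$ with $a_{ij}\in L$, $a_{ij}\to 0$, with the Gauss norm; let $V_{k,k}(L)$ be its subspace of polynomials of degree at most $k$ in each variable. The monoid $\Sigma_0(\mathcal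 O_L)$ of matrices $\begin{pmatrix}a&b\\c&d\end{pmatrix}\in M_2(\mathcal O_L)$ with $p\mid c$, $a\in\mathcal O_L^\times$, $ad-bc\ne0$ gives a left action of $\Sigma_0(\mathcal O_L)^2$ on $\mathcal A_{k,k}(L)$ which preserves $V_{k,k}(L)$: $$\big((\gamma_1,\gamma_2)\cdot f\big)(x,y)=(a_1+c_1x)^k(a_2+c_2y)^k f\left(\frac{b_1+d_1x}{a_1+c_1x},\frac{b_2+d_2y}{a_2+c_2y}\right),\qquad \gamma_s=\begin{pmatrix}a_s&b_s\\c_s&d_s\end{pmatrix}.$$ Let $\mathbb D_{k,k}(L)$ be the topological dual of $\mathcal A_{k,k}(L)$ and $V_{k,k}^*(L)$ the dual of $V_{k,k}(L)$, with the right actions $(\mu|\gamma)(f)=\mu(\gamma\cdot f)$. A matrix over $K$ acts through its images under $(\sigma_1,\sigma_2)$ whenever these lie in $\Sigma_0(\mathcal O_L)^2$; this is so for all matrices below. *Symbols.* Let $\Delta_0$ be the group of divisors of degree $0$ on $\mathbb P^1(K)$, with $\mathrm{GL}_2(K)$ acting by fractional linear transformations. For $M=\mathbb D_{k,k}(L)$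 or $M=V_{k,k}^*(L)$ and a homomorphism $\phi:\Delta_0\to M$ put $(\phi|g)(E)=\phi(gE)|g$, and let $\mathrm{Symb}_{\Gamma_i}(M)$ be the space of $\phi$ with $\phi|\gamma=\phi$ for all $\gamma\in\Gamma_i$. *Hecke operators.* For each prime $\mathfrak p\mid p$ and each $i$ there is a unique index $j_i$ with $\mathfrak pI_i=(\alpha_i)I_{j_i}$ for some $\alpha_i\in K^\times$; fix such $\alpha_i$ for every $\mathfrak p$ and $i$. The operator $U_{\mathfrak p}$ on $\bigoplus_i\mathrm{Symb}_{\Gamma_i}(M)$ is $$(\phi_1,\dots,\phi_h)|U_{\mathfrak p}=\left(\sum_{a}\phi_{j_i}\Big|\begin{pmatrix}1&a\\0&\alpha_i\end{pmatrix}\right)_{1\le i\le h},$$ where in the $i$-th component $a$ runs over representatives in $I_i$ of the residue classes modulo $\mathfrak p$ (this is the double coset operator $[\Gamma_{j_i}\begin{pmatrix}1&0\\0&\alpha_i\end{pmatrix}\Gamma_i]$). *Theorem.* Write $p\mathcal O_K=\prod_{\mathfrak p\mid p}\mathfrak p^{e_{\mathfrak p}}$. For each $\mathfrak p\mid p$ let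 $\lambda_{\mathfrak p}\in L$ with $v_p(\lambda_{\mathfrak p})<(k+1)/e_{\mathfrak p}$. Then the specialisation map, induced by restricting distributions from $\mathcal A_{k,k}(L)$ to $V_{k,k}(L)$, restricts to an isomorphism of $L$-vector spaces between simultaneous eigenspaces $$\bigoplus_{i=1}^h\mathrm{Symb}_{\Gamma_i}(\mathbb D_{k,k}(L))^{\{U_{\mathfrak p}=\lambda_{\mathfrak p}\,:\,\mathfrak p\mid p\}}\ \xrightarrow{\ \sim\ }\ \bigoplus_{i=1}^h\mathrm{Symb}_{\Gamma_i}(V_{k,k}^*(L))^{\{U_{\mathfrak p}=\lambda_{\mathfrak p}\,:\,\mathfrak p\mid p\}}.$$ -/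

import Mathlib

open scoped NumberField nonZeroDivisors MatrixGroups ZeroAtInfty

namespace Bianchi

noncomputable section

/-- The valuation of `L` with `vp p p = 1` and `vp p 0 = ⊤`, for a norm on `L` that extends the
`p`-adic norm of `ℚ_[p]`. -/
def vp {L : Type*} [NormedField L] (p : ℕ) (x : L) : EReal :=
  open Classical in if x = 0 then ⊤ else ((-Real.logb p ‖x‖ : ℝ) : EReal)

section Functions

variable {L : Type*} [NormedField L]

/-- Rigid analytic functions on the product of two closed unit discs, defined over `L`: the
completed tensor product of two copies of the algebra of rigid analytic functions on the closed unit
disc, i.e. the Tate algebra of power series `∑ f (i, j) x ^ i y ^ j` with coefficients in `L` that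
tend to zero, with the Gauss norm (the maximum of the norms of the coefficients). A function is given
by its family of coefficients. -/
abbrev A2 (L : Type*) [NormedField L] : Type _ := C₀(ℕ × ℕ, L)

/-- The function with coefficients `a`. -/
def A2.mk (a : ℕ × ℕ → L) (ha : Filter.Tendsto a Filter.cofinite (nhds 0)) : A2 L :=
  ⟨⟨a, continuous_of_discreteTopology⟩, by simpa [Filter.cocompact_eq_cofinite] using ha⟩

theorem A2.norm_apply_le (f : A2 L) (x : ℕ × ℕ) : ‖f x‖ ≤ ‖f‖ := by
  rw [← ZeroAtInftyContinuousMap.norm_toBCF_eq_norm]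
  exact BoundedContinuousFunction.norm_coe_le_norm f.toBCF x

theorem A2.norm_le {f : A2 L} {C : ℝ} (hC : 0 ≤ C) (h : ∀ x, ‖f x‖ ≤ C) : ‖f‖ ≤ C := by
  rw [← ZeroAtInftyContinuousMap.norm_toBCF_eq_norm]
  exact (BoundedContinuousFunction.norm_le hC).2 h

theorem A2.tendsto (f : A2 L) : Filter.Tendsto f Filter.cofinite (nhds 0) := by
  simpa [Filter.cocompact_eq_cofinite] using f.zero_at_infty'

instance [IsUltrametricDist L] : IsUltrametricDist (A2 L) :=
  IsUltrametricDist.isUltrametricDist_of_forall_norm_add_le_max_norm fun f g =>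
    A2.norm_le (le_max_of_le_left (norm_nonneg f)) fun x =>
      (IsUltrametricDist.norm_add_le_max (f x) (g x)).trans
        (max_le_max (A2.norm_apply_le f x) (A2.norm_apply_le g x))

/-- Power series in one variable with coefficients of norm at most `1` tending to zero. -/
def integralTate (L : Type*) [NormedField L] [IsUltrametricDist L] : Submonoid (PowerSeries L) where
  carrier := {f | (∀ n, ‖PowerSeries.coeff n f‖ ≤ 1) ∧ PowerSeries.IsRestricted 1 f}
  one_mem' := by
    refine ⟨fun n => ?_, PowerSeries.isRestricted_one 1⟩
    rw [PowerSeries.coeff_one]; split_ifs <;> simp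
  mul_mem' := by
    rintro f g ⟨hf, hf'⟩ ⟨hg, hg'⟩
    refine ⟨fun n => ?_, PowerSeries.isRestricted.mul 1 hf' hg'⟩
    rw [PowerSeries.coeff_mul]
    refine IsUltrametricDist.norm_sum_le_of_forall_le_of_nonneg zero_le_one fun x _ => ?_
    rw [norm_mul]
    exact mul_le_one₀ (hf _) (norm_nonneg _) (hg _)

theorem integralTate.tendsto [IsUltrametricDist L] {f : PowerSeries L} (hf : f ∈ integralTate L) :
    Filter.Tendsto (fun n => PowerSeries.coeff n f) Filter.cofinite (nhds 0) := by
  have := (PowerSeries.isRestricted_iff 1 f).1 hf.2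
  rw [tendsto_zero_iff_norm_tendsto_zero]
  simpa using this

/-- The function `e(x) e'(y)`. -/
def tensor [IsUltrametricDist L] (e e' : integralTate L) : A2 L :=
  A2.mk (fun x => PowerSeries.coeff x.1 (e : PowerSeries L) *
      PowerSeries.coeff x.2 (e' : PowerSeries L)) (by
    have h1 := integralTate.tendsto e.2
    have h2 := integralTate.tendsto e'.2
    rw [Metric.tendsto_nhds] at h1 h2 ⊢
    intro ε hε
    have h1 := h1 ε hε
    have h2 := h2 ε hε
    rw [Filter.eventually_cofinite] at h1 h2 ⊢
    refine (h1.prod h2).subset fun x hx => ?_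
    simp only [Set.mem_prod, Set.mem_ofPred_eq, dist_zero_right, not_lt, norm_mul] at hx ⊢
    exact ⟨hx.trans (mul_le_of_le_one_right (norm_nonneg _) (e'.2.1 _)),
      hx.trans (mul_le_of_le_one_left (norm_nonneg _) (e.2.1 _))⟩)

theorem norm_tensor_le [IsUltrametricDist L] (e e' : integralTate L) : ‖tensor e e'‖ ≤ 1 :=
  A2.norm_le zero_le_one fun x => by
    change ‖PowerSeries.coeff x.1 (e : PowerSeries L) *
      PowerSeries.coeff x.2 (e' : PowerSeries L)‖ ≤ 1
    rw [norm_mul]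
    exact mul_le_one₀ (e.2.1 _) (norm_nonneg _) (e'.2.1 _)

theorem summable_smul [IsUltrametricDist L] [CompleteSpace L] (v : ℕ × ℕ → A2 L)
    (hv : ∀ x, ‖v x‖ ≤ 1) (f : A2 L) : Summable fun x => f x • v x := by
  refine NonarchimedeanAddGroup.summable_of_tendsto_cofinite_zero ?_
  rw [tendsto_zero_iff_norm_tendsto_zero]
  refine squeeze_zero (fun _ => norm_nonneg _) (fun x => ?_)
    (tendsto_zero_iff_norm_tendsto_zero.1 f.tendsto)
  rw [norm_smul]
  exact mul_le_of_le_one_right (norm_nonneg _) (hv x)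

/-- The continuous linear endomorphism of `A2 L` that sends `x ^ i y ^ j` to `v (i, j)`. -/
def extend [IsUltrametricDist L] [CompleteSpace L] (v : ℕ × ℕ → A2 L)
    (hv : ∀ x, ‖v x‖ ≤ 1) : A2 L →L[L] A2 L :=
  LinearMap.mkContinuous
    { toFun := fun f => ∑' x, f x • v x
      map_add' := fun f g => by
        rw [← (summable_smul v hv f).tsum_add (summable_smul v hv g)]
        exact tsum_congr fun x => add_smul (f x) (g x) (v x)
      map_smul' := fun c f => by
        simpa [mul_smul] using (summable_smul v hv f).tsum_const_smul c } 1
    (fun f => by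
      rw [one_mul]
      refine IsUltrametricDist.norm_tsum_le_of_forall_le_of_nonneg (norm_nonneg f) fun x => ?_
      rw [norm_smul]
      exact (mul_le_of_le_one_right (norm_nonneg _) (hv x)).trans (A2.norm_apply_le f x))

theorem extend_apply [IsUltrametricDist L] [CompleteSpace L] (v : ℕ × ℕ → A2 L)
    (hv : ∀ x, ‖v x‖ ≤ 1) (f : A2 L) (m : ℕ × ℕ) :
    extend v hv f m = ∑' x, f x * v x m := by
  let ev : A2 L →L[L] L := LinearMap.mkContinuous
    { toFun := fun g => g m, map_add' := fun _ _ => rfl, map_smul' := fun _ _ => rfl } 1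
    (fun g => by simpa using A2.norm_apply_le g m)
  exact ev.map_tsum (summable_smul v hv f)

end Functions

section Action

variable (p : ℕ) [Fact p.Prime] (L : Type*) [NormedField L] [NormedAlgebra ℚ_[p] L]

theorem norm_prime_lt_one : ‖(p : L)‖ < 1 := by
  have h : ‖algebraMap ℚ_[p] L (p : ℚ_[p])‖ = ‖(p : ℚ_[p])‖ := norm_algebraMap' L _
  rw [map_natCast] at h
  rw [h]
  exact Padic.norm_p_lt_one

/-- The monoid of matrices `!![a, b; c, d]` over the ring of integers of `L` with `p ∣ c`, `a` a
unit, and `a * d - b * c ≠ 0`. -/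
def Sigma0 : Submonoid (Matrix (Fin 2) (Fin 2) L) where
  carrier := {M | (∀ i j, ‖M i j‖ ≤ 1) ∧ ‖M 1 0‖ ≤ ‖(p : L)‖ ∧ ‖M 0 0‖ = 1 ∧ M.det ≠ 0}
  one_mem' := by
    refine ⟨fun i j => ?_, by simp, by simp, by simp⟩
    rw [Matrix.one_apply]; split_ifs <;> simp
  mul_mem' := by
    have : IsUltrametricDist L := IsUltrametricDist.of_normedAlgebra ℚ_[p]
    rintro M N ⟨h1, h2, h3, h4⟩ ⟨k1, k2, k3, k4⟩
    have hp := norm_prime_lt_one p L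
    refine ⟨fun i j => ?_, ?_, ?_, by rw [Matrix.det_mul]; exact mul_ne_zero h4 k4⟩
    · rw [Matrix.mul_apply]
      refine IsUltrametricDist.norm_sum_le_of_forall_le_of_nonneg zero_le_one fun x _ => ?_
      rw [norm_mul]
      exact mul_le_one₀ (h1 _ _) (norm_nonneg _) (k1 _ _)
    · rw [Matrix.mul_apply, Fin.sum_univ_two]
      refine (IsUltrametricDist.norm_add_le_max _ _).trans (max_le ?_ ?_) <;> rw [norm_mul]
      · rw [k3, mul_one]; exact h2
      · exact (mul_le_of_le_one_left (norm_nonneg _) (h1 _ _)).trans k2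
    · rw [Matrix.mul_apply, Fin.sum_univ_two]
      have ha : ‖M 0 0 * N 0 0‖ = 1 := by rw [norm_mul, h3, k3, one_mul]
      have hb : ‖M 0 1 * N 1 0‖ < 1 := by
        rw [norm_mul]
        exact ((mul_le_of_le_one_left (norm_nonneg _) (h1 _ _)).trans k2).trans_lt hp
      rw [IsUltrametricDist.norm_add_eq_max_of_norm_ne_norm (by rw [ha]; exact hb.ne'), ha]
      exact max_eq_left hb.le

variable {p L}

open PowerSeries in
/-- The power series `(a + c x) ^ k * ((b + d x) / (a + c x)) ^ i` for `M = !![a, b; c, d]`: the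
image of the function `x ^ i` under the weight `k` action of `M`. -/
def monomialSeries (k : ℕ) (M : Matrix (Fin 2) (Fin 2) L) (i : ℕ) : PowerSeries L :=
  (C (M 0 0) + C (M 1 0) * X) ^ k *
    ((C (M 0 1) + C (M 1 1) * X) * (C (M 0 0) + C (M 1 0) * X)⁻¹) ^ i

theorem linear_mem [IsUltrametricDist L] {a c : L} (ha : ‖a‖ ≤ 1) (hc : ‖c‖ ≤ 1) :
    PowerSeries.C a + PowerSeries.C c * PowerSeries.X ∈ integralTate L := by
  refine ⟨fun n => ?_, ?_⟩
  · rcases n with _ | _ | n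
    · simpa using ha
    · simpa using hc
    · simp [PowerSeries.coeff_succ_C]
  · refine PowerSeries.isRestricted.add _ (PowerSeries.isRestricted_C _ a)
      (PowerSeries.isRestricted.mul _ (PowerSeries.isRestricted_C _ c) ?_)
    rw [PowerSeries.X_eq]
    exact PowerSeries.isRestricted_monomial _ _ _

theorem linear_inv_mem [IsUltrametricDist L] {a c : L} (ha : ‖a‖ = 1) (hc : ‖c‖ < 1) :
    (PowerSeries.C a + PowerSeries.C c * PowerSeries.X)⁻¹ ∈ integralTate L := by
  have ha0 : a ≠ 0 := by rintro rfl; simp at ha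
  have h : (PowerSeries.C a + PowerSeries.C c * PowerSeries.X)⁻¹ =
      PowerSeries.mk fun n => a⁻¹ * (-(c * a⁻¹)) ^ n := by
    rw [eq_comm, PowerSeries.eq_inv_iff_mul_eq_one (by simpa using ha0)]
    ext n
    rw [mul_add, ← mul_assoc]
    rcases n with _ | n
    · simp [ha0]
    · rw [map_add, PowerSeries.coeff_succ_mul_X, PowerSeries.coeff_mul_C, PowerSeries.coeff_mul_C,
        PowerSeries.coeff_mk, PowerSeries.coeff_mk, PowerSeries.coeff_one, if_neg n.succ_ne_zero]
      have : a * a⁻¹ = 1 := mul_inv_cancel₀ ha0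
      linear_combination (-(c * a⁻¹ * (-(c * a⁻¹)) ^ n)) * this
  have hn : ∀ n, ‖a⁻¹ * (-(c * a⁻¹)) ^ n‖ = ‖c‖ ^ n := fun n => by simp [ha]
  rw [h]
  refine ⟨fun n => ?_, ?_⟩
  · rw [PowerSeries.coeff_mk, hn]
    exact pow_le_one₀ (norm_nonneg _) hc.le
  · rw [PowerSeries.isRestricted_iff']
    simpa [hn, ha] using tendsto_pow_atTop_nhds_zero_of_lt_one (norm_nonneg c) hc

theorem monomialSeries_mem (k : ℕ) (M : Sigma0 p L) (i : ℕ) :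
    haveI : IsUltrametricDist L := IsUltrametricDist.of_normedAlgebra ℚ_[p]
    monomialSeries k (M : Matrix (Fin 2) (Fin 2) L) i ∈ integralTate L := by
  have : IsUltrametricDist L := IsUltrametricDist.of_normedAlgebra ℚ_[p]
  obtain ⟨M, h1, h2, h3, h4⟩ := M
  exact mul_mem (pow_mem (linear_mem (h1 _ _) (h1 _ _)) _)
    (pow_mem (mul_mem (linear_mem (h1 _ _) (h1 _ _))
      (linear_inv_mem h3 (h2.trans_lt (norm_prime_lt_one p L)))) _)

theorem coeff_monomialSeries (k : ℕ) (M : Sigma0 p L) {i m : ℕ} (hi : i ≤ k) (hm : k < m) :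
    PowerSeries.coeff m (monomialSeries k (M : Matrix (Fin 2) (Fin 2) L) i) = 0 := by
  obtain ⟨M, h1, h2, h3, h4⟩ := M
  have ha0 : M 0 0 ≠ 0 := by intro h; rw [h] at h3; simp at h3
  obtain ⟨j, rfl⟩ := Nat.exists_eq_add_of_le hi
  let P : Polynomial L := (Polynomial.C (M 0 0) + Polynomial.C (M 1 0) * Polynomial.X) ^ j *
    (Polynomial.C (M 0 1) + Polynomial.C (M 1 1) * Polynomial.X) ^ i
  have hP : monomialSeries (i + j) M i = (P : PowerSeries L) := by
    have hu : (PowerSeries.C (M 0 0) + PowerSeries.C (M 1 0) * PowerSeries.X) *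
        (PowerSeries.C (M 0 0) + PowerSeries.C (M 1 0) * PowerSeries.X)⁻¹ = 1 :=
      PowerSeries.mul_inv_cancel _ (by simpa using ha0)
    simp only [monomialSeries, P, Polynomial.coe_mul, Polynomial.coe_pow, Polynomial.coe_add,
      Polynomial.coe_C, Polynomial.coe_X]
    generalize (PowerSeries.C (M 0 0) + PowerSeries.C (M 1 0) * PowerSeries.X)⁻¹ = w at hu ⊢
    generalize PowerSeries.C (M 0 0) + PowerSeries.C (M 1 0) * PowerSeries.X = u at hu ⊢
    generalize PowerSeries.C (M 0 1) + PowerSeries.C (M 1 1) * PowerSeries.X = t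
    calc u ^ (i + j) * (t * w) ^ i = (u * w) ^ i * (u ^ j * t ^ i) := by ring
      _ = u ^ j * t ^ i := by rw [hu, one_pow, one_mul]
  have hl : ∀ a c : L, (Polynomial.C a + Polynomial.C c * Polynomial.X).natDegree ≤ 1 :=
    fun a c => by compute_degree
  have hdeg : P.natDegree ≤ i + j := by
    refine Polynomial.natDegree_mul_le.trans ?_
    have := Polynomial.natDegree_pow_le_of_le j (hl (M 0 0) (M 1 0))
    have := Polynomial.natDegree_pow_le_of_le i (hl (M 0 1) (M 1 1))
    omega
  change PowerSeries.coeff m (monomialSeries (i + j) M i) = 0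
  rw [hP, Polynomial.coeff_coe]
  exact Polynomial.coeff_eq_zero_of_natDegree_lt (hdeg.trans_lt hm)

variable [FiniteDimensional ℚ_[p] L]

/-- The weight `(k, k)` left action of a pair of matrices `γ_s = !![a_s, b_s; c_s, d_s]` on functions,
`f(x, y) ↦ (a₁ + c₁x)^k (a₂ + c₂y)^k f((b₁ + d₁x) / (a₁ + c₁x), (b₂ + d₂y) / (a₂ + c₂y))`,
expanded in powers of `x` and `y`: the continuous linear map with the prescribed value at each
monomial `x ^ i y ^ j`. -/
def actA (k : ℕ) (γ₁ γ₂ : Sigma0 p L) : A2 L →L[L] A2 L :=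
  haveI : IsUltrametricDist L := IsUltrametricDist.of_normedAlgebra ℚ_[p]
  haveI : CompleteSpace L := FiniteDimensional.complete ℚ_[p] L
  extend (fun x => tensor ⟨_, monomialSeries_mem k γ₁ x.1⟩ ⟨_, monomialSeries_mem k γ₂ x.2⟩)
    fun _ => norm_tensor_le _ _

theorem actA_apply (k : ℕ) (γ₁ γ₂ : Sigma0 p L) (f : A2 L) (m : ℕ × ℕ) :
    actA k γ₁ γ₂ f m = ∑' x : ℕ × ℕ, f x *
      (PowerSeries.coeff m.1 (monomialSeries k (γ₁ : Matrix (Fin 2) (Fin 2) L) x.1) *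
        PowerSeries.coeff m.2 (monomialSeries k (γ₂ : Matrix (Fin 2) (Fin 2) L) x.2)) :=
  haveI : IsUltrametricDist L := IsUltrametricDist.of_normedAlgebra ℚ_[p]
  haveI : CompleteSpace L := FiniteDimensional.complete ℚ_[p] L
  extend_apply _ _ f m

variable (L) in
/-- The space `V_{k,k}(L)` of polynomials of degree at most `k` in each of the two variables, as
a subspace of `A2 L`: the tensor square of the space of binary forms of degree `k`, dehomogenised. -/
def V (k : ℕ) : Submodule L (A2 L) where
  carrier := {f | ∀ x : ℕ × ℕ, (k < x.1 ∨ k < x.2) → f x = 0}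
  zero_mem' := fun _ _ => rfl
  add_mem' := fun {f g} hf hg x hx => by
    rw [ZeroAtInftyContinuousMap.add_apply, hf x hx, hg x hx, add_zero]
  smul_mem' := fun c f hf x hx => by
    rw [ZeroAtInftyContinuousMap.smul_apply, hf x hx, smul_zero]

theorem actA_mem_V (k : ℕ) (γ₁ γ₂ : Sigma0 p L) (f : A2 L) (hf : f ∈ V L k) :
    actA k γ₁ γ₂ f ∈ V L k := by
  intro m hm
  rw [actA_apply]
  refine (tsum_congr fun x => ?_).trans tsum_zero
  by_cases hx : k < x.1 ∨ k < x.2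
  · rw [hf x hx, zero_mul]
  · push Not at hx
    rcases hm with hm | hm
    · rw [coeff_monomialSeries k γ₁ hx.1 hm, zero_mul, mul_zero]
    · rw [coeff_monomialSeries k γ₂ hx.2 hm, mul_zero, mul_zero]

/-- Rigid analytic distributions in two variables: the topological dual of `A2 L`. -/
abbrev D (L : Type*) [NormedField L] : Type _ := A2 L →L[L] L

/-- The dual of `V_{k,k}(L)`. -/
abbrev VDual (L : Type*) [NormedField L] (k : ℕ) : Type _ := Module.Dual L (V L k)

/-- The weight `(k, k)` right action on distributions, `(μ | γ)(f) = μ(γ · f)`. -/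
def actD (k : ℕ) (γ₁ γ₂ : Sigma0 p L) : D L →ₗ[L] D L where
  toFun μ := μ.comp (actA k γ₁ γ₂)
  map_add' _ _ := rfl
  map_smul' _ _ := rfl

/-- The right action on the dual of `V_{k,k}(L)`, `(μ | γ)(P) = μ(γ · P)`. -/
def actVDual (k : ℕ) (γ₁ γ₂ : Sigma0 p L) : VDual L k →ₗ[L] VDual L k :=
  Module.Dual.transpose ((actA k γ₁ γ₂ : A2 L →ₗ[L] A2 L).restrict (actA_mem_V k γ₁ γ₂))

/-- Restriction of distributions to polynomials, dual to the inclusion of `V_{k,k}(L)` in `A2 L`. -/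
def specialise (k : ℕ) : D L →ₗ[L] VDual L k where
  toFun μ := (μ : A2 L →ₗ[L] L) ∘ₗ (V L k).subtype
  map_add' _ _ := rfl
  map_smul' _ _ := rfl

end Action

section Symbols

variable (K : Type*) [Field K]

/-- The degree of a divisor on the projective line over `K`. -/
def degree : (OnePoint K →₀ ℤ) →+ ℤ := Finsupp.liftAddHom fun _ => AddMonoidHom.id ℤ

/-- Divisors of degree zero on the projective line `K ∪ {∞}`. -/
def Div0 : AddSubgroup (OnePoint K →₀ ℤ) := (degree K).ker

variable {K}

open Classical in
/-- The left action on divisors by fractional linear transformations. -/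
def moveDiv (g : GL (Fin 2) K) : Div0 K →+ Div0 K :=
  ((Finsupp.mapDomain.addMonoidHom (g • ·)).comp (Div0 K).subtype).codRestrict (Div0 K)
    fun x => by
      obtain ⟨x, hx⟩ := x
      have h : (degree K).comp (Finsupp.mapDomain.addMonoidHom (g • ·)) = degree K := by
        ext; simp [degree]
      exact (DFunLike.congr_fun h x).trans hx

variable {p : ℕ} [Fact p.Prime] {L : Type*} [NormedField L] [NormedAlgebra ℚ_[p] L]
variable {M : Type*} [AddCommGroup M] [Module L M]

open Classical in
/-- The right action of a matrix over `K` through its two images over `L`. It is the zero map, by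
convention, for matrices whose images do not lie in `Sigma0`; no such matrix is ever used, see
`levelGroup_mem_Sigma0` and `heckeMatrix_mem_Sigma0`. -/
def actGL (act : Sigma0 p L → Sigma0 p L → M →ₗ[L] M) (σ : Fin 2 → K →+* L)
    (g : GL (Fin 2) K) : M →ₗ[L] M :=
  if h : ∀ s, (g : Matrix (Fin 2) (Fin 2) K).map (σ s) ∈ Sigma0 p L then
    act ⟨_, h 0⟩ ⟨_, h 1⟩ else 0

/-- The right action on homomorphisms, `(φ | g)(E) = φ(g E) | g`. -/
def slash (act : Sigma0 p L → Sigma0 p L → M →ₗ[L] M) (σ : Fin 2 → K →+* L)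
    (g : GL (Fin 2) K) : (Div0 K →+ M) →ₗ[L] (Div0 K →+ M) where
  toFun φ := (actGL act σ g).toAddMonoidHom.comp (φ.comp (moveDiv g))
  map_add' φ ψ := by ext; simp
  map_smul' c φ := by ext; simp

/-- Modular symbols for `Γ` with values in `M`. -/
def Symb (act : Sigma0 p L → Sigma0 p L → M →ₗ[L] M) (σ : Fin 2 → K →+* L)
    (Γ : Subgroup SL(2, K)) : Submodule L (Div0 K →+ M) where
  carrier := {φ | ∀ γ ∈ Γ, slash act σ γ φ = φ}
  zero_mem' γ _ := map_zero _
  add_mem' hφ hψ γ hγ := by rw [map_add, hφ γ hγ, hψ γ hγ]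
  smul_mem' c φ hφ γ hγ := by rw [map_smul, hφ γ hγ]

end Symbols

section Embeddings

variable {K : Type*} [Field K] {L : Type*} [NormedField L]

theorem norm_embedding_le_one (p : ℕ) [Fact p.Prime] [NormedAlgebra ℚ_[p] L] (s : K →+* L)
    (x : 𝓞 K) : ‖s x‖ ≤ 1 := by
  have : IsUltrametricDist L := IsUltrametricDist.of_normedAlgebra ℚ_[p]
  have hx : IsIntegral ℤ (s x) := (NumberField.RingOfIntegers.isIntegral_coe x).map s.toIntAlgHom
  exact (Valuation.integer.integers (NormedField.valuation (K := L))).mem_of_integral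
    (hx.tower_top)

variable {p : ℕ} [Fact p.Prime] [NormedAlgebra ℚ_[p] L]

theorem norm_embedding_le_of_coprime (s : K →+* L) {J : Ideal (𝓞 K)}
    (hJ : IsCoprime J (Ideal.span {(p : 𝓞 K)})) {x : K} {C : ℝ}
    (h : ∀ t ∈ J, ‖s (x * (t : K))‖ ≤ C) : ‖s x‖ ≤ C := by
  have : IsUltrametricDist L := IsUltrametricDist.of_normedAlgebra ℚ_[p]
  obtain ⟨t, ht, u, hu, htu⟩ := Ideal.isCoprime_iff_exists.1 hJ
  obtain ⟨w, rfl⟩ := Ideal.mem_span_singleton'.1 hu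
  have h1 : s (t : K) = 1 - s (w : K) * (p : L) := by
    have := congrArg (fun z : 𝓞 K => s (z : K)) htu
    simp only [map_add, map_mul, map_natCast, map_one] at this
    exact eq_sub_of_add_eq this
  have h2 : ‖s (w : K) * (p : L)‖ < 1 := by
    rw [norm_mul]
    exact (mul_le_of_le_one_left (norm_nonneg _) (norm_embedding_le_one p s w)).trans_lt
      (norm_prime_lt_one p L)
  have h3 : ‖s (t : K)‖ = 1 := by
    rw [h1, sub_eq_add_neg, IsUltrametricDist.norm_add_eq_max_of_norm_ne_norm
      (by rw [norm_one, norm_neg]; exact h2.ne'), norm_one, norm_neg]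
    exact max_eq_left h2.le
  have := h t ht
  rwa [map_mul, norm_mul, h3, mul_one] at this

theorem norm_embedding_le_of_mem (s : K →+* L) {𝔫 : Ideal (𝓞 K)}
    (hp : Ideal.span {(p : 𝓞 K)} ∣ 𝔫) {x : K} (hx : x ∈ (𝔫 : FractionalIdeal (𝓞 K)⁰ K)) :
    ‖s x‖ ≤ ‖(p : L)‖ := by
  obtain ⟨y, hy, rfl⟩ := (FractionalIdeal.mem_coeIdeal _).1 hx
  obtain ⟨w, rfl⟩ := Ideal.mem_span_singleton'.1 (Ideal.le_of_dvd hp hy)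
  simp only [map_mul, map_natCast, norm_mul]
  exact mul_le_of_le_one_left (norm_nonneg _) (norm_embedding_le_one p s w)

end Embeddings

section Level

variable {K : Type*} [Field K] [NumberField K]

open FractionalIdeal in
/-- The twist of `Γ₁(𝔫)` by `I`: matrices `!![a, b; c, d]` of determinant one over `K` with
`a, d ∈ 1 + 𝔫`, `b ∈ I`, `c ∈ 𝔫 I⁻¹`. -/
def levelGroup (𝔫 : Ideal (𝓞 K)) (I : (Ideal (𝓞 K))⁰) : Subgroup SL(2, K) where
  carrier := {γ | γ 0 0 - 1 ∈ (𝔫 : FractionalIdeal (𝓞 K)⁰ K) ∧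
    γ 1 1 - 1 ∈ (𝔫 : FractionalIdeal (𝓞 K)⁰ K) ∧
    γ 0 1 ∈ ((I : Ideal (𝓞 K)) : FractionalIdeal (𝓞 K)⁰ K) ∧
    γ 1 0 ∈ (𝔫 : FractionalIdeal (𝓞 K)⁰ K) * ((I : Ideal (𝓞 K)) : FractionalIdeal (𝓞 K)⁰ K)⁻¹}
  one_mem' := by simp [FractionalIdeal.zero_mem]
  mul_mem' := by
    rintro γ δ ⟨h1, h2, h3, h4⟩ ⟨k1, k2, k3, k4⟩
    have hI : ((I : Ideal (𝓞 K)) : FractionalIdeal (𝓞 K)⁰ K) ≠ 0 :=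
      coeIdeal_ne_zero.2 (nonZeroDivisors.ne_zero I.2)
    have add_mem : ∀ {J : FractionalIdeal (𝓞 K)⁰ K} {x y : K}, x ∈ J → y ∈ J → x + y ∈ J :=
      fun {J} _ _ hx hy => J.val.add_mem hx hy
    have hn : ∀ x y : K, x - 1 ∈ (𝔫 : FractionalIdeal (𝓞 K)⁰ K) →
        y - 1 ∈ (𝔫 : FractionalIdeal (𝓞 K)⁰ K) → x * y - 1 ∈ (𝔫 : FractionalIdeal (𝓞 K)⁰ K) := by
      intro x y hx hy
      have : x * y - 1 = (x - 1) * (y - 1) + (x - 1) + (y - 1) := by ring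
      rw [this]
      refine add_mem (add_mem ?_ hx) hy
      have := mul_mem_mul hx hy
      rw [← coeIdeal_mul] at this
      exact coeIdeal_le_coeIdeal K |>.2 Ideal.mul_le_left this
    have hmul : ∀ (J : FractionalIdeal (𝓞 K)⁰ K) (x y : K),
        x - 1 ∈ (𝔫 : FractionalIdeal (𝓞 K)⁰ K) → y ∈ J → x * y ∈ J := by
      intro J x y hx hy
      obtain ⟨r, -, hr⟩ := (mem_coeIdeal _).1 hx
      have : x * y = r • y + y := by
        rw [Algebra.smul_def, show (algebraMap (𝓞 K) K) r = x - 1 from hr]; ring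
      rw [this]
      exact add_mem (J.val.smul_mem r hy) hy
    have hbc : ∀ b c : K, b ∈ ((I : Ideal (𝓞 K)) : FractionalIdeal (𝓞 K)⁰ K) →
        c ∈ (𝔫 : FractionalIdeal (𝓞 K)⁰ K) * ((I : Ideal (𝓞 K)) : FractionalIdeal (𝓞 K)⁰ K)⁻¹ →
        c * b ∈ (𝔫 : FractionalIdeal (𝓞 K)⁰ K) := by
      intro b c hb hc
      have := mul_mem_mul hc hb
      rwa [mul_assoc, inv_mul_cancel₀ hI, mul_one] at this
    refine ⟨?_, ?_, ?_, ?_⟩ <;>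
      simp only [Matrix.SpecialLinearGroup.coe_mul, Matrix.mul_apply, Fin.sum_univ_two]
    · rw [add_sub_right_comm]
      exact add_mem (hn _ _ h1 k1) (mul_comm (δ 1 0) (γ 0 1) ▸ hbc _ _ h3 k4)
    · rw [add_sub_assoc]
      exact add_mem (hbc _ _ k3 h4) (hn _ _ h2 k2)
    · exact add_mem (hmul _ _ _ h1 k3) (mul_comm (δ 1 1) (γ 0 1) ▸ hmul _ _ _ k2 h3)
    · exact add_mem (mul_comm (δ 0 0) (γ 1 0) ▸ hmul _ _ _ k1 h4) (hmul _ _ _ h2 k4)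
  inv_mem' := by
    rintro γ ⟨h1, h2, h3, h4⟩
    have hneg : ∀ (J : FractionalIdeal (𝓞 K)⁰ K) (x : K), x ∈ J → -x ∈ J :=
      fun J x hx => J.val.neg_mem hx
    refine ⟨?_, ?_, ?_, ?_⟩ <;> simp only [Matrix.SpecialLinearGroup.coe_inv,
      Matrix.adjugate_fin_two, Matrix.of_apply, Matrix.cons_val', Matrix.cons_val_zero,
      Matrix.cons_val_one, Matrix.cons_val_fin_one]
    exacts [h2, h1, hneg _ _ h3, hneg _ _ h4]

/-- The choices in the definition of the Hecke operator at `𝔭`, for ideals `I i` that represent the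
class group: for each `i`, the index `j i` and a generator `α i` with `𝔭 * I i = (α i) * I (j i)`, and
representatives in `I i` of the residue classes modulo `𝔭`. -/
structure HeckeChoice (I : Fin (NumberField.classNumber K) → (Ideal (𝓞 K))⁰)
    (𝔭 : Ideal (𝓞 K)) where
  j : Fin (NumberField.classNumber K) → Fin (NumberField.classNumber K)
  α : Fin (NumberField.classNumber K) → Kˣ
  mul_eq : ∀ i, (𝔭 : FractionalIdeal (𝓞 K)⁰ K) * ((I i : Ideal (𝓞 K)) : FractionalIdeal (𝓞 K)⁰ K) =
    FractionalIdeal.spanSingleton (𝓞 K)⁰ (α i : K) *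
      ((I (j i) : Ideal (𝓞 K)) : FractionalIdeal (𝓞 K)⁰ K)
  rep : Fin (NumberField.classNumber K) → 𝓞 K ⧸ 𝔭 → 𝓞 K
  rep_mem : ∀ i a, rep i a ∈ (I i : Ideal (𝓞 K))
  mk_rep : ∀ i a, Ideal.Quotient.mk 𝔭 (rep i a) = a

/-- The matrix `!![1, a; 0, α]`. -/
def heckeMatrix (a : K) (α : Kˣ) : GL (Fin 2) K :=
  Matrix.GeneralLinearGroup.mkOfDetNeZero !![1, a; 0, (α : K)] (by simp)

variable {p : ℕ} [Fact p.Prime] {L : Type*} [NormedField L] [NormedAlgebra ℚ_[p] L]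
variable {M : Type*} [AddCommGroup M] [Module L M]
variable {I : Fin (NumberField.classNumber K) → (Ideal (𝓞 K))⁰} {𝔭 : Ideal (𝓞 K)}

/-- The level groups act through `Sigma0`. -/
theorem levelGroup_mem_Sigma0 (s : K →+* L) {𝔫 : Ideal (𝓞 K)}
    (hp : Ideal.span {(p : 𝓞 K)} ∣ 𝔫) {J : (Ideal (𝓞 K))⁰} (hJ : IsCoprime (J : Ideal (𝓞 K)) 𝔫)
    {γ : SL(2, K)} (hγ : γ ∈ levelGroup 𝔫 J) :
    (γ : Matrix (Fin 2) (Fin 2) K).map s ∈ Sigma0 p L := by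
  have : IsUltrametricDist L := IsUltrametricDist.of_normedAlgebra ℚ_[p]
  obtain ⟨h1, h2, h3, h4⟩ := hγ
  have hJp : IsCoprime (J : Ideal (𝓞 K)) (Ideal.span {(p : 𝓞 K)}) := by
    obtain ⟨r, rfl⟩ := hp
    exact hJ.of_mul_right_left
  have hJ0 : ((J : Ideal (𝓞 K)) : FractionalIdeal (𝓞 K)⁰ K) ≠ 0 :=
    FractionalIdeal.coeIdeal_ne_zero.2 (nonZeroDivisors.ne_zero J.2)
  have hp1 := norm_prime_lt_one p L
  have hunit : ∀ x : K, x - 1 ∈ (𝔫 : FractionalIdeal (𝓞 K)⁰ K) → ‖s x‖ = 1 := by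
    intro x hx
    have h := (norm_embedding_le_of_mem s hp hx).trans_lt hp1
    have hx : s x = s (x - 1) + 1 := by rw [map_sub, map_one]; ring
    rw [hx, IsUltrametricDist.norm_add_eq_max_of_norm_ne_norm (by rw [norm_one]; exact h.ne),
      norm_one]
    exact max_eq_right h.le
  have hc : ‖s (γ 1 0)‖ ≤ ‖(p : L)‖ := by
    refine norm_embedding_le_of_coprime s hJp fun t ht => norm_embedding_le_of_mem s hp ?_
    have := FractionalIdeal.mul_mem_mul h4 (FractionalIdeal.mem_coeIdeal_of_mem (𝓞 K)⁰ ht)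
    rwa [mul_assoc, inv_mul_cancel₀ hJ0, mul_one] at this
  have hb : ‖s (γ 0 1)‖ ≤ 1 := by
    obtain ⟨y, -, hy⟩ := (FractionalIdeal.mem_coeIdeal _).1 h3
    rw [← hy]
    exact norm_embedding_le_one p s y
  refine ⟨fun i j => ?_, hc, hunit _ h1, ?_⟩
  · fin_cases i <;> fin_cases j
    exacts [(hunit _ h1).le, hb, hc.trans hp1.le, (hunit _ h2).le]
  · have := RingHom.map_det s (γ : Matrix (Fin 2) (Fin 2) K)
    rw [RingHom.mapMatrix_apply] at this
    rw [← this, γ.det_coe, map_one]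
    exact one_ne_zero

/-- The matrices occurring in the Hecke operators act through `Sigma0`. -/
theorem heckeMatrix_mem_Sigma0 (s : K →+* L)
    (hI : ∀ i, IsCoprime (I i : Ideal (𝓞 K)) (Ideal.span {(p : 𝓞 K)}))
    (c : HeckeChoice I 𝔭) (i : Fin (NumberField.classNumber K)) (a : 𝓞 K ⧸ 𝔭) :
    (heckeMatrix (c.rep i a : K) (c.α i) : Matrix (Fin 2) (Fin 2) K).map s ∈ Sigma0 p L := by
  have hα : ‖s (c.α i : K)‖ ≤ 1 := by
    refine norm_embedding_le_of_coprime s (hI (c.j i)) fun t ht => ?_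
    have h := FractionalIdeal.mul_mem_mul
      (FractionalIdeal.mem_spanSingleton_self (𝓞 K)⁰ (c.α i : K))
      (FractionalIdeal.mem_coeIdeal_of_mem (𝓞 K)⁰ ht)
    rw [← c.mul_eq, ← FractionalIdeal.coeIdeal_mul] at h
    obtain ⟨y, -, hy⟩ := (FractionalIdeal.mem_coeIdeal _).1 h
    rw [← hy]
    exact norm_embedding_le_one p s y
  refine ⟨fun i' j' => ?_, ?_, ?_, ?_⟩
  · fin_cases i' <;> fin_cases j'
    · simp [heckeMatrix]
    · simpa [heckeMatrix] using norm_embedding_le_one p s (c.rep i a)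
    · simp [heckeMatrix]
    · simpa [heckeMatrix] using hα
  · simp [heckeMatrix]
  · simp [heckeMatrix]
  · simp [heckeMatrix, Matrix.det_fin_two]

/-- The Hecke operator `U` at `𝔭`: the `i`-th component of `φ | U` is the sum of the
`φ (j i) | !![1, a; 0, α i]` over the representatives `a ∈ I i` of the residue classes modulo `𝔭`.
These matrices represent the cosets `Γ_(j i) \ Γ_(j i) !![1, 0; 0, α i] Γ_i`, where `Γ_i` is the
twist by `I i` of a group `Γ₁(𝔫)` with `𝔭 ∣ 𝔫`. -/
def heckeU (act : Sigma0 p L → Sigma0 p L → M →ₗ[L] M) (σ : Fin 2 → K →+* L)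
    (c : HeckeChoice I 𝔭) :
    Module.End L (Fin (NumberField.classNumber K) → Div0 K →+ M) :=
  LinearMap.pi fun i =>
    (∑ᶠ a : 𝓞 K ⧸ 𝔭, slash act σ (heckeMatrix (c.rep i a : K) (c.α i))) ∘ₗ LinearMap.proj (c.j i)


/-- Modular symbols of level `Ω₁(𝔫)`: the direct sum, over the class group, of the spaces of modular
symbols for the twists of `Γ₁(𝔫)`. -/
def bianchiSymbols (act : Sigma0 p L → Sigma0 p L → M →ₗ[L] M) (σ : Fin 2 → K →+* L)
    (𝔫 : Ideal (𝓞 K)) (I : Fin (NumberField.classNumber K) → (Ideal (𝓞 K))⁰) :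
    Submodule L (Fin (NumberField.classNumber K) → Div0 K →+ M) :=
  Submodule.pi Set.univ fun i => Symb act σ (levelGroup 𝔫 (I i))

/-- The simultaneous eigenspace, in the modular symbols of level `Ω₁(𝔫)`, of the Hecke operators at
the ideals `𝔭 q` with eigenvalues `lam q`. -/
def eigenSymbols (act : Sigma0 p L → Sigma0 p L → M →ₗ[L] M) (σ : Fin 2 → K →+* L)
    (𝔫 : Ideal (𝓞 K)) {ι : Type*} {𝔭 : ι → Ideal (𝓞 K)} (c : ∀ q, HeckeChoice I (𝔭 q))
    (lam : ι → L) : Submodule L (Fin (NumberField.classNumber K) → Div0 K →+ M) :=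
  bianchiSymbols act σ 𝔫 I ⊓ ⨅ q, Module.End.eigenspace (heckeU act σ (c q)) (lam q)

variable (K) in
/-- The specialisation map on tuples of distribution-valued symbols. -/
def specialisation (L : Type*) [NormedField L] (k : ℕ) :
    (Fin (NumberField.classNumber K) → Div0 K →+ D L) →ₗ[L]
      (Fin (NumberField.classNumber K) → Div0 K →+ VDual L k) where
  toFun Φ i := (specialise k : D L →ₗ[L] VDual L k).toAddMonoidHom.comp (Φ i)
  map_add' _ _ := by ext; rfl
  map_smul' _ _ := by ext; rfl

end Level

end
end Bianchi

open Bianchi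

namespace Bianchi

/-! Specialisation factors through the dual of the functions that are polynomial of degree at most
`k` in `x` and arbitrary in `y`. The excess degrees in `x` are controlled by the prime above `p` cut
out by `σ 0`, those in `y` by the prime cut out by `σ 1`. Let `f` be one of the two restriction
maps, `T` the Hecke operator at the corresponding prime and `λ` its eigenvalue. The matrices `!![1,
a; 0, α]` in `T` scale coefficients of degree `m` in that variable by at most `‖σ α‖ ^ m`, where `‖σ
α‖ ≤ p ^ (-1/e)`. Functionals that vanish on degrees at most `k` are therefore shrunk by `ρ = p ^
(-(k+1)/e)`, and the slope hypothesis says precisely that `ρ < ‖λ‖` (`contracts_restrictD1`,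
`contracts_restrictV`, `rpow_lt_norm_of_vp_lt`).

Modular symbols are bounded, because an approximation argument writes each degree-zero divisor in
terms of divisors from finitely many orbits of a congruence subgroup, and the action does not
increase norms (`CongruenceInvariant.bounded`, `exists_bound_of_mem_Symb`). Hence an eigensymbol in
the kernel of `f` is a bounded family fixed by the strict contraction `λ⁻¹ T`, and so is zero; this
gives injectivity.

For surjectivity (`postcomp_surjective`), a linear section of `f` gives a bounded additive lift, and
inverting `T - λ` on bounded kernel-valued tuples by a geometric series corrects it to an
eigenvector `Φ` of `T`. The remaining conditions follow by contraction again. The defect of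
invariance `Φ|γ - Φ` is bounded and kernel-valued, and `T` expresses it through other such defects,
since right multiplication by `γ` permutes the cosets. The defect `(R - λ')Φ` for another Hecke
operator `R` is bounded, kernel-valued and an eigenvector of a power of `T`. A power is used because
the multipliers `α i` are arbitrary choices of generators: raising `T` to the class number times the
number of roots of unity makes its multipliers independent of `i`, after which it commutes with `R`
(`IsHecke.exists_pow_comm`). -/

/-! ### Approximation in a quadratic field -/

/-- **Dirichlet approximation** with the norm form of a quadratic field. -/
theorem exists_approx (K : Type*) [Field K] [NumberField K] [Algebra.IsQuadraticExtension ℚ K] :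
    ∃ C : ℤ, ∀ a c : 𝓞 K, c ≠ 0 → ∃ b d : 𝓞 K, (b ≠ 0 ∨ d ≠ 0) ∧
      |Algebra.norm ℤ d| < |Algebra.norm ℤ c| ∧ |Algebra.norm ℤ (a * d - b * c)| ≤ C := by
  classical
  let B := NumberField.RingOfIntegers.basis K
  let ι := Module.Free.ChooseBasisIndex ℤ (𝓞 K)
  have hι : Fintype.card ι = 2 := by
    rw [← Module.finrank_eq_card_basis B, NumberField.RingOfIntegers.rank,
      Algebra.IsQuadraticExtension.finrank_eq_two]
  set κ := ClassGroup.normBound AbsoluteValue.abs B with hκdef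
  have hκ : 0 < κ := ClassGroup.normBound_pos AbsoluteValue.abs B
  have hnorm : ∀ (x : 𝓞 K) (y : ℤ), (∀ i, |B.repr x i| ≤ y) → |Algebra.norm ℤ x| ≤ κ * y ^ 2 := by
    intro x y h
    have := ClassGroup.norm_le AbsoluteValue.abs B x (y := y) h
    rwa [show Fintype.card _ = 2 from hι] at this
  -- The term `κ` serves denominators of small norm, approximated by `1 / 0`; the term `4 * κ ^ 2`
  -- comes from the pigeonhole argument.
  refine ⟨max κ (4 * κ ^ 2), fun a c hc => ?_⟩
  set N := Algebra.norm ℤ c with hN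
  have hN0 : N ≠ 0 := Algebra.norm_ne_zero_iff.2 hc
  by_cases hsmall : |N| ≤ κ
  · refine ⟨1, 0, Or.inl one_ne_zero, by simpa using hN0, ?_⟩
    rw [mul_zero, one_mul, zero_sub]
    have : |Algebra.norm ℤ (-c)| = |N| := by
      rw [neg_eq_neg_one_mul, map_mul, abs_mul]
      have : IsUnit (Algebra.norm ℤ (-1 : 𝓞 K)) := (isUnit_one.neg).map _
      rw [Int.isUnit_iff_abs_eq.1 this, one_mul]
    rw [this]
    exact hsmall.trans (le_max_left _ _)
  push Not at hsmall
  have hnpos : 0 < |N| := abs_pos.2 hN0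
  -- `m` is about `√(|N| / κ)`: the largest side for which elements with coordinates at most `m`
  -- still have norm below `|N|`.
  obtain ⟨m, hm1, hmlt, hmge⟩ : ∃ m : ℕ, 1 ≤ m ∧ κ * (m : ℤ) ^ 2 < |N| ∧
      |N| ≤ κ * ((m : ℤ) + 1) ^ 2 := by
    have hq : 0 ≤ (|N| - 1) / κ := Int.ediv_nonneg (by lia) hκ.le
    obtain ⟨t, ht⟩ := Int.eq_ofNat_of_zero_le hq
    have hle : κ * ((|N| - 1) / κ) ≤ |N| - 1 := Int.mul_ediv_self_le hκ.ne'
    have hgt : |N| - 1 < κ * ((|N| - 1) / κ) + κ := Int.lt_mul_ediv_self_add hκ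
    have h1 : (1 : ℤ) ≤ (|N| - 1) / κ := (Int.le_ediv_iff_mul_le hκ).2 (by lia)
    have ha : (Nat.sqrt t : ℤ) ^ 2 ≤ t := by exact_mod_cast Nat.sqrt_le' t
    have hb : (t : ℤ) + 1 ≤ ((Nat.sqrt t : ℤ) + 1) ^ 2 := by
      exact_mod_cast Nat.succ_le_succ_sqrt' t
    rw [ht] at hle hgt h1
    refine ⟨Nat.sqrt t, ?_, ?_, ?_⟩
    · have h1' : 1 ≤ t := by exact_mod_cast h1
      exact Nat.le_sqrt.2 (by simpa using h1')
    · nlinarith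
    · nlinarith
  -- With `c * c' = |N|`, dividing by `c` becomes multiplying by `c'` and dividing by an integer,
  -- which can be done coordinatewise.
  obtain ⟨c', hc'⟩ : c ∣ (algebraMap ℤ (𝓞 K) |N|) := by
    have h := Ideal.absNorm_mem (Ideal.span {c})
    rw [Ideal.absNorm_span_singleton, Ideal.mem_span_singleton, ← Int.cast_natCast,
      Int.natCast_natAbs] at h
    exact h
  have hNc' : |Algebra.norm ℤ c'| = |N| := by
    have h := congrArg (fun x => |Algebra.norm ℤ x|) hc'
    simp only [map_mul, abs_mul] at h
    rw [Algebra.norm_algebraMap_of_basis B, hι, abs_pow, abs_abs, sq] at h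
    exact (mul_left_cancel₀ hnpos.ne' h).symm
  let pt : (ι → Fin (m + 1)) → 𝓞 K := fun x => ∑ i, ((x i : ℕ) : ℤ) • B i
  have hpt : ∀ x i, B.repr (pt x) i = (x i : ℕ) := fun x i => by
    simp only [pt]
    rw [B.repr_sum_self]
  let r : (ι → Fin (m + 1)) → ι → ℤ := fun x i => B.repr (a * pt x * c') i % |N|
  have hr0 : ∀ x i, 0 ≤ r x i := fun x i => Int.emod_nonneg _ hnpos.ne'
  have hr1 : ∀ x i, r x i < |N| := fun x i => Int.emod_lt_of_pos _ hnpos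
  -- The fractional parts of the coordinates of `a * pt x / c` fill a unit square, cut here into `m
  -- ^ 2` boxes; there are `(m + 1) ^ 2` points.
  let box : (ι → Fin (m + 1)) → ι → Fin m := fun x i =>
    ⟨(r x i * m / |N|).toNat, by
      have h1 : r x i * m / |N| < m := (Int.ediv_lt_iff_lt_mul hnpos).2 (by
        have := hr1 x i
        have : (1 : ℤ) ≤ m := by exact_mod_cast hm1
        nlinarith)
      have h2 : 0 ≤ r x i * m / |N| := Int.ediv_nonneg (mul_nonneg (hr0 x i) (by lia)) hnpos.le
      lia⟩
  obtain ⟨x, y, hxy, hbox⟩ := Fintype.exists_ne_map_eq_of_card_lt box (by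
    simp only [Fintype.card_fun, Fintype.card_fin, hι]
    exact Nat.pow_lt_pow_left (Nat.lt_succ_self m) two_ne_zero)
  have hdiff : ∀ i, |r x i - r y i| ≤ |N| / m := fun i => by
    have h := congrArg (fun z : Fin m => (z : ℕ)) (congrFun hbox i)
    simp only [box] at h
    have hm0 : (0 : ℤ) < m := by exact_mod_cast hm1
    have h2 : 0 ≤ r x i * m / |N| := Int.ediv_nonneg (mul_nonneg (hr0 x i) (by lia)) hnpos.le
    have h3 : 0 ≤ r y i * m / |N| := Int.ediv_nonneg (mul_nonneg (hr0 y i) (by lia)) hnpos.le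
    have h4 : r x i * m / |N| = r y i * m / |N| := by lia
    have a1 := Int.mul_ediv_self_le (x := r x i * m) hnpos.ne'
    have a2 := Int.lt_mul_ediv_self_add (x := r x i * m) hnpos
    have a3 := Int.mul_ediv_self_le (x := r y i * m) hnpos.ne'
    have a4 := Int.lt_mul_ediv_self_add (x := r y i * m) hnpos
    rw [h4] at a1 a2
    have a5 : |(r x i - r y i) * m| ≤ |N| := by
      rw [sub_mul]
      exact abs_le.2 ⟨by lia, by lia⟩
    rw [abs_mul, abs_of_pos hm0] at a5
    exact (Int.le_ediv_iff_mul_le hm0).2 a5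
  let d := pt x - pt y
  have hd0 : d ≠ 0 := by
    intro h
    apply hxy
    funext i
    have h' := congrArg (fun z => B.repr z i) (sub_eq_zero.1 h)
    simp only [hpt] at h'
    exact Fin.ext (by exact_mod_cast h')
  -- Differences of integer parts, so that the coordinates of `c' * (a * d - q * c)` are differences
  -- of remainders in a common box, at most `|N| / m`.
  let q : 𝓞 K := ∑ i, (B.repr (a * pt x * c') i / |N| - B.repr (a * pt y * c') i / |N|) • B i
  have he : c' * (a * d - q * c) = a * pt x * c' - a * pt y * c' - |N| • q := by
    rw [Algebra.smul_def, hc']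
    ring
  refine ⟨q, d, Or.inr hd0, ?_, ?_⟩
  · refine (hnorm d m fun i => ?_).trans_lt hmlt
    simp only [d, map_sub, Finsupp.coe_sub, Pi.sub_apply, hpt]
    have h1 := (x i).2
    have h2 := (y i).2
    exact abs_le.2 ⟨by lia, by lia⟩
  · have h1 : |Algebra.norm ℤ (c' * (a * d - q * c))| ≤ κ * (|N| / m) ^ 2 := by
      refine hnorm _ _ fun i => ?_
      rw [he]
      simp only [map_sub, map_smul, q, Finsupp.coe_sub, Finsupp.coe_smul, Pi.sub_apply,
        Pi.smul_apply, B.repr_sum_self, smul_eq_mul]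
      have h := hdiff i
      simp only [r] at h
      have e1 := Int.mul_ediv_add_emod (B.repr (a * pt x * c') i) |N|
      have e2 := Int.mul_ediv_add_emod (B.repr (a * pt y * c') i) |N|
      convert h using 2
      linear_combination e2 - e1
    rw [map_mul, abs_mul, hNc'] at h1
    have hm0 : (0 : ℤ) < m := by exact_mod_cast hm1
    have h2 : |N| / m * m ≤ |N| := Int.ediv_mul_le _ hm0.ne'
    have h3 : |N| / m ≤ 4 * κ * m := by
      refine Int.ediv_le_of_le_mul hm0 (hmge.trans ?_)
      have : (1 : ℤ) ≤ m := by exact_mod_cast hm1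
      nlinarith [mul_le_mul_of_nonneg_left
        (show ((m : ℤ) + 1) ^ 2 ≤ 4 * (m : ℤ) ^ 2 by nlinarith) hκ.le]
    have h4 : 0 ≤ |N| / m := Int.ediv_nonneg hnpos.le hm0.le
    -- The factor `|N|` is the norm of `c'`; cancelling it leaves about `κ |N| / m ^ 2`, and `|N| ≤
    -- κ (m + 1) ^ 2 ≤ 4 κ m ^ 2`.
    refine le_max_of_le_right (le_of_mul_le_mul_left (h1.trans ?_) hnpos)
    calc κ * (|N| / m) ^ 2 ≤ κ * ((|N| / m) * (4 * κ * m)) := by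
          rw [sq]
          exact mul_le_mul_of_nonneg_left (mul_le_mul_of_nonneg_left h3 h4) hκ.le
      _ = 4 * κ ^ 2 * (|N| / m * m) := by ring
      _ ≤ 4 * κ ^ 2 * |N| := mul_le_mul_of_nonneg_left h2 (by positivity)
      _ = |N| * (4 * κ ^ 2) := by ring

/-! ### Degree-zero divisors and cusps -/

section Divisors

variable {K : Type*}

/-- The divisor `{x} - {y}`. -/
noncomputable def divisor (x y : OnePoint K) : Div0 K :=
  ⟨Finsupp.single x 1 - Finsupp.single y 1, by
    rw [Div0, AddMonoidHom.mem_ker, map_sub]; simp [degree]⟩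

theorem divisor_self (x : OnePoint K) : divisor x x = 0 :=
  Subtype.ext (sub_self _)

theorem divisor_add_divisor (x y z : OnePoint K) : divisor x y + divisor y z = divisor x z :=
  Subtype.ext (sub_add_sub_cancel _ _ _)

/-- Divisors of degree zero are generated by the divisors `{x} - {∞}`. -/
theorem Div0.mem_closure (E : Div0 K) :
    E ∈ AddSubgroup.closure (Set.range fun x : OnePoint K => divisor x OnePoint.infty) := by
  have key : E = ∑ x ∈ E.1.support, E.1 x • divisor x OnePoint.infty := by
    apply Subtype.ext
    have hdeg : ∑ x ∈ E.1.support, E.1 x = 0 := by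
      have : degree K E.1 = 0 := E.2
      simpa [degree, Finsupp.sum] using this
    rw [AddSubgroup.val_finsetSum]
    simp only [AddSubgroupClass.coe_zsmul, divisor, smul_sub]
    rw [Finset.sum_sub_distrib, ← Finset.sum_smul, hdeg, zero_smul, sub_zero]
    conv_lhs => rw [← Finsupp.sum_single E.1]
    simp [Finsupp.sum]
  rw [key]
  exact AddSubgroup.sum_mem _ fun x _ => AddSubgroup.zsmul_mem _
    (AddSubgroup.subset_closure (Set.mem_range_self x)) _

variable [Field K]

open Classical in
/-- The point `a / c` of the projective line. -/
noncomputable def cusp (a c : K) : OnePoint K := if c = 0 then OnePoint.infty else ↑(a / c)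

@[simp] theorem cusp_zero (a : K) : cusp a 0 = OnePoint.infty := if_pos rfl

theorem cusp_of_ne_zero (a : K) {c : K} (hc : c ≠ 0) : cusp a c = ↑(a / c) := if_neg hc

theorem cusp_mul_left (a c : K) {u : K} (hu : u ≠ 0) : cusp (u * a) (u * c) = cusp a c := by
  by_cases hc : c = 0
  · simp [hc]
  · rw [cusp_of_ne_zero _ hc, cusp_of_ne_zero _ (mul_ne_zero hu hc), mul_div_mul_left _ _ hu]

theorem cusp_eq_of_mul_eq {a b c d : K} (h : a * d = b * c) (hac : a ≠ 0 ∨ c ≠ 0)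
    (hbd : b ≠ 0 ∨ d ≠ 0) : cusp a c = cusp b d := by
  by_cases hc : c = 0
  · subst hc
    have ha : a ≠ 0 := by simpa using hac
    have hd : d = 0 := by simpa [ha] using h
    rw [hd, cusp_zero, cusp_zero]
  · have hd : d ≠ 0 := by
      rintro rfl
      simp_all
    rw [cusp_of_ne_zero _ hc, cusp_of_ne_zero _ hd, (div_eq_div_iff hc hd).2 h]

open Classical in
theorem smul_cusp (g : GL (Fin 2) K) {a c : K} (h : a ≠ 0 ∨ c ≠ 0) :
    g • cusp a c = cusp (g 0 0 * a + g 0 1 * c) (g 1 0 * a + g 1 1 * c) := by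
  by_cases hc : c = 0
  · subst hc
    have ha : a ≠ 0 := by simpa using h
    rw [cusp_zero, OnePoint.smul_infty_eq_ite, mul_zero, mul_zero, add_zero, add_zero, mul_comm _ a,
      mul_comm _ a, cusp_mul_left _ _ ha, cusp]
  · rw [cusp_of_ne_zero _ hc, OnePoint.smul_some_eq_ite]
    have h1 : g 1 0 * a + g 1 1 * c = c * (g 1 0 * (a / c) + g 1 1) := by field_simp
    have h0 : g 0 0 * a + g 0 1 * c = c * (g 0 0 * (a / c) + g 0 1) := by field_simp
    rw [h0, h1, cusp_mul_left _ _ hc, cusp]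

open Classical in
theorem coe_moveDiv (g : GL (Fin 2) K) (E : Div0 K) :
    (moveDiv g E : OnePoint K →₀ ℤ) = Finsupp.mapDomain (g • ·) (E : OnePoint K →₀ ℤ) := rfl

open Classical in
theorem moveDiv_divisor (g : GL (Fin 2) K) (x y : OnePoint K) :
    moveDiv g (divisor x y) = divisor (g • x) (g • y) := by
  apply Subtype.ext
  rw [coe_moveDiv, divisor, ← Finsupp.mapDomain.addMonoidHom_apply, map_sub]
  simp [divisor, Finsupp.mapDomain_single]

theorem moveDiv_mul (g h : GL (Fin 2) K) (E : Div0 K) :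
    moveDiv (g * h) E = moveDiv g (moveDiv h E) := by
  classical
  apply Subtype.ext
  change Finsupp.mapDomain _ _ = Finsupp.mapDomain _ (Finsupp.mapDomain _ _)
  rw [← Finsupp.mapDomain_comp]
  congr 1
  funext x
  exact mul_smul g h x

theorem moveDiv_one (E : Div0 K) : moveDiv (1 : GL (Fin 2) K) E = E := by
  classical
  apply Subtype.ext
  rw [coe_moveDiv]
  conv_rhs => rw [← Finsupp.mapDomain_id (v := (E : OnePoint K →₀ ℤ))]
  congr 1
  funext x
  exact one_smul _ x

end Divisors

/-! ### Boundedness of functions invariant under a congruence subgroup -/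

section Bounded

variable {K : Type*} [Field K]

/-- The divisor `{a / c} - {b / d}`. -/
noncomputable def edge (a b c d : 𝓞 K) : Div0 K := divisor (cusp (a : K) c) (cusp (b : K) d)

/-- The invariance, up to inequality, of a function on divisors under the principal congruence
subgroup of level `N`. -/
def CongruenceInvariant (N : 𝓞 K) (ψ : Div0 K → ℝ) : Prop :=
  ∀ g : SL(2, 𝓞 K), (∀ i j, N ∣ g i j - (1 : Matrix (Fin 2) (Fin 2) (𝓞 K)) i j) →
    ∀ E, ψ (moveDiv (g.map (algebraMap (𝓞 K) K) : SL(2, K)) E) ≤ ψ E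

/-- If `X` and `X' = X + D N Y` both have determinant `D`, then `X' X⁻¹ = 1 + N Y adj(X)` is
integral, congruent to `1` modulo `N` and of determinant one. It carries the edge of `X` to the edge
of `X'`. -/
theorem CongruenceInvariant.edge_le {N : 𝓞 K} {ψ : Div0 K → ℝ} (hψ : CongruenceInvariant N ψ)
    {D : 𝓞 K} (hD : D ≠ 0) {a b c d a' b' c' d' : 𝓞 K} (h : a * d - b * c = D)
    (h' : a' * d' - b' * c' = D) (ha : D * N ∣ a' - a) (hb : D * N ∣ b' - b)
    (hc : D * N ∣ c' - c) (hd : D * N ∣ d' - d) : ψ (edge a' b' c' d') ≤ ψ (edge a b c d) := by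
  obtain ⟨x, hx⟩ := ha
  obtain ⟨y, hy⟩ := hb
  obtain ⟨z, hz⟩ := hc
  obtain ⟨t, ht⟩ := hd
  have hD' : (D : K) ≠ 0 := by simpa using hD
  let g : SL(2, 𝓞 K) := ⟨!![1 + N * (x * d - y * c), N * (y * a - x * b);
    N * (z * d - t * c), 1 + N * (t * a - z * b)], by
      rw [Matrix.det_fin_two_of]
      obtain rfl : a' = a + D * N * x := by linear_combination hx
      obtain rfl : b' = b + D * N * y := by linear_combination hy
      obtain rfl : c' = c + D * N * z := by linear_combination hz
      obtain rfl : d' = d + D * N * t := by linear_combination ht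
      apply mul_left_cancel₀ hD
      rw [← h] at h' ⊢
      linear_combination h'⟩
  have hg := hψ g (fun i j => by
    fin_cases i <;> fin_cases j <;> simp [g]) (edge a b c d)
  have h1 : a ≠ 0 ∨ c ≠ 0 := by
    by_contra! H
    exact hD (by rw [← h, H.1, H.2]; ring)
  have h2 : b ≠ 0 ∨ d ≠ 0 := by
    by_contra! H
    exact hD (by rw [← h, H.1, H.2]; ring)
  rw [edge, moveDiv_divisor, smul_cusp _ (by simpa using h1), smul_cusp _ (by simpa using h2)] at hg
  have e : ∀ r s u v r' : 𝓞 K, r * s + u * v = r' → (r : K) * s + u * v = r' := by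
    rintro r s u v _ rfl
    simp
  have g00 : (g 0 0) = 1 + N * (x * d - y * c) := rfl
  have g01 : (g 0 1) = N * (y * a - x * b) := rfl
  have g10 : (g 1 0) = N * (z * d - t * c) := rfl
  have g11 : (g 1 1) = 1 + N * (t * a - z * b) := rfl
  have e1 := e (g 0 0) a (g 0 1) c a' (by rw [g00, g01]; linear_combination N * x * h - hx)
  have e2 := e (g 1 0) a (g 1 1) c c' (by rw [g10, g11]; linear_combination N * z * h - hz)
  have e3 := e (g 0 0) b (g 0 1) d b' (by rw [g00, g01]; linear_combination N * y * h - hy)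
  have e4 := e (g 1 0) b (g 1 1) d d' (by rw [g10, g11]; linear_combination N * t * h - ht)
  rw [edge, ← e1, ← e2, ← e3, ← e4]
  exact hg

variable [NumberField K]

/-- By `edge_le` the value depends only on the entries modulo `D * N`, which leaves finitely many
cases. -/
theorem CongruenceInvariant.bounded_of_det_eq {N : 𝓞 K} (hN : N ≠ 0) {ψ : Div0 K → ℝ}
    (hψ : CongruenceInvariant N ψ) {D : 𝓞 K} (hD : D ≠ 0) :
    ∃ B, ∀ a b c d : 𝓞 K, a * d - b * c = D → ψ (edge a b c d) ≤ B := by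
  let J : Ideal (𝓞 K) := Ideal.span {D * N}
  have hJ : J ≠ ⊥ := by simpa [J] using ⟨hD, hN⟩
  have : Finite (𝓞 K ⧸ J) := Ideal.finiteQuotientOfFreeOfNeBot J hJ
  let S := {x : Fin 4 → 𝓞 K // x 0 * x 3 - x 1 * x 2 = D}
  let f : S → Fin 4 → 𝓞 K ⧸ J := fun x i => Ideal.Quotient.mk J (x.1 i)
  let b : S → ℝ := fun x => ψ (edge (x.1 0) (x.1 1) (x.1 2) (x.1 3))
  have hfb : ∀ x y, f x = f y → b y ≤ b x := fun x y hxy => by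
    have h : ∀ i, D * N ∣ y.1 i - x.1 i := fun i => by
      rw [← Ideal.mem_span_singleton]
      exact (Ideal.Quotient.eq).1 (congrFun hxy i).symm
    exact hψ.edge_le hD x.2 y.2 (h 0) (h 1) (h 2) (h 3)
  obtain ⟨B, hB⟩ : ∃ B, ∀ y ∈ Set.range f, ∀ x, f x = y → b x ≤ B := by
    have h1 : ∀ y ∈ Set.range f, ∃ B, ∀ x, f x = y → b x ≤ B := by
      rintro _ ⟨z, rfl⟩
      exact ⟨b z, fun x hx => hfb z x hx.symm⟩
    choose! B hB using h1
    obtain ⟨B', hB'⟩ := ((Set.toFinite (Set.range f)).image B).bddAbove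
    exact ⟨B', fun y hy x hx => (hB y hy x hx).trans (hB' ⟨y, hy, rfl⟩)⟩
  refine ⟨B, fun a b' c d h => ?_⟩
  let x : S := ⟨![a, b', c, d], by simpa using h⟩
  exact hB (f x) (Set.mem_range_self x) x rfl

/-- There are finitely many ideals of bounded norm. Determinants generating the same ideal differ by
a unit, which is absorbed by scaling `(a, c)` without moving the cusp. -/
theorem CongruenceInvariant.bounded_of_norm_det_le {N : 𝓞 K} (hN : N ≠ 0) {ψ : Div0 K → ℝ}
    (hψ : CongruenceInvariant N ψ) (C : ℤ) :
    ∃ B, ∀ a b c d : 𝓞 K, a * d - b * c ≠ 0 → |Algebra.norm ℤ (a * d - b * c)| ≤ C →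
      ψ (edge a b c d) ≤ B := by
  have h1 : ∀ J : Ideal (𝓞 K), ∃ B, ∀ a b c d : 𝓞 K, a * d - b * c ≠ 0 →
      Ideal.span {a * d - b * c} = J → ψ (edge a b c d) ≤ B := by
    intro J
    by_cases hJ : ∃ D : 𝓞 K, D ≠ 0 ∧ Ideal.span {D} = J
    · obtain ⟨D, hD, rfl⟩ := hJ
      obtain ⟨B, hB⟩ := hψ.bounded_of_det_eq hN hD
      refine ⟨B, fun a b c d _ h => ?_⟩
      obtain ⟨u, hu⟩ := Ideal.span_singleton_eq_span_singleton.1 h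
      have hu0 : ((u : 𝓞 K) : K) ≠ 0 := by simp
      have := hB (u * a) b (u * c) d (by rw [← hu]; ring)
      rwa [edge, show ((u * a : 𝓞 K) : K) = u * a by simp,
        show ((u * c : 𝓞 K) : K) = u * c by simp, cusp_mul_left _ _ hu0] at this
    · exact ⟨0, fun a b c d h h' => absurd ⟨_, h, h'⟩ hJ⟩
  choose B hB using h1
  obtain ⟨B', hB'⟩ := ((Ideal.finite_setOfPred_absNorm_le (S := 𝓞 K) C.toNat).image B).bddAbove
  refine ⟨B', fun a b c d h0 h => (hB _ a b c d h0 rfl).trans (hB' ⟨_, ?_, rfl⟩)⟩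
  change Ideal.absNorm _ ≤ _
  rw [Ideal.absNorm_span_singleton]
  rw [← Int.ofNat_le, Int.natCast_natAbs]
  exact h.trans (Int.self_le_toNat C)

/-- A function on divisors of degree zero that satisfies the ultrametric inequality and is invariant
under a congruence subgroup is bounded: divisors of degree zero are finitely generated over the
group. -/
theorem CongruenceInvariant.bounded [Algebra.IsQuadraticExtension ℚ K] {N : 𝓞 K} (hN : N ≠ 0)
    {ψ : Div0 K → ℝ} (hψ : CongruenceInvariant N ψ)
    (hsub : ∀ E F, ψ (E - F) ≤ max (ψ E) (ψ F)) : ∃ B, ∀ E, ψ E ≤ B := by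
  have h0 : ∀ E, ψ 0 ≤ ψ E := fun E => by simpa using hsub E E
  have hneg : ∀ E, ψ (-E) ≤ ψ E := fun E => by
    have := hsub 0 E
    rwa [zero_sub, max_eq_right (h0 E)] at this
  have hadd : ∀ E F, ψ (E + F) ≤ max (ψ E) (ψ F) := fun E F => by
    have := hsub E (-F)
    rw [sub_neg_eq_add] at this
    exact this.trans (max_le_max le_rfl (hneg F))
  obtain ⟨C, hC⟩ := exists_approx K
  obtain ⟨B, hB⟩ := hψ.bounded_of_norm_det_le hN C
  have hBmax : ∀ a b c d : 𝓞 K, |Algebra.norm ℤ (a * d - b * c)| ≤ C → (a ≠ 0 ∨ c ≠ 0) →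
      (b ≠ 0 ∨ d ≠ 0) → ψ (edge a b c d) ≤ max B (ψ 0) := by
    intro a b c d h hac hbd
    by_cases hD : a * d - b * c = 0
    · refine le_max_of_le_right (le_of_eq ?_)
      rw [edge, cusp_eq_of_mul_eq (a := (a : K)) (b := b) (c := c) (d := d)
        (by exact_mod_cast sub_eq_zero.1 hD) (by simpa using hac) (by simpa using hbd),
        divisor_self]
    · exact le_max_of_le_left (hB a b c d hD h)
  -- Euclidean descent on the norm of the denominator: `{a/c} - {∞}` is `{a/c} - {b/d}`, of bounded
  -- determinant, plus `{b/d} - {∞}`, with `d` of smaller norm than `c`.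
  have hvec : ∀ (n : ℕ) (a c : 𝓞 K), |Algebra.norm ℤ c| < n → (a ≠ 0 ∨ c ≠ 0) →
      ψ (divisor (cusp (a : K) c) OnePoint.infty) ≤ max B (ψ 0) := by
    intro n
    induction n with
    | zero => exact fun a c h => absurd h (abs_nonneg _).not_gt
    | succ n ih =>
      intro a c h hac
      by_cases hc : c = 0
      · rw [hc, show ((0 : 𝓞 K) : K) = 0 by simp, cusp_zero, divisor_self]
        exact le_max_right _ _
      · obtain ⟨b, d, hbd, hdc, hdet⟩ := hC a c hc
        rw [← divisor_add_divisor _ (cusp (b : K) d)]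
        refine (hadd _ _).trans (max_le (hBmax a b c d hdet hac hbd) (ih b d ?_ hbd))
        push_cast at h
        lia
  refine ⟨max B (ψ 0), fun E => ?_⟩
  refine AddSubgroup.closure_induction (p := fun E _ => ψ E ≤ max B (ψ 0)) ?_ (le_max_right _ _)
    (fun E F _ _ hE hF => (hadd E F).trans (max_le hE hF)) (fun E _ hE => (hneg E).trans hE)
    (Div0.mem_closure E)
  rintro _ ⟨x, rfl⟩
  change ψ (divisor x OnePoint.infty) ≤ _
  induction x using OnePoint.rec with
  | infty =>
    rw [divisor_self]
    exact le_max_right _ _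
  | coe x =>
    obtain ⟨a, c, hc, rfl⟩ := IsFractionRing.div_surjective (A := 𝓞 K) x
    have hc0 : c ≠ 0 := nonZeroDivisors.ne_zero hc
    have := hvec ((Algebra.norm ℤ c).natAbs + 1) a c
      (by push_cast; exact Int.lt_succ _) (Or.inr hc0)
    rwa [cusp_of_ne_zero _ (by simpa using hc0)] at this

end Bounded

/-! ### Values of rigid analytic functions at points -/

section Evaluation

variable {L : Type*} [NormedField L]

/-- The value at `z` of a power series in one variable. -/
noncomputable def evalSeries (z : L) (e : PowerSeries L) : L := ∑' n, PowerSeries.coeff n e * z ^ n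

/-- A power series with coefficients tending to zero that vanishes on the closed unit disc is
zero. -/
theorem eq_zero_of_forall_tsum_eq_zero [IsUltrametricDist L] [CompleteSpace L] {π : L}
    (hπ0 : π ≠ 0) (hπ : ‖π‖ < 1) {a : ℕ → L} (ha : Filter.Tendsto a Filter.cofinite (nhds 0))
    (h : ∀ z : L, ‖z‖ ≤ 1 → ∑' n, a n * z ^ n = 0) : ∀ n, a n = 0 := by
  obtain ⟨B, hB⟩ : ∃ B, ∀ n, ‖a n‖ ≤ B := by
    rw [Nat.cofinite_eq_atTop] at ha
    obtain ⟨B, hB⟩ := (Metric.isBounded_range_of_tendsto a ha).exists_norm_le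
    exact ⟨B, fun n => hB _ (Set.mem_range_self n)⟩
  have hB0 : 0 ≤ B := (norm_nonneg _).trans (hB 0)
  have hsum : ∀ z : L, ‖z‖ ≤ 1 → Summable fun n => a n * z ^ n := fun z hz => by
    refine NonarchimedeanAddGroup.summable_of_tendsto_cofinite_zero ?_
    rw [tendsto_zero_iff_norm_tendsto_zero] at ha ⊢
    refine squeeze_zero (fun _ => norm_nonneg _) (fun n => ?_) ha
    rw [norm_mul, norm_pow]
    exact mul_le_of_le_one_right (norm_nonneg _) (pow_le_one₀ (norm_nonneg _) hz)
  intro n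
  induction n using Nat.strong_induction_on with
  | _ m ih =>
    -- At `z = π ^ t` the term `a m * z ^ m` is minus the tail, whose norm is at most `B ‖z‖ ^ (m +
    -- 1)`; divide by `‖z‖ ^ m`.
    have key : ∀ t : ℕ, ‖a m‖ ≤ B * ‖π‖ ^ t := fun t => by
      have hz : ‖π ^ t‖ ≤ 1 := by
        rw [norm_pow]
        exact pow_le_one₀ (norm_nonneg _) hπ.le
      have h1 := h _ hz
      rw [← (hsum _ hz).sum_add_tsum_nat_add (m + 1), Finset.sum_range_succ,
        Finset.sum_eq_zero fun i hi => by rw [ih i (Finset.mem_range.1 hi), zero_mul], zero_add] at h1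
      have h2 : ‖∑' i, a (i + (m + 1)) * (π ^ t) ^ (i + (m + 1))‖ ≤ B * ‖π ^ t‖ ^ (m + 1) := by
        refine IsUltrametricDist.norm_tsum_le_of_forall_le_of_nonneg (by positivity) fun i => ?_
        rw [norm_mul, norm_pow (π ^ t)]
        exact mul_le_mul (hB _) (pow_le_pow_of_le_one (norm_nonneg _) hz (by lia))
          (by positivity) hB0
      rw [← norm_neg, ← eq_neg_of_add_eq_zero_left h1, norm_mul, norm_pow (π ^ t), pow_succ,
        ← mul_assoc, mul_right_comm] at h2
      have h3 : 0 < ‖π ^ t‖ ^ m := pow_pos (norm_pos_iff.2 (pow_ne_zero _ hπ0)) _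
      rw [← norm_pow]
      exact le_of_mul_le_mul_right h2 h3
    have h4 : Filter.Tendsto (fun t : ℕ => B * ‖π‖ ^ t) Filter.atTop (nhds (B * 0)) :=
      (tendsto_pow_atTop_nhds_zero_of_lt_one (norm_nonneg _) hπ).const_mul B
    rw [mul_zero] at h4
    exact norm_le_zero_iff.1 (ge_of_tendsto' h4 key)

theorem norm_pow_mul_pow_le {z w : L} (hz : ‖z‖ ≤ 1) (hw : ‖w‖ ≤ 1) (m n : ℕ) :
    ‖z ^ m * w ^ n‖ ≤ 1 := by
  rw [norm_mul, norm_pow, norm_pow]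
  exact mul_le_one₀ (pow_le_one₀ (norm_nonneg _) hz) (by positivity)
    (pow_le_one₀ (norm_nonneg _) hw)

theorem evalSeries_linear (z a c : L) :
    evalSeries z (PowerSeries.C a + PowerSeries.C c * PowerSeries.X) = a + c * z := by
  rw [evalSeries, tsum_eq_sum (s := Finset.range 2)]
  · simp [Finset.sum_range_succ, PowerSeries.coeff_succ_C]
  · intro n hn
    obtain ⟨n, rfl⟩ : ∃ m, n = m + 2 := ⟨n - 2, by simp at hn; lia⟩
    simp [PowerSeries.coeff_succ_C]

variable [IsUltrametricDist L] [CompleteSpace L]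

theorem summable_evalSeries {z : L} (hz : ‖z‖ ≤ 1) {e : PowerSeries L} (he : e ∈ integralTate L) :
    Summable fun n => PowerSeries.coeff n e * z ^ n := by
  refine NonarchimedeanAddGroup.summable_of_tendsto_cofinite_zero ?_
  have ha := integralTate.tendsto he
  rw [tendsto_zero_iff_norm_tendsto_zero] at ha ⊢
  refine squeeze_zero (fun _ => norm_nonneg _) (fun n => ?_) ha
  rw [norm_mul, norm_pow]
  exact mul_le_of_le_one_right (norm_nonneg _) (pow_le_one₀ (norm_nonneg _) hz)

theorem summable_eval {z w : L} (hz : ‖z‖ ≤ 1) (hw : ‖w‖ ≤ 1) (f : A2 L) :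
    Summable fun x : ℕ × ℕ => f x * (z ^ x.1 * w ^ x.2) := by
  refine NonarchimedeanAddGroup.summable_of_tendsto_cofinite_zero ?_
  have ha := f.tendsto
  rw [tendsto_zero_iff_norm_tendsto_zero] at ha ⊢
  refine squeeze_zero (fun _ => norm_nonneg _) (fun n => ?_) ha
  rw [norm_mul]
  exact mul_le_of_le_one_right (norm_nonneg _) (norm_pow_mul_pow_le hz hw _ _)

/-- The value of a function at the point `(z, w)` of the product of two closed unit discs. -/
noncomputable def eval {z w : L} (hz : ‖z‖ ≤ 1) (hw : ‖w‖ ≤ 1) : A2 L →L[L] L :=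
  LinearMap.mkContinuous
    { toFun := fun f => ∑' x : ℕ × ℕ, f x * (z ^ x.1 * w ^ x.2)
      map_add' := fun f g => by
        rw [← (summable_eval hz hw f).tsum_add (summable_eval hz hw g)]
        exact tsum_congr fun x => add_mul (f x) (g x) _
      map_smul' := fun c f => by
        simpa [mul_assoc] using (summable_eval hz hw f).tsum_const_smul c } 1
    (fun f => by
      rw [one_mul]
      refine IsUltrametricDist.norm_tsum_le_of_forall_le_of_nonneg (norm_nonneg f) fun x => ?_
      rw [norm_mul]
      exact (mul_le_of_le_one_right (norm_nonneg _) (norm_pow_mul_pow_le hz hw _ _)).trans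
        (A2.norm_apply_le f x))

theorem eval_apply {z w : L} (hz : ‖z‖ ≤ 1) (hw : ‖w‖ ≤ 1) (f : A2 L) :
    eval hz hw f = ∑' x : ℕ × ℕ, f x * (z ^ x.1 * w ^ x.2) := rfl

theorem eval_tensor {z w : L} (hz : ‖z‖ ≤ 1) (hw : ‖w‖ ≤ 1) (e e' : integralTate L) :
    eval hz hw (tensor e e') = evalSeries z (e : PowerSeries L) * evalSeries w (e' : PowerSeries L) := by
  have h : ∀ x : ℕ × ℕ, tensor e e' x * (z ^ x.1 * w ^ x.2) =
      (PowerSeries.coeff x.1 (e : PowerSeries L) * z ^ x.1) *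
        (PowerSeries.coeff x.2 (e' : PowerSeries L) * w ^ x.2) := fun x => mul_mul_mul_comm _ _ _ _
  rw [evalSeries, evalSeries, (summable_evalSeries hz e.2).tsum_mul_tsum
    (summable_evalSeries hw e'.2) ((summable_eval hz hw (tensor e e')).congr fun x => h x), eval_apply]
  exact tsum_congr h

/-- A function that vanishes at all points is zero. -/
theorem A2.ext_eval {π : L} (hπ0 : π ≠ 0) (hπ : ‖π‖ < 1) {f g : A2 L}
    (h : ∀ (z w : L) (hz : ‖z‖ ≤ 1) (hw : ‖w‖ ≤ 1), eval hz hw f = eval hz hw g) : f = g := by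
  rw [← sub_eq_zero]
  replace h : ∀ (z w : L) (hz : ‖z‖ ≤ 1) (hw : ‖w‖ ≤ 1), eval hz hw (f - g) = 0 :=
    fun z w hz hw => by rw [map_sub, h, sub_self]
  generalize f - g = f at h
  -- For fixed `w` the function is a one-variable series in `z` whose `m`-th coefficient is this
  -- sum.
  have h1 : ∀ (w : L), ‖w‖ ≤ 1 → ∀ m, ∑' n, f (m, n) * w ^ n = 0 := by
    intro w hw
    have hs : ∀ m, Summable fun n => f (m, n) * w ^ n := fun m => by
      refine ((summable_eval (z := 1) (by simp) hw f).comp_injective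
        (Prod.mk_right_injective m)).congr fun n => ?_
      simp
    refine eq_zero_of_forall_tsum_eq_zero hπ0 hπ ?_ fun z hz => ?_
    · have := (summable_eval (z := 1) (by simp) hw f).prod
      simp only [one_pow, one_mul] at this
      exact this.tendsto_cofinite_zero
    · rw [← h z w hz hw, eval_apply, (summable_eval hz hw f).tsum_prod]
      refine tsum_congr fun m => ?_
      rw [← (hs m).tsum_mul_right]
      exact tsum_congr fun n => by ring
  ext ⟨m, n⟩
  refine eq_zero_of_forall_tsum_eq_zero hπ0 hπ (a := fun n => f (m, n)) ?_ (fun w hw => h1 w hw m) n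
  exact f.tendsto.comp (Prod.mk_right_injective m).tendsto_cofinite

/-- Cauchy product; the summability over pairs that it needs is that of the two-variable function
`e(x) e'(y)` at the point `(z, z)`. -/
theorem evalSeries_mul {z : L} (hz : ‖z‖ ≤ 1) {e e' : PowerSeries L} (he : e ∈ integralTate L)
    (he' : e' ∈ integralTate L) : evalSeries z (e * e') = evalSeries z e * evalSeries z e' := by
  have h := summable_eval hz hz (tensor ⟨e, he⟩ ⟨e', he'⟩)
  have h' : Summable fun x : ℕ × ℕ => (PowerSeries.coeff x.1 e * z ^ x.1) *
      (PowerSeries.coeff x.2 e' * z ^ x.2) := h.congr fun x => mul_mul_mul_comm _ _ _ _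
  rw [evalSeries, evalSeries, evalSeries, (summable_evalSeries hz he).tsum_mul_tsum_eq_tsum_sum_antidiagonal
    (summable_evalSeries hz he') h']
  refine tsum_congr fun n => ?_
  rw [PowerSeries.coeff_mul, Finset.sum_mul]
  refine Finset.sum_congr rfl fun x hx => ?_
  rw [← Finset.HasAntidiagonal.mem_antidiagonal.1 hx]
  ring

/-- Evaluation at `z` as a homomorphism of monoids. -/
noncomputable def evalHom {z : L} (hz : ‖z‖ ≤ 1) : integralTate L →* L where
  toFun e := evalSeries z (e : PowerSeries L)
  map_one' := by
    have := evalSeries_linear z 1 0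
    simpa using this
  map_mul' e e' := evalSeries_mul hz e.2 e'.2

end Evaluation

/-! ### The weight action as a weighted substitution -/

section Action

variable {p : ℕ} [Fact p.Prime] {L : Type*} [NormedField L] [NormedAlgebra ℚ_[p] L]

/-- The automorphy factor `a + c z` of `!![a, b; c, d]`. -/
def autFactor (M : Matrix (Fin 2) (Fin 2) L) (z : L) : L := M 0 0 + M 1 0 * z

/-- The fractional linear transformation `z ↦ (b + d z) / (a + c z)` of `!![a, b; c, d]`. -/
noncomputable def moebius (M : Matrix (Fin 2) (Fin 2) L) (z : L) : L :=
  (M 0 1 + M 1 1 * z) / (M 0 0 + M 1 0 * z)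

theorem norm_autFactor (M : Sigma0 p L) {z : L} (hz : ‖z‖ ≤ 1) :
    ‖autFactor (M : Matrix (Fin 2) (Fin 2) L) z‖ = 1 := by
  have : IsUltrametricDist L := IsUltrametricDist.of_normedAlgebra ℚ_[p]
  have h2 := M.2.2.1
  have h3 := M.2.2.2.1
  have h : ‖(M : Matrix (Fin 2) (Fin 2) L) 1 0 * z‖ < 1 := by
    rw [norm_mul]
    exact ((mul_le_of_le_one_right (norm_nonneg _) hz).trans h2).trans_lt (norm_prime_lt_one p L)
  rw [autFactor, IsUltrametricDist.norm_add_eq_max_of_norm_ne_norm (by rw [h3]; exact h.ne'), h3]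
  exact max_eq_left h.le

theorem autFactor_ne_zero (M : Sigma0 p L) {z : L} (hz : ‖z‖ ≤ 1) :
    autFactor (M : Matrix (Fin 2) (Fin 2) L) z ≠ 0 := by
  rw [← norm_ne_zero_iff, norm_autFactor M hz]
  exact one_ne_zero

theorem norm_moebius_le (M : Sigma0 p L) {z : L} (hz : ‖z‖ ≤ 1) :
    ‖moebius (M : Matrix (Fin 2) (Fin 2) L) z‖ ≤ 1 := by
  have : IsUltrametricDist L := IsUltrametricDist.of_normedAlgebra ℚ_[p]
  have h := norm_autFactor M hz
  rw [autFactor] at h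
  rw [moebius, norm_div, h, div_one]
  refine (IsUltrametricDist.norm_add_le_max _ _).trans (max_le (M.2.1 _ _) ?_)
  rw [norm_mul]
  exact mul_le_one₀ (M.2.1 _ _) (norm_nonneg _) hz

/-- Cocycle relation. With the transformation `(b + d z) / (a + c z)`, the product `M * N` moves a
point by `M` first and then by `N`, which is what makes substitution a left action on functions. -/
theorem autFactor_mul (M N : Sigma0 p L) {z : L} (hz : ‖z‖ ≤ 1) :
    autFactor ((M * N : Sigma0 p L) : Matrix (Fin 2) (Fin 2) L) z =
      autFactor (M : Matrix (Fin 2) (Fin 2) L) z *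
        autFactor (N : Matrix (Fin 2) (Fin 2) L) (moebius (M : Matrix (Fin 2) (Fin 2) L) z) := by
  have h := autFactor_ne_zero M hz
  simp only [autFactor, moebius, Submonoid.coe_mul, Matrix.mul_apply, Fin.sum_univ_two] at h ⊢
  field_simp
  ring

theorem moebius_mul (M N : Sigma0 p L) {z : L} (hz : ‖z‖ ≤ 1) :
    moebius ((M * N : Sigma0 p L) : Matrix (Fin 2) (Fin 2) L) z =
      moebius (N : Matrix (Fin 2) (Fin 2) L) (moebius (M : Matrix (Fin 2) (Fin 2) L) z) := by
  have h := autFactor_ne_zero M hz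
  have h2 := autFactor_ne_zero N (norm_moebius_le M hz)
  have h3 := autFactor_mul M N hz
  have h4 := autFactor_ne_zero (M * N) hz
  rw [moebius, moebius]
  simp only [autFactor] at h h2 h3 h4
  rw [div_eq_div_iff h4 h2, h3]
  simp only [moebius, Submonoid.coe_mul, Matrix.mul_apply, Fin.sum_univ_two] at h ⊢
  field_simp
  ring

/-- Evaluation at `z` is a monoid homomorphism on integral Tate series, so the formal inverse of `a
+ c X` takes the value `(a + c z)⁻¹`. -/
theorem evalSeries_monomialSeries [CompleteSpace L] (k : ℕ) (M : Sigma0 p L) (i : ℕ) {z : L}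
    (hz : ‖z‖ ≤ 1) : evalSeries z (monomialSeries k (M : Matrix (Fin 2) (Fin 2) L) i) =
      autFactor (M : Matrix (Fin 2) (Fin 2) L) z ^ k *
        moebius (M : Matrix (Fin 2) (Fin 2) L) z ^ i := by
  have : IsUltrametricDist L := IsUltrametricDist.of_normedAlgebra ℚ_[p]
  have hne := autFactor_ne_zero M hz
  obtain ⟨M, h1, h2, h3, h4⟩ := M
  let u : integralTate L := ⟨_, linear_mem (h1 0 0) (h1 1 0)⟩
  let t : integralTate L := ⟨_, linear_mem (h1 0 1) (h1 1 1)⟩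
  let v : integralTate L := ⟨_, linear_inv_mem h3 (h2.trans_lt (norm_prime_lt_one p L))⟩
  have hu : evalHom hz u = autFactor M z := evalSeries_linear _ _ _
  have ht : evalHom hz t = M 0 1 + M 1 1 * z := evalSeries_linear _ _ _
  have ha0 : M 0 0 ≠ 0 := by intro h; rw [h] at h3; simp at h3
  have huv : u * v = 1 := Subtype.ext (PowerSeries.mul_inv_cancel
    (PowerSeries.C (M 0 0) + PowerSeries.C (M 1 0) * PowerSeries.X) (by simpa using ha0))
  have hv : evalHom hz v = (autFactor M z)⁻¹ := by
    refine eq_inv_of_mul_eq_one_right ?_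
    rw [← hu, ← map_mul, huv, map_one]
  have : evalSeries z (monomialSeries k M i) = evalHom hz (u ^ k * (t * v) ^ i) := rfl
  change evalSeries z (monomialSeries k M i) = _
  rw [this, map_mul, map_pow, map_pow, map_mul, hu, ht, hv, moebius, ← div_eq_mul_inv]
  rfl

/-- In the expansion of the power every factor `X` brings a factor `d`, while `b` is merely
integral. -/
theorem norm_coeff_linear_pow_le [IsUltrametricDist L] {b d : L} (hb : ‖b‖ ≤ 1) (i m : ℕ) :
    ‖PowerSeries.coeff m ((PowerSeries.C b + PowerSeries.C d * PowerSeries.X) ^ i)‖ ≤ ‖d‖ ^ m := by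
  induction i generalizing m with
  | zero =>
    rw [pow_zero, PowerSeries.coeff_one]
    split_ifs with h
    · simp [h]
    · simp
  | succ i ih =>
    rw [pow_succ', add_mul, mul_assoc, map_add, PowerSeries.coeff_C_mul, PowerSeries.coeff_C_mul]
    refine (IsUltrametricDist.norm_add_le_max _ _).trans (max_le ?_ ?_)
    · rw [norm_mul]
      exact (mul_le_of_le_one_left (norm_nonneg _) hb).trans (ih m)
    · rcases m with _ | m
      · simp
      · rw [PowerSeries.coeff_succ_X_mul, norm_mul, pow_succ']
        exact mul_le_mul_of_nonneg_left (ih m) (norm_nonneg _)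

/-- Upper triangular matrices `!![1, b; 0, d]` scale the coefficients of degree `m` by at most
`‖d‖ ^ m`. -/
theorem norm_coeff_monomialSeries_le (k : ℕ) (M : Sigma0 p L)
    (h0 : (M : Matrix (Fin 2) (Fin 2) L) 0 0 = 1) (h1 : (M : Matrix (Fin 2) (Fin 2) L) 1 0 = 0)
    (i m : ℕ) : ‖PowerSeries.coeff m (monomialSeries k (M : Matrix (Fin 2) (Fin 2) L) i)‖ ≤
      ‖(M : Matrix (Fin 2) (Fin 2) L) 1 1‖ ^ m := by
  have : IsUltrametricDist L := IsUltrametricDist.of_normedAlgebra ℚ_[p]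
  have h := norm_coeff_linear_pow_le (d := (M : Matrix (Fin 2) (Fin 2) L) 1 1) (M.2.1 0 1) i m
  rw [monomialSeries, h0, h1]
  simpa using h

variable [FiniteDimensional ℚ_[p] L]

/-- Identifies the operator, defined through the images of monomials, with an actual substitution;
composites can then be compared pointwise instead of by rearranging double series of coefficients.
-/
theorem eval_actA [IsUltrametricDist L] [CompleteSpace L] (k : ℕ) (γ₁ γ₂ : Sigma0 p L) (f : A2 L)
    {z w : L} (hz : ‖z‖ ≤ 1) (hw : ‖w‖ ≤ 1) :
    eval hz hw (actA k γ₁ γ₂ f) = autFactor (γ₁ : Matrix (Fin 2) (Fin 2) L) z ^ k *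
      autFactor (γ₂ : Matrix (Fin 2) (Fin 2) L) w ^ k *
        eval (norm_moebius_le γ₁ hz) (norm_moebius_le γ₂ hw) f := by
  have h : actA k γ₁ γ₂ f = ∑' x : ℕ × ℕ, f x • tensor ⟨_, monomialSeries_mem k γ₁ x.1⟩
    ⟨_, monomialSeries_mem k γ₂ x.2⟩ := rfl
  rw [h, (eval hz hw).map_tsum (summable_smul _ (fun _ => norm_tensor_le _ _) f), eval_apply,
    ← (summable_eval (norm_moebius_le γ₁ hz) (norm_moebius_le γ₂ hw) f).tsum_mul_left]
  refine tsum_congr fun x => ?_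
  rw [map_smul, eval_tensor, evalSeries_monomialSeries k γ₁ _ hz, evalSeries_monomialSeries k γ₂ _ hw,
    smul_eq_mul]
  ring

/-- The weight `(k, k)` action on functions is a left action. -/
theorem actA_mul (k : ℕ) (γ₁ γ₂ δ₁ δ₂ : Sigma0 p L) (f : A2 L) :
    actA k (γ₁ * δ₁) (γ₂ * δ₂) f = actA k γ₁ γ₂ (actA k δ₁ δ₂ f) := by
  have : IsUltrametricDist L := IsUltrametricDist.of_normedAlgebra ℚ_[p]
  have : CompleteSpace L := FiniteDimensional.complete ℚ_[p] L
  have hp : (p : L) ≠ 0 := by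
    rw [← map_natCast (algebraMap ℚ_[p] L), map_ne_zero]
    exact_mod_cast (Fact.out : p.Prime).ne_zero
  refine A2.ext_eval hp (norm_prime_lt_one p L) fun z w hz hw => ?_
  rw [eval_actA, eval_actA, eval_actA, autFactor_mul _ _ hz, autFactor_mul _ _ hw]
  simp only [moebius_mul _ _ hz, moebius_mul _ _ hw]
  ring

theorem norm_actA_le (k : ℕ) (γ₁ γ₂ : Sigma0 p L) (f : A2 L) : ‖actA k γ₁ γ₂ f‖ ≤ ‖f‖ := by
  have : IsUltrametricDist L := IsUltrametricDist.of_normedAlgebra ℚ_[p]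
  refine A2.norm_le (norm_nonneg _) fun m => ?_
  rw [actA_apply]
  refine IsUltrametricDist.norm_tsum_le_of_forall_le_of_nonneg (norm_nonneg f) fun x => ?_
  rw [norm_mul, norm_mul]
  exact (mul_le_of_le_one_right (norm_nonneg _) (mul_le_one₀ ((monomialSeries_mem k γ₁ x.1).1 _)
    (norm_nonneg _) ((monomialSeries_mem k γ₂ x.2).1 _))).trans (A2.norm_apply_le f x)

theorem norm_actA_apply_le (k : ℕ) (γ₁ γ₂ : Sigma0 p L) (f : A2 L) (m : ℕ × ℕ) {C : ℝ}
    (h : ∀ i j, ‖PowerSeries.coeff m.1 (monomialSeries k (γ₁ : Matrix (Fin 2) (Fin 2) L) i)‖ *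
      ‖PowerSeries.coeff m.2 (monomialSeries k (γ₂ : Matrix (Fin 2) (Fin 2) L) j)‖ ≤ C) :
    ‖actA k γ₁ γ₂ f m‖ ≤ C * ‖f‖ := by
  have : IsUltrametricDist L := IsUltrametricDist.of_normedAlgebra ℚ_[p]
  have hC : 0 ≤ C := (mul_nonneg (norm_nonneg _) (norm_nonneg _)).trans (h 0 0)
  rw [actA_apply]
  refine IsUltrametricDist.norm_tsum_le_of_forall_le_of_nonneg (by positivity) fun x => ?_
  rw [norm_mul, norm_mul, mul_comm]
  exact mul_le_mul (h _ _) (A2.norm_apply_le f x) (norm_nonneg _) hC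

end Action

/-! ### The slash operators -/

section Slash

variable {K : Type*} [Field K] {p : ℕ} [Fact p.Prime] {L : Type*} [NormedField L]
  [NormedAlgebra ℚ_[p] L] {M : Type*} [AddCommGroup M] [Module L M]

/-- Compatibility of the operators `act` with multiplication, as for a right action. -/
def IsRightAction (act : Sigma0 p L → Sigma0 p L → M →ₗ[L] M) : Prop :=
  ∀ γ₁ γ₂ δ₁ δ₂ m, act (γ₁ * δ₁) (γ₂ * δ₂) m = act δ₁ δ₂ (act γ₁ γ₂ m)

variable (p) in
/-- The images of `g` lie in `Sigma0`. -/
abbrev ActsThrough (σ : Fin 2 → K →+* L) (g : GL (Fin 2) K) : Prop :=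
  ∀ s, (g : Matrix (Fin 2) (Fin 2) K).map (σ s) ∈ Sigma0 p L

variable {act : Sigma0 p L → Sigma0 p L → M →ₗ[L] M} {σ : Fin 2 → K →+* L}

theorem actGL_apply {g : GL (Fin 2) K} (hg : ActsThrough p σ g) (m : M) :
    actGL act σ g m = act ⟨_, hg 0⟩ ⟨_, hg 1⟩ m := by
  rw [actGL, dif_pos hg]

theorem slash_apply (g : GL (Fin 2) K) (φ : Div0 K →+ M) (E : Div0 K) :
    slash act σ g φ E = actGL act σ g (φ (moveDiv g E)) := rfl

theorem ActsThrough.mul {g h : GL (Fin 2) K} (hg : ActsThrough p σ g) (hh : ActsThrough p σ h) :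
    ActsThrough p σ (g * h) := fun s => by
  rw [Units.val_mul, Matrix.map_mul]
  exact mul_mem (hg s) (hh s)

/-- Both factors must have images in `Sigma0`, since outside it `actGL` is zero by convention and is
not multiplicative. -/
theorem slash_slash (hact : IsRightAction act) {g h : GL (Fin 2) K} (hg : ActsThrough p σ g)
    (hh : ActsThrough p σ h) (φ : Div0 K →+ M) :
    slash act σ h (slash act σ g φ) = slash act σ (g * h) φ := by
  ext E
  rw [slash_apply, slash_apply, slash_apply, moveDiv_mul, actGL_apply hg, actGL_apply hh,
    actGL_apply (hg.mul hh), ← hact]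
  congr 2 <;> exact Subtype.ext (by rw [Submonoid.coe_mul, ← Matrix.map_mul]; rfl)

theorem heckeMatrix_mul (a b : K) (α β : Kˣ) :
    heckeMatrix a α * heckeMatrix b β = heckeMatrix (b + a * β) (α * β) := by
  ext i j
  fin_cases i <;> fin_cases j <;> simp [heckeMatrix, Matrix.mul_apply, Fin.sum_univ_two]

end Slash

/-! ### Residue systems of fractional ideals -/

section ResidueSystems

variable {K : Type*} [Field K]

/-- Complete systems of representatives of `A` modulo `B`. -/
structure IsResidueSystem {ι : Type*} (A B : FractionalIdeal (𝓞 K)⁰ K) (x : ι → K) : Prop where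
  mem : ∀ t, x t ∈ A
  existsUnique : ∀ y ∈ A, ∃! t, y - x t ∈ B

theorem fractionalIdeal_sub_mem {A : FractionalIdeal (𝓞 K)⁰ K} {x y : K} (hx : x ∈ A)
    (hy : y ∈ A) : x - y ∈ A := A.val.sub_mem hx hy

theorem fractionalIdeal_add_mem {A : FractionalIdeal (𝓞 K)⁰ K} {x y : K} (hx : x ∈ A)
    (hy : y ∈ A) : x + y ∈ A := A.val.add_mem hx hy

theorem IsResidueSystem.exists_equiv {ι ι' : Type*} {A B : FractionalIdeal (𝓞 K)⁰ K} {x : ι → K}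
    {y : ι' → K} (hx : IsResidueSystem A B x) (hy : IsResidueSystem A B y) :
    ∃ e : ι ≃ ι', ∀ t, x t - y (e t) ∈ B := by
  choose f hf hf' using fun t => hy.existsUnique _ (hx.mem t)
  choose g hg hg' using fun t => hx.existsUnique _ (hy.mem t)
  have hneg : ∀ {a b : K}, a - b ∈ B → b - a ∈ B := fun {a b} h => by
    rw [← neg_sub]; exact B.val.neg_mem h
  exact ⟨⟨f, g, fun t => (hg' (f t) t (hneg (hf t))).symm, fun t => (hf' (g t) t (hneg (hg t))).symm⟩,
    hf⟩

theorem IsResidueSystem.comp_equiv {ι ι' : Type*} {A B : FractionalIdeal (𝓞 K)⁰ K} {x : ι → K}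
    (hx : IsResidueSystem A B x) (e : ι' ≃ ι) : IsResidueSystem A B (x ∘ e) :=
  ⟨fun t => hx.mem _, fun y hy => (e.existsUnique_congr_left).2 <| by
    simpa using hx.existsUnique y hy⟩

theorem IsResidueSystem.add_right {ι : Type*} {A B : FractionalIdeal (𝓞 K)⁰ K} {x : ι → K}
    (hx : IsResidueSystem A B x) {b : K} (hb : b ∈ A) : IsResidueSystem A B fun t => x t + b :=
  ⟨fun t => fractionalIdeal_add_mem (hx.mem t) hb, fun y hy => by
    simpa only [sub_add_eq_sub_sub_swap] using
      hx.existsUnique _ (fractionalIdeal_sub_mem hy hb)⟩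

variable [NumberField K]

theorem mul_mem_spanSingleton_mul (β : Kˣ) (A : FractionalIdeal (𝓞 K)⁰ K) {v : K} :
    v * β ∈ FractionalIdeal.spanSingleton (𝓞 K)⁰ (β : K) * A ↔ v ∈ A := by
  rw [FractionalIdeal.mem_singleton_mul]
  constructor
  · rintro ⟨y, hy, h⟩
    rw [mul_comm] at h
    rwa [mul_left_cancel₀ β.ne_zero h]
  · exact fun h => ⟨v, h, mul_comm _ _⟩

/-- Refinement along the chain `A ⊇ βC ⊇ βD`: multiplication by `β` turns representatives of `C`
modulo `D` into representatives of `βC` modulo `βD`. -/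
theorem IsResidueSystem.comp {ι ι' : Type*} {A C D : FractionalIdeal (𝓞 K)⁰ K} {β : Kˣ}
    {x : ι → K} {y : ι' → K}
    (hx : IsResidueSystem A (FractionalIdeal.spanSingleton (𝓞 K)⁰ (β : K) * C) x)
    (hy : IsResidueSystem C D y) (hCA : FractionalIdeal.spanSingleton (𝓞 K)⁰ (β : K) * C ≤ A)
    (hDC : D ≤ C) :
    IsResidueSystem A (FractionalIdeal.spanSingleton (𝓞 K)⁰ (β : K) * D)
      fun t : ι × ι' => x t.1 + y t.2 * β := by
  have hβ : ∀ t, y t * β ∈ FractionalIdeal.spanSingleton (𝓞 K)⁰ (β : K) * C := fun t =>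
    (mul_mem_spanSingleton_mul β C).2 (hy.mem t)
  have hle : FractionalIdeal.spanSingleton (𝓞 K)⁰ (β : K) * D ≤
    FractionalIdeal.spanSingleton (𝓞 K)⁰ (β : K) * C := mul_le_mul_right hDC _
  refine ⟨fun t => fractionalIdeal_add_mem (hx.mem _) (hCA (hβ _)), fun Y hY => ?_⟩
  obtain ⟨t, ht, ht'⟩ := hx.existsUnique Y hY
  obtain ⟨v, hv, hv'⟩ := FractionalIdeal.mem_singleton_mul.1 ht
  obtain ⟨u, hu, hu'⟩ := hy.existsUnique v hv
  have key : ∀ u', Y - (x t + y u' * β) = (v - y u') * β := fun u' => by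
    rw [← sub_sub, hv']; ring
  refine ⟨(t, u), ?_, ?_⟩
  · change Y - (x t + y u * β) ∈ _
    rw [key]
    exact (mul_mem_spanSingleton_mul β D).2 hu
  · rintro ⟨t', u'⟩ h
    change Y - (x t' + y u' * β) ∈ _ at h
    obtain rfl : t' = t := ht' t' (by
      have := fractionalIdeal_add_mem (hle h) (hβ u')
      change _ ∈ _
      convert this using 1
      ring)
    rw [key] at h
    rw [hu' u' ((mul_mem_spanSingleton_mul β D).1 h)]

end ResidueSystems

/-! ### Operators of Hecke type and their products -/

section HeckeType

variable {K : Type*} [Field K] [NumberField K] {p : ℕ} [Fact p.Prime] {L : Type*} [NormedField L]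
  [NormedAlgebra ℚ_[p] L] {M : Type*} [AddCommGroup M] [Module L M]

/-- Operators on tuples whose components are sums over complete residue systems, as for the Hecke
operator at an integral ideal `𝔞`. -/
structure IsHecke (act : Sigma0 p L → Sigma0 p L → M →ₗ[L] M) (σ : Fin 2 → K →+* L)
    (I : Fin (NumberField.classNumber K) → (Ideal (𝓞 K))⁰)
    (O : Module.End L (Fin (NumberField.classNumber K) → Div0 K →+ M)) (𝔞 : Ideal (𝓞 K))
    (l : Fin (NumberField.classNumber K) → Fin (NumberField.classNumber K))
    (δ : Fin (NumberField.classNumber K) → Kˣ) : Prop where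
  mul_eq : ∀ i, (𝔞 : FractionalIdeal (𝓞 K)⁰ K) * ((I i : Ideal (𝓞 K)) : FractionalIdeal (𝓞 K)⁰ K) =
    FractionalIdeal.spanSingleton (𝓞 K)⁰ (δ i : K) *
      ((I (l i) : Ideal (𝓞 K)) : FractionalIdeal (𝓞 K)⁰ K)
  exists_sum : ∀ i, ∃ (ι : Type) (_ : Fintype ι) (x : ι → K),
    IsResidueSystem ((I i : Ideal (𝓞 K)) : FractionalIdeal (𝓞 K)⁰ K)
      ((𝔞 : FractionalIdeal (𝓞 K)⁰ K) * ((I i : Ideal (𝓞 K)) : FractionalIdeal (𝓞 K)⁰ K)) x ∧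
    ∀ Φ, O Φ i = ∑ t, slash act σ (heckeMatrix (x t) (δ i)) (Φ (l i))

variable {act : Sigma0 p L → Sigma0 p L → M →ₗ[L] M} {σ : Fin 2 → K →+* L}
  {I : Fin (NumberField.classNumber K) → (Ideal (𝓞 K))⁰}

/-- The multiplier `δ` need not be an algebraic integer, but `δ J' = 𝔞 J` is integral and `J'`
contains an element that is a unit at `p`; hence the images of `δ` are integral. -/
theorem actsThrough_heckeMatrix {J J' : (Ideal (𝓞 K))⁰} {𝔞 : Ideal (𝓞 K)} {δ : Kˣ}
    (hJ' : IsCoprime (J' : Ideal (𝓞 K)) (Ideal.span {(p : 𝓞 K)}))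
    (h : (𝔞 : FractionalIdeal (𝓞 K)⁰ K) * ((J : Ideal (𝓞 K)) : FractionalIdeal (𝓞 K)⁰ K) =
      FractionalIdeal.spanSingleton (𝓞 K)⁰ (δ : K) *
        ((J' : Ideal (𝓞 K)) : FractionalIdeal (𝓞 K)⁰ K))
    {x : K} (hx : x ∈ ((J : Ideal (𝓞 K)) : FractionalIdeal (𝓞 K)⁰ K)) :
    ActsThrough p σ (heckeMatrix x δ) := by
  intro s
  have hδ : ‖σ s (δ : K)‖ ≤ 1 := by
    refine norm_embedding_le_of_coprime (σ s) hJ' fun t ht => ?_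
    have ht := FractionalIdeal.mul_mem_mul
      (FractionalIdeal.mem_spanSingleton_self (𝓞 K)⁰ (δ : K))
      (FractionalIdeal.mem_coeIdeal_of_mem (𝓞 K)⁰ ht)
    rw [← h, ← FractionalIdeal.coeIdeal_mul] at ht
    obtain ⟨y, -, hy⟩ := (FractionalIdeal.mem_coeIdeal _).1 ht
    rw [← hy]
    exact norm_embedding_le_one p (σ s) y
  have hb : ‖σ s x‖ ≤ 1 := by
    obtain ⟨y, -, hy⟩ := (FractionalIdeal.mem_coeIdeal _).1 hx
    rw [← hy]
    exact norm_embedding_le_one p (σ s) y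
  refine ⟨fun i' j' => ?_, ?_, ?_, ?_⟩
  · fin_cases i' <;> fin_cases j'
    · simp [heckeMatrix]
    · simpa [heckeMatrix] using hb
    · simp [heckeMatrix]
    · simpa [heckeMatrix] using hδ
  · simp [heckeMatrix]
  · simp [heckeMatrix]
  · simp [heckeMatrix, Matrix.det_fin_two]

theorem coeIdeal_mul_le (𝔞 J : Ideal (𝓞 K)) :
    (𝔞 : FractionalIdeal (𝓞 K)⁰ K) * (J : FractionalIdeal (𝓞 K)⁰ K) ≤ J := by
  rw [← FractionalIdeal.coeIdeal_mul]
  exact (FractionalIdeal.coeIdeal_le_coeIdeal K).2 Ideal.mul_le_right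

/-- The product of `!![1, y; 0, α]` and `!![1, x; 0, β]` is `!![1, x + y β; 0, α β]`, so composing
the operators refines one residue system by the other as in `IsResidueSystem.comp`. -/
theorem IsHecke.mul (hact : IsRightAction act)
    (hI : ∀ i, IsCoprime (I i : Ideal (𝓞 K)) (Ideal.span {(p : 𝓞 K)}))
    {O O' : Module.End L (Fin (NumberField.classNumber K) → Div0 K →+ M)} {𝔞 𝔟 : Ideal (𝓞 K)}
    {l l' : Fin (NumberField.classNumber K) → Fin (NumberField.classNumber K)}
    {α β : Fin (NumberField.classNumber K) → Kˣ} (hO : IsHecke act σ I O 𝔞 l α)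
    (hO' : IsHecke act σ I O' 𝔟 l' β) :
    IsHecke act σ I (O' * O) (𝔞 * 𝔟) (l ∘ l') fun i => α (l' i) * β i := by
  have key : ∀ i, ((𝔞 * 𝔟 : Ideal (𝓞 K)) : FractionalIdeal (𝓞 K)⁰ K) *
      ((I i : Ideal (𝓞 K)) : FractionalIdeal (𝓞 K)⁰ K) =
      FractionalIdeal.spanSingleton (𝓞 K)⁰ (β i : K) * ((𝔞 : FractionalIdeal (𝓞 K)⁰ K) *
        ((I (l' i) : Ideal (𝓞 K)) : FractionalIdeal (𝓞 K)⁰ K)) := fun i => by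
    rw [FractionalIdeal.coeIdeal_mul, mul_assoc, hO'.mul_eq, mul_left_comm]
  refine ⟨fun i => ?_, fun i => ?_⟩
  · rw [key, hO.mul_eq, ← mul_assoc, FractionalIdeal.spanSingleton_mul_spanSingleton,
      Units.val_mul, mul_comm (β i : K)]
    rfl
  · obtain ⟨ι, _, x, hx, hxO⟩ := hO'.exists_sum i
    obtain ⟨ι', _, y, hy, hyO⟩ := hO.exists_sum (l' i)
    refine ⟨ι × ι', inferInstance, fun t => x t.1 + y t.2 * β i, ?_, fun Φ => ?_⟩
    · rw [key]
      rw [hO'.mul_eq] at hx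
      refine hx.comp hy ?_ (coeIdeal_mul_le _ _)
      rw [← hO'.mul_eq]
      exact coeIdeal_mul_le _ _
    · rw [Module.End.mul_apply, hxO, Fintype.sum_prod_type]
      refine Finset.sum_congr rfl fun t _ => ?_
      rw [hyO, map_sum]
      refine Finset.sum_congr rfl fun u _ => ?_
      rw [slash_slash hact (actsThrough_heckeMatrix (hI _) (hO.mul_eq (l' i)) (hy.mem u))
        (actsThrough_heckeMatrix (hI _) (hO'.mul_eq i) (hx.mem t)), heckeMatrix_mul]
      rfl

/-- Since `x - y` lies in `𝔞 J = δ J'`, the two matrices differ by left multiplication by a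
unipotent element of the level group of `J'`, which fixes `φ`. -/
theorem slash_heckeMatrix_eq (hact : IsRightAction act) {J J' : (Ideal (𝓞 K))⁰} {𝔞 𝔫 : Ideal (𝓞 K)}
    {δ : Kˣ} (hJ' : IsCoprime (J' : Ideal (𝓞 K)) (Ideal.span {(p : 𝓞 K)}))
    (h : (𝔞 : FractionalIdeal (𝓞 K)⁰ K) * ((J : Ideal (𝓞 K)) : FractionalIdeal (𝓞 K)⁰ K) =
      FractionalIdeal.spanSingleton (𝓞 K)⁰ (δ : K) *
        ((J' : Ideal (𝓞 K)) : FractionalIdeal (𝓞 K)⁰ K))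
    {x y : K} (hy : y ∈ ((J : Ideal (𝓞 K)) : FractionalIdeal (𝓞 K)⁰ K))
    (hxy : x - y ∈ (𝔞 : FractionalIdeal (𝓞 K)⁰ K) *
      ((J : Ideal (𝓞 K)) : FractionalIdeal (𝓞 K)⁰ K)) {φ : Div0 K →+ M}
    (hφ : φ ∈ Symb act σ (levelGroup 𝔫 J')) :
    slash act σ (heckeMatrix x δ) φ = slash act σ (heckeMatrix y δ) φ := by
  rw [h] at hxy
  obtain ⟨z, hz, hz'⟩ := FractionalIdeal.mem_singleton_mul.1 hxy
  have h1 : heckeMatrix x δ = heckeMatrix z 1 * heckeMatrix y δ := by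
    rw [heckeMatrix_mul, one_mul, mul_comm z, ← hz']
    congr 1
    ring
  let g : SL(2, K) := ⟨!![1, z; 0, 1], by simp⟩
  have hg : g ∈ levelGroup 𝔫 J' := by
    refine ⟨?_, ?_, hz, ?_⟩
    · simp [g, FractionalIdeal.zero_mem]
    · simp [g, FractionalIdeal.zero_mem]
    · simp [g, FractionalIdeal.zero_mem]
  have h2 : (g : GL (Fin 2) K) = heckeMatrix z 1 := by
    ext i j
    fin_cases i <;> fin_cases j <;> simp [heckeMatrix, g, Matrix.SpecialLinearGroup.toGL]
  have h3 : slash act σ (heckeMatrix z 1) φ = φ := h2 ▸ hφ g hg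
  rw [h1, ← slash_slash hact ?_ (actsThrough_heckeMatrix hJ' h hy), h3]
  -- The unipotent matrix is a Hecke matrix for the unit ideal with multiplier `1`.
  refine actsThrough_heckeMatrix (𝔞 := 1) (J := J') hJ' ?_ hz
  simp

/-- Two operators of the same type agree on modular symbols. -/
theorem IsHecke.eq_of_mem (hact : IsRightAction act)
    (hI : ∀ i, IsCoprime (I i : Ideal (𝓞 K)) (Ideal.span {(p : 𝓞 K)})) {𝔫 : Ideal (𝓞 K)}
    {O O' : Module.End L (Fin (NumberField.classNumber K) → Div0 K →+ M)} {𝔞 : Ideal (𝓞 K)}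
    {l : Fin (NumberField.classNumber K) → Fin (NumberField.classNumber K)}
    {δ : Fin (NumberField.classNumber K) → Kˣ} (hO : IsHecke act σ I O 𝔞 l δ)
    (hO' : IsHecke act σ I O' 𝔞 l δ) {Φ : Fin (NumberField.classNumber K) → Div0 K →+ M}
    (hΦ : Φ ∈ bianchiSymbols act σ 𝔫 I) : O Φ = O' Φ := by
  funext i
  obtain ⟨ι, _, x, hx, hxO⟩ := hO.exists_sum i
  obtain ⟨ι', _, y, hy, hyO⟩ := hO'.exists_sum i
  obtain ⟨e, he⟩ := hx.exists_equiv hy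
  rw [hxO, hyO, ← e.sum_comp]
  exact Finset.sum_congr rfl fun t _ => slash_heckeMatrix_eq hact (hI _) (hO.mul_eq i) (hy.mem _)
    (he t) (hΦ (l i) (Set.mem_univ _))

end HeckeType

/-! ### Permutation of Hecke cosets by the level group -/

section Cosets

variable {K : Type*} [Field K] [NumberField K]

open FractionalIdeal in
/-- Right multiplication by `γ` permutes the cosets in the Hecke operator. -/
theorem exists_heckeMatrix_mul_eq {J J' : (Ideal (𝓞 K))⁰} {𝔞 𝔫 : Ideal (𝓞 K)} {δ : Kˣ}
    (h𝔞 : 𝔫 ≤ 𝔞)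
    (h : (𝔞 : FractionalIdeal (𝓞 K)⁰ K) * ((J : Ideal (𝓞 K)) : FractionalIdeal (𝓞 K)⁰ K) =
      spanSingleton (𝓞 K)⁰ (δ : K) * ((J' : Ideal (𝓞 K)) : FractionalIdeal (𝓞 K)⁰ K))
    {γ : SL(2, K)} (hγ : γ ∈ levelGroup 𝔫 J) {x y : K}
    (hx : x ∈ ((J : Ideal (𝓞 K)) : FractionalIdeal (𝓞 K)⁰ K))
    (hy : y ∈ ((J : Ideal (𝓞 K)) : FractionalIdeal (𝓞 K)⁰ K))
    (hxy : x + γ 0 1 - y ∈ (𝔞 : FractionalIdeal (𝓞 K)⁰ K) *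
      ((J : Ideal (𝓞 K)) : FractionalIdeal (𝓞 K)⁰ K)) :
    ∃ γ' ∈ levelGroup 𝔫 J', heckeMatrix x δ * (γ : GL (Fin 2) K) =
      (γ' : GL (Fin 2) K) * heckeMatrix y δ := by
  have hJ : ((J : Ideal (𝓞 K)) : FractionalIdeal (𝓞 K)⁰ K) ≠ 0 :=
    coeIdeal_ne_zero.2 (nonZeroDivisors.ne_zero J.2)
  have hJ' : ((J' : Ideal (𝓞 K)) : FractionalIdeal (𝓞 K)⁰ K) ≠ 0 :=
    coeIdeal_ne_zero.2 (nonZeroDivisors.ne_zero J'.2)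
  obtain ⟨h1, h2, h3, h4⟩ := hγ
  have hle : (𝔫 : FractionalIdeal (𝓞 K)⁰ K) ≤ 𝔞 := (coeIdeal_le_coeIdeal K).2 h𝔞
  have hcx : ∀ {z : K}, z ∈ ((J : Ideal (𝓞 K)) : FractionalIdeal (𝓞 K)⁰ K) →
      γ 1 0 * z ∈ (𝔫 : FractionalIdeal (𝓞 K)⁰ K) := fun {z} hz => by
    have := mul_mem_mul h4 hz
    rwa [mul_assoc, inv_mul_cancel₀ hJ, mul_one] at this
  have h11 : γ 0 0 + x * γ 1 0 - 1 ∈ (𝔫 : FractionalIdeal (𝓞 K)⁰ K) := by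
    convert fractionalIdeal_add_mem h1 (hcx hx) using 1
    ring
  -- The product equation forces the upper right entry of `γ'` to be this expression divided by `δ`.
  -- The expression is `(x + γ 0 1 - y) + (γ 1 1 - 1) x - (γ 0 0 + x γ 1 0 - 1) y`, with every term
  -- in `𝔞 J = δ J'`.
  obtain ⟨z, hz, hz'⟩ : ∃ z ∈ ((J' : Ideal (𝓞 K)) : FractionalIdeal (𝓞 K)⁰ K),
      x * γ 1 1 + γ 0 1 - (γ 0 0 + x * γ 1 0) * y = δ * z := by
    rw [← mem_singleton_mul, ← h]
    have e1 := mul_mem_mul (hle h2) hx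
    have e2 := mul_mem_mul (hle h11) hy
    convert fractionalIdeal_sub_mem (fractionalIdeal_add_mem hxy e1) e2 using 1
    ring
  have hdet : γ 0 0 * γ 1 1 - γ 0 1 * γ 1 0 = 1 := by
    rw [← Matrix.det_fin_two]
    exact γ.det_coe
  have hδ : (δ : K) ≠ 0 := δ.ne_zero
  let γ' : SL(2, K) := ⟨!![γ 0 0 + x * γ 1 0, z; δ * γ 1 0, γ 1 1 - γ 1 0 * y], by
    rw [Matrix.det_fin_two_of]
    linear_combination hdet + γ 1 0 * hz'⟩
  refine ⟨γ', ⟨h11, ?_, hz, ?_⟩, ?_⟩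
  · change γ 1 1 - γ 1 0 * y - 1 ∈ _
    rw [sub_right_comm]
    exact fractionalIdeal_sub_mem h2 (hcx hy)
  · change (δ : K) * γ 1 0 ∈ _
    -- As ideals `(δ) = 𝔞 J J'⁻¹`, so `δ 𝔫 J⁻¹ = 𝔞 𝔫 J'⁻¹`, which is contained in `𝔫 J'⁻¹`.
    have e : (𝔫 : FractionalIdeal (𝓞 K)⁰ K) * ((J : Ideal (𝓞 K)) : FractionalIdeal (𝓞 K)⁰ K)⁻¹ *
        spanSingleton (𝓞 K)⁰ (δ : K) = 𝔞 * (𝔫 * ((J' : Ideal (𝓞 K)) : FractionalIdeal (𝓞 K)⁰ K)⁻¹) := by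
      have h' : spanSingleton (𝓞 K)⁰ (δ : K) = (𝔞 : FractionalIdeal (𝓞 K)⁰ K) *
          ((J : Ideal (𝓞 K)) : FractionalIdeal (𝓞 K)⁰ K) *
            ((J' : Ideal (𝓞 K)) : FractionalIdeal (𝓞 K)⁰ K)⁻¹ := by
        rw [h, mul_assoc, mul_inv_cancel₀ hJ', mul_one]
      rw [h']
      field_simp
    have h5 := mul_mem_mul h4 (mem_spanSingleton_self (𝓞 K)⁰ (δ : K))
    rw [e] at h5
    rw [mul_comm (δ : K)]
    have h6 : (𝔞 : FractionalIdeal (𝓞 K)⁰ K) * (𝔫 * ((J' : Ideal (𝓞 K)) : FractionalIdeal (𝓞 K)⁰ K)⁻¹)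
        ≤ 1 * (𝔫 * ((J' : Ideal (𝓞 K)) : FractionalIdeal (𝓞 K)⁰ K)⁻¹) :=
      mul_le_mul_left coeIdeal_le_one _
    rw [one_mul] at h6
    exact h6 h5
  · apply Units.ext
    change !![1, x; 0, (δ : K)] * (γ : Matrix (Fin 2) (Fin 2) K) =
      !![γ 0 0 + x * γ 1 0, z; δ * γ 1 0, γ 1 1 - γ 1 0 * y] * !![1, y; 0, (δ : K)]
    ext i j
    fin_cases i <;> fin_cases j <;> simp [Matrix.mul_apply, Fin.sum_univ_two]
    · linear_combination hz'
    · ring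

end Cosets

/-! ### Powers and commutation of the Hecke operators -/

section HeckeOperators

variable {K : Type*} [Field K] [NumberField K] {p : ℕ} [Fact p.Prime] {L : Type*} [NormedField L]
  [NormedAlgebra ℚ_[p] L] {M : Type*} [AddCommGroup M] [Module L M]
  {act : Sigma0 p L → Sigma0 p L → M →ₗ[L] M} {σ : Fin 2 → K →+* L}
  {I : Fin (NumberField.classNumber K) → (Ideal (𝓞 K))⁰}

/-- Because `I i` is coprime to `𝔭`, one has `𝔭 ∩ I i = 𝔭 I i`; elements of `I i` representing the
classes modulo `𝔭` thus represent `I i` modulo `𝔭 I i`. -/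
theorem isHecke_heckeU {𝔭 : Ideal (𝓞 K)} (h𝔭 : 𝔭 ≠ ⊥)
    (hI : ∀ i, IsCoprime (I i : Ideal (𝓞 K)) 𝔭) (c : HeckeChoice I 𝔭) :
    IsHecke act σ I (heckeU act σ c) 𝔭 c.j c.α := by
  refine ⟨c.mul_eq, fun i => ?_⟩
  have : Finite (𝓞 K ⧸ 𝔭) := Ideal.finiteQuotientOfFreeOfNeBot 𝔭 h𝔭
  let e := (Finite.equivFin (𝓞 K ⧸ 𝔭)).symm
  refine ⟨Fin (Nat.card (𝓞 K ⧸ 𝔭)), inferInstance, (fun a => (c.rep i a : K)) ∘ e,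
    IsResidueSystem.comp_equiv ⟨fun a => FractionalIdeal.mem_coeIdeal_of_mem _ (c.rep_mem i a),
      fun y hy => ?_⟩ e, fun Φ => ?_⟩
  · obtain ⟨y, hy', rfl⟩ := (FractionalIdeal.mem_coeIdeal _).1 hy
    have key : ∀ a, algebraMap (𝓞 K) K y - (c.rep i a : K) ∈ (𝔭 : FractionalIdeal (𝓞 K)⁰ K) *
        ((I i : Ideal (𝓞 K)) : FractionalIdeal (𝓞 K)⁰ K) ↔ a = Ideal.Quotient.mk 𝔭 y := fun a => by
      rw [← FractionalIdeal.coeIdeal_mul, Ideal.mul_eq_inf_of_isCoprime (hI i).symm, ← map_sub,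
        FractionalIdeal.mem_coeIdeal]
      nth_rewrite 2 [← c.mk_rep i a]
      rw [eq_comm (b := Ideal.Quotient.mk 𝔭 y), Ideal.Quotient.eq]
      constructor
      · rintro ⟨t, ht, h⟩
        rw [← FaithfulSMul.algebraMap_injective (𝓞 K) K h]
        exact ht.1
      · exact fun h => ⟨_, ⟨h, sub_mem hy' (c.rep_mem i a)⟩, rfl⟩
    exact ⟨_, (key _).2 rfl, fun a ha => (key a).1 ha⟩
  · cases nonempty_fintype (𝓞 K ⧸ 𝔭)
    simp only [heckeU, LinearMap.pi_apply, LinearMap.comp_apply, LinearMap.proj_apply]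
    rw [finsum_eq_sum_of_fintype, LinearMap.sum_apply, ← e.sum_comp]
    rfl

theorem IsHecke.exists_pow (hact : IsRightAction act)
    (hI : ∀ i, IsCoprime (I i : Ideal (𝓞 K)) (Ideal.span {(p : 𝓞 K)}))
    {O : Module.End L (Fin (NumberField.classNumber K) → Div0 K →+ M)} {𝔞 : Ideal (𝓞 K)}
    {l : Fin (NumberField.classNumber K) → Fin (NumberField.classNumber K)}
    {δ : Fin (NumberField.classNumber K) → Kˣ} (hO : IsHecke act σ I O 𝔞 l δ) (n : ℕ) :
    ∃ ε, IsHecke act σ I (O ^ (n + 1)) (𝔞 ^ (n + 1)) (l^[n + 1]) ε := by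
  induction n with
  | zero => exact ⟨δ, by simpa using hO⟩
  | succ n ih =>
    obtain ⟨ε, hε⟩ := ih
    have h := hO.mul hact hI hε
    rw [← pow_succ O, ← pow_succ' 𝔞, ← Function.iterate_succ'] at h
    exact ⟨_, h⟩

/-- When the index map is trivial, the multipliers of the iterates are pointwise powers rather than
products along an orbit. -/
theorem IsHecke.pow_of_id (hact : IsRightAction act)
    (hI : ∀ i, IsCoprime (I i : Ideal (𝓞 K)) (Ideal.span {(p : 𝓞 K)}))
    {O : Module.End L (Fin (NumberField.classNumber K) → Div0 K →+ M)} {𝔞 : Ideal (𝓞 K)}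
    {δ : Fin (NumberField.classNumber K) → Kˣ} (hO : IsHecke act σ I O 𝔞 id δ) (n : ℕ) :
    IsHecke act σ I (O ^ (n + 1)) (𝔞 ^ (n + 1)) id (δ ^ (n + 1)) := by
  induction n with
  | zero => simpa using hO
  | succ n ih =>
    rw [pow_succ O, pow_succ' 𝔞, pow_succ' δ]
    exact hO.mul hact hI ih

open FractionalIdeal in
/-- The `h`-th iterate of multiplication by a class is the identity, `h` being the class number. -/
theorem eq_of_pow_classNumber (hI : Function.Bijective fun i => ClassGroup.mk0 (I i))
    {𝔞 : Ideal (𝓞 K)} (h𝔞 : 𝔞 ≠ ⊥) {i j : Fin (NumberField.classNumber K)} {δ : Kˣ} {n : ℕ}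
    (hn : NumberField.classNumber K = n)
    (h : ((𝔞 ^ n : Ideal (𝓞 K)) : FractionalIdeal (𝓞 K)⁰ K) *
      ((I i : Ideal (𝓞 K)) : FractionalIdeal (𝓞 K)⁰ K) =
      spanSingleton (𝓞 K)⁰ (δ : K) * ((I j : Ideal (𝓞 K)) : FractionalIdeal (𝓞 K)⁰ K)) : j = i := by
  apply hI.1
  let a : (Ideal (𝓞 K))⁰ := ⟨𝔞, mem_nonZeroDivisors_of_ne_zero h𝔞⟩
  have h1 : ClassGroup.mk0 (a ^ n) = 1 := by
    rw [map_pow, ← hn]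
    exact pow_card_eq_one
  obtain ⟨x, y, hy, hxy⟩ := IsFractionRing.div_surjective (A := 𝓞 K) (δ : K)
  have hy0 : y ≠ 0 := nonZeroDivisors.ne_zero hy
  have hx0 : x ≠ 0 := by
    rintro rfl
    rw [map_zero, zero_div] at hxy
    exact δ.ne_zero hxy.symm
  change ClassGroup.mk0 (I j) = ClassGroup.mk0 (I i)
  rw [← one_mul (ClassGroup.mk0 (I i)), ← h1, ← map_mul, ClassGroup.mk0_eq_mk0_iff]
  refine ⟨x, y, hx0, hy0, ?_⟩
  have hyK : (algebraMap (𝓞 K) K y) ≠ 0 := by simpa using hy0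
  rw [← coeIdeal_inj (K := K), coeIdeal_mul, coeIdeal_mul, coeIdeal_span_singleton,
    coeIdeal_span_singleton]
  have h2 : (((a ^ n * I i : (Ideal (𝓞 K))⁰) : Ideal (𝓞 K)) :
      FractionalIdeal (𝓞 K)⁰ K) = ((𝔞 ^ n : Ideal (𝓞 K)) :
        FractionalIdeal (𝓞 K)⁰ K) * ((I i : Ideal (𝓞 K)) : FractionalIdeal (𝓞 K)⁰ K) :=
    coeIdeal_mul _ _
  rw [h2, h, ← mul_assoc, spanSingleton_mul_spanSingleton, ← hxy, mul_div_cancel₀ _ hyK]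

/-- The unit rank of an imaginary quadratic field is zero, so every unit is a root of unity. -/
theorem unit_pow_torsionOrder [Algebra.IsQuadraticExtension ℚ K] [NumberField.IsTotallyComplex K]
    (u : (𝓞 K)ˣ) : u ^ NumberField.Units.torsionOrder K = 1 := by
  have hr : NumberField.Units.rank K = 0 := by
    have h1 := NumberField.IsTotallyComplex.finrank K
    rw [Algebra.IsQuadraticExtension.finrank_eq_two] at h1
    rw [NumberField.Units.rank, NumberField.InfinitePlace.card_eq_nrRealPlaces_add_nrComplexPlaces,
      NumberField.IsTotallyComplex.nrRealPlaces_eq_zero]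
    lia
  obtain ⟨⟨ζ, e⟩, h, -⟩ := NumberField.Units.exist_unique_eq_mul_prod K u
  have : IsEmpty (Fin (NumberField.Units.rank K)) := by rw [hr]; infer_instance
  rw [Finset.univ_eq_empty, Finset.prod_empty, mul_one] at h
  rw [h, ← Subgroup.coe_pow, NumberField.Units.torsionOrder]
  exact congrArg Subtype.val pow_card_eq_one'

open FractionalIdeal in
/-- A power of a Hecke operator commutes with a Hecke operator. -/
theorem IsHecke.exists_pow_comm [Algebra.IsQuadraticExtension ℚ K] [NumberField.IsTotallyComplex K]
    (hact : IsRightAction act) (hIbij : Function.Bijective fun i => ClassGroup.mk0 (I i))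
    (hI : ∀ i, IsCoprime (I i : Ideal (𝓞 K)) (Ideal.span {(p : 𝓞 K)})) {𝔫 : Ideal (𝓞 K)}
    {T R : Module.End L (Fin (NumberField.classNumber K) → Div0 K →+ M)} {𝔮 𝔭 : Ideal (𝓞 K)}
    (h𝔮 : 𝔮 ≠ ⊥) {j l : Fin (NumberField.classNumber K) → Fin (NumberField.classNumber K)}
    {β α : Fin (NumberField.classNumber K) → Kˣ} (hT : IsHecke act σ I T 𝔮 j β)
    (hR : IsHecke act σ I R 𝔭 l α) :
    ∃ m : ℕ, m ≠ 0 ∧ ∀ Φ ∈ bianchiSymbols act σ 𝔫 I, (T ^ m) (R Φ) = R ((T ^ m) Φ) := by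
  obtain ⟨n, hn⟩ : ∃ n, NumberField.classNumber K = n + 1 :=
    Nat.exists_eq_succ_of_ne_zero (NumberField.classNumber_ne_zero K)
  obtain ⟨w, hw⟩ : ∃ w, NumberField.Units.torsionOrder K = w + 1 :=
    Nat.exists_eq_succ_of_ne_zero (NumberField.Units.torsionOrder_ne_zero K)
  obtain ⟨ε, hε⟩ := hT.exists_pow hact hI n
  have hj : j^[n + 1] = id := by
    funext i
    exact eq_of_pow_classNumber (i := i) (j := j^[n + 1] i) hIbij h𝔮 hn (hε.mul_eq i)
  rw [hj] at hε
  -- Every `ε i` generates the ideal `𝔮 ^ (n + 1)`, so any two differ by a unit, which the power `w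
  -- + 1` kills.
  have hconst : ∀ i i', ε i ^ (w + 1) = ε i' ^ (w + 1) := by
    intro i i'
    have hs : ∀ i, spanSingleton (𝓞 K)⁰ (ε i : K) = ((𝔮 ^ (n + 1) : Ideal (𝓞 K)) :
        FractionalIdeal (𝓞 K)⁰ K) := fun i =>
      (mul_right_cancel₀ (coeIdeal_ne_zero.2 (nonZeroDivisors.ne_zero (I i).2)) (hε.mul_eq i)).symm
    have h1 : ∀ i i', ∃ u : 𝓞 K, (ε i : K) = u * (ε i' : K) := fun i i' => by
      have : (ε i : K) ∈ spanSingleton (𝓞 K)⁰ (ε i' : K) := by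
        rw [hs i', ← hs i]
        exact mem_spanSingleton_self _ _
      obtain ⟨u, hu⟩ := (mem_spanSingleton _).1 this
      exact ⟨u, by rw [← hu, Algebra.smul_def]⟩
    obtain ⟨u, hu⟩ := h1 i i'
    obtain ⟨v, hv⟩ := h1 i' i
    have huv : u * v = 1 := by
      apply FaithfulSMul.algebraMap_injective (𝓞 K) K
      rw [map_mul, map_one]
      apply mul_right_cancel₀ (ε i).ne_zero
      rw [one_mul, mul_assoc, ← hv, ← hu]
    have hu1 : u ^ (w + 1) = 1 := by
      have := unit_pow_torsionOrder (Units.mkOfMulEqOne u v huv)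
      rw [hw] at this
      simpa using congrArg Units.val this
    ext
    rw [Units.val_pow_eq_pow_val, Units.val_pow_eq_pow_val, hu, mul_pow, ← map_pow, hu1, map_one,
      one_mul]
  have hTm := hε.pow_of_id hact hI w
  rw [← pow_mul, ← pow_mul] at hTm
  refine ⟨(n + 1) * (w + 1), by positivity, fun Φ hΦ => ?_⟩
  have h1 := hR.mul hact hI hTm
  have h2 := hTm.mul hact hI hR
  -- The two composites have the same ideal and index map, and the same multipliers because `ε ^ (w
  -- + 1)` does not depend on the component.
  have h3 : IsHecke act σ I (R * T ^ ((n + 1) * (w + 1))) (𝔭 * 𝔮 ^ ((n + 1) * (w + 1))) (l ∘ id)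
      fun i => α (id i) * (ε ^ (w + 1)) i := by
    convert h2 using 1
    · exact mul_comm _ _
    · rfl
    · funext i
      rw [mul_comm]
      exact congrArg (· * α i) (hconst _ _)
  exact h1.eq_of_mem hact hI h3 hΦ

end HeckeOperators

/-! ### Boundedness of modular symbols -/

section Boundedness

variable {K : Type*} [Field K] [NumberField K] {p : ℕ} [Fact p.Prime] {L : Type*} [NormedField L]
  [NormedAlgebra ℚ_[p] L] {M : Type*} [AddCommGroup M] [Module L M]
  {act : Sigma0 p L → Sigma0 p L → M →ₗ[L] M} {σ : Fin 2 → K →+* L}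

/-- A principal congruence subgroup lies in the twisted level group: `N ∈ J` handles the upper right
entry, and `𝔫 ⊆ 𝔫 J⁻¹`, as `J` is integral, the lower left one. -/
theorem map_mem_levelGroup {𝔫 : Ideal (𝓞 K)} {J : (Ideal (𝓞 K))⁰} {N : 𝓞 K}
    (hN : N ∈ 𝔫 * (J : Ideal (𝓞 K))) {g : SL(2, 𝓞 K)}
    (hg : ∀ i j, N ∣ g i j - (1 : Matrix (Fin 2) (Fin 2) (𝓞 K)) i j) :
    (g.map (algebraMap (𝓞 K) K) : SL(2, K)) ∈ levelGroup 𝔫 J := by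
  have hJ : ((J : Ideal (𝓞 K)) : FractionalIdeal (𝓞 K)⁰ K) ≠ 0 :=
    FractionalIdeal.coeIdeal_ne_zero.2 (nonZeroDivisors.ne_zero J.2)
  have h1 : ∀ i j, g i j - (1 : Matrix (Fin 2) (Fin 2) (𝓞 K)) i j ∈ 𝔫 := fun i j =>
    Ideal.mem_of_dvd _ (hg i j) (Ideal.mul_le_left hN)
  have h2 : ∀ i j, g i j - (1 : Matrix (Fin 2) (Fin 2) (𝓞 K)) i j ∈ (J : Ideal (𝓞 K)) := fun i j =>
    Ideal.mem_of_dvd _ (hg i j) (Ideal.mul_le_right hN)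
  have h01 := h2 0 1
  have h10 := h1 1 0
  simp only [ne_eq, zero_ne_one, one_ne_zero, not_false_eq_true, Matrix.one_apply_ne, sub_zero]
    at h01 h10
  refine ⟨?_, ?_, ?_, ?_⟩
  · have := FractionalIdeal.mem_coeIdeal_of_mem (𝓞 K)⁰ (P := K) (h1 0 0)
    simpa using this
  · have := FractionalIdeal.mem_coeIdeal_of_mem (𝓞 K)⁰ (P := K) (h1 1 1)
    simpa using this
  · exact FractionalIdeal.mem_coeIdeal_of_mem (𝓞 K)⁰ h01
  · have h3 : (1 : K) ∈ ((J : Ideal (𝓞 K)) : FractionalIdeal (𝓞 K)⁰ K)⁻¹ := by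
      rw [FractionalIdeal.mem_inv_iff hJ]
      intro y hy
      rw [one_mul]
      exact FractionalIdeal.coeIdeal_le_one hy
    have := FractionalIdeal.mul_mem_mul (FractionalIdeal.mem_coeIdeal_of_mem (𝓞 K)⁰ h10) h3
    rwa [mul_one] at this

/-- Modular symbols are bounded, with respect to an invariant ultrametric on the coefficients. -/
theorem exists_bound_of_mem_Symb [Algebra.IsQuadraticExtension ℚ K] {𝔫 : Ideal (𝓞 K)} (h𝔫 : 𝔫 ≠ ⊥)
    (J : (Ideal (𝓞 K))⁰) {ν : M → ℝ} (hsub : ∀ m m', ν (m - m') ≤ max (ν m) (ν m'))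
    (hν : ∀ γ₁ γ₂ m, ν (act γ₁ γ₂ m) ≤ ν m) {φ : Div0 K →+ M}
    (hφ : φ ∈ Symb act σ (levelGroup 𝔫 J)) : ∃ B, ∀ E, ν (φ E) ≤ B := by
  have h0 : ∀ m, ν 0 ≤ ν m := fun m => by simpa using hsub m m
  obtain ⟨N, hN, hN0⟩ := Submodule.exists_mem_ne_zero_of_ne_bot
    (mul_ne_zero h𝔫 (nonZeroDivisors.ne_zero J.2))
  refine CongruenceInvariant.bounded hN0 (ψ := fun E => ν (φ E)) (fun g hg E => ?_)
    fun E F => by rw [map_sub]; exact hsub _ _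
  have hmem := inv_mem (map_mem_levelGroup hN hg)
  -- Invariance under the inverse, applied to the moved divisor, gives `φ(gE) = φ(E) | g⁻¹`, and the
  -- action does not increase `ν`.
  have h1 := DFunLike.congr_fun (hφ _ hmem) (moveDiv (g.map (algebraMap (𝓞 K) K) : SL(2, K)) E)
  rw [slash_apply, ← moveDiv_mul, ← map_mul, inv_mul_cancel, map_one, moveDiv_one] at h1
  change ν (φ (moveDiv (g.map (algebraMap (𝓞 K) K) : SL(2, K)) E)) ≤ ν (φ E)
  rw [← h1, actGL]
  split_ifs
  · exact hν _ _ _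
  · exact h0 _

end Boundedness

/-! ### Contraction on the kernel of a specialisation map -/

section Specialisation

variable {K : Type*} [Field K] {p : ℕ} [Fact p.Prime] {L : Type*} [NormedField L]
  [NormedAlgebra ℚ_[p] L] {M : Type*} [NormedAddCommGroup M] [NormedSpace L M]
  {M' : Type*} [AddCommGroup M'] [Module L M']

/-- An equivariant surjection `f` from a normed space with a contracting right action, with a linear
section `s` such that `s ∘ f` is contracting. -/
structure IsSpecialisation (act : Sigma0 p L → Sigma0 p L → M →ₗ[L] M)
    (act' : Sigma0 p L → Sigma0 p L → M' →ₗ[L] M') (f : M →ₗ[L] M') (s : M' →ₗ[L] M) : Prop where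
  act_mul : IsRightAction act
  norm_act_le : ∀ γ₁ γ₂ m, ‖act γ₁ γ₂ m‖ ≤ ‖m‖
  map_act : ∀ γ₁ γ₂ m, f (act γ₁ γ₂ m) = act' γ₁ γ₂ (f m)
  map_section : ∀ m, f (s m) = m
  norm_section_le : ∀ m, ‖s (f m)‖ ≤ ‖m‖

variable {act : Sigma0 p L → Sigma0 p L → M →ₗ[L] M}
    {act' : Sigma0 p L → Sigma0 p L → M' →ₗ[L] M'} {f : M →ₗ[L] M'} {s : M' →ₗ[L] M}
    {σ : Fin 2 → K →+* L}

namespace IsSpecialisation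

theorem norm_actGL_le (hf : IsSpecialisation act act' f s) (g : GL (Fin 2) K) (m : M) :
    ‖actGL act σ g m‖ ≤ ‖m‖ := by
  rw [actGL]
  split_ifs
  · exact hf.norm_act_le _ _ _
  · simp

theorem map_actGL (hf : IsSpecialisation act act' f s) (g : GL (Fin 2) K) (m : M) :
    f (actGL act σ g m) = actGL act' σ g (f m) := by
  rw [actGL, actGL]
  split_ifs
  · exact hf.map_act _ _ _
  · simp

theorem slash_comp (hf : IsSpecialisation act act' f s) (g : GL (Fin 2) K) (φ : Div0 K →+ M) :
    slash act' σ g (f.toAddMonoidHom.comp φ) = f.toAddMonoidHom.comp (slash act σ g φ) := by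
  ext E
  exact (hf.map_actGL g _).symm

/-- `M'` carries no norm; this makes `‖s m‖` a substitute not increased by the action, so that
symbols with values in `M'` are bounded for it and have bounded lifts. -/
theorem norm_section_act_le (hf : IsSpecialisation act act' f s) (γ₁ γ₂ : Sigma0 p L) (m : M') :
    ‖s (act' γ₁ γ₂ m)‖ ≤ ‖s m‖ := by
  conv_lhs => rw [← hf.map_section m, ← hf.map_act]
  exact (hf.norm_section_le _).trans (hf.norm_act_le _ _ _)

/-- A self-improving bound: iteration replaces `B` by `r ^ t * B`, which tends to zero. -/
theorem eq_zero_of_forall_bound {r B : ℝ} (hr0 : 0 ≤ r) (hr : r < 1) {P : ℝ → Prop} (hB : P B)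
    (h : ∀ b, P b → P (r * b)) {x : M} (hx : ∀ b, P b → ‖x‖ ≤ b) : x = 0 := by
  have h1 : ∀ t : ℕ, P (r ^ t * B) := fun t => by
    induction t with
    | zero => simpa using hB
    | succ t ih =>
      rw [pow_succ', mul_assoc]
      exact h _ ih
  have h2 : Filter.Tendsto (fun t : ℕ => r ^ t * B) Filter.atTop (nhds (0 * B)) :=
    (tendsto_pow_atTop_nhds_zero_of_lt_one hr0 hr).mul_const B
  rw [zero_mul] at h2
  exact norm_le_zero_iff.1 (ge_of_tendsto' h2 fun t => hx _ (h1 t))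

end IsSpecialisation

variable [NumberField K]

variable (K) in
/-- Tuples, indexed by the class group, of homomorphisms on divisors of degree zero. -/
abbrev Tuple (M : Type*) [AddCommGroup M] : Type _ :=
  Fin (NumberField.classNumber K) → Div0 K →+ M

variable (K) in
/-- The map on tuples induced by a linear map on coefficients. -/
noncomputable def postcomp {N N' : Type*} [AddCommGroup N] [Module L N] [AddCommGroup N']
    [Module L N'] (f : N →ₗ[L] N') : Tuple K N →ₗ[L] Tuple K N' where
  toFun Φ i := f.toAddMonoidHom.comp (Φ i)
  map_add' _ _ := by ext; simp
  map_smul' _ _ := by ext; simp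

theorem postcomp_apply (f : M →ₗ[L] M') (Φ : Tuple K M) (i) (E : Div0 K) :
    postcomp K f Φ i E = f (Φ i E) := rfl

variable {I : Fin (NumberField.classNumber K) → (Ideal (𝓞 K))⁰}

namespace IsSpecialisation

theorem heckeU_postcomp (hf : IsSpecialisation act act' f s) {𝔭 : Ideal (𝓞 K)} (h𝔭 : 𝔭 ≠ ⊥)
    (c : HeckeChoice I 𝔭) (Φ : Tuple K M) :
    heckeU act' σ c (postcomp K f Φ) = postcomp K f (heckeU act σ c Φ) := by
  have : Finite (𝓞 K ⧸ 𝔭) := Ideal.finiteQuotientOfFreeOfNeBot 𝔭 h𝔭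
  cases nonempty_fintype (𝓞 K ⧸ 𝔭)
  ext i E
  simp only [heckeU, LinearMap.pi_apply, LinearMap.comp_apply, LinearMap.proj_apply,
    finsum_eq_sum_of_fintype, LinearMap.sum_apply, AddMonoidHom.finsetSum_apply, postcomp_apply,
    map_sum]
  exact Finset.sum_congr rfl fun a _ => (hf.map_actGL _ _).symm

theorem postcomp_mem_bianchiSymbols (hf : IsSpecialisation act act' f s) {𝔫 : Ideal (𝓞 K)}
    {Φ : Tuple K M} (hΦ : Φ ∈ bianchiSymbols act σ 𝔫 I) :
    postcomp K f Φ ∈ bianchiSymbols act' σ 𝔫 I := fun i hi γ hγ =>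
  (hf.slash_comp _ _).trans (congrArg _ (hΦ i hi γ hγ))

/-- Tuples with values in the kernel of `f` that are bounded by `B`. -/
def KernelBounded (f : M →ₗ[L] M') (n : Tuple K M) (B : ℝ) : Prop :=
  ∀ i E, f (n i E) = 0 ∧ ‖n i E‖ ≤ B

theorem KernelBounded.nonneg {n : Tuple K M} {B : ℝ} (h : KernelBounded f n B) : 0 ≤ B :=
  (norm_nonneg _).trans (h ⟨0, Nat.pos_of_ne_zero (NumberField.classNumber_ne_zero K)⟩ 0).2

theorem KernelBounded.smul {n : Tuple K M} {B : ℝ} (h : KernelBounded f n B) (a : L) :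
    KernelBounded f (a • n) (‖a‖ * B) := fun i E => by
  have e : (a • n) i E = a • n i E := rfl
  rw [e, map_smul, (h i E).1, smul_zero, norm_smul]
  exact ⟨rfl, mul_le_mul_of_nonneg_left (h i E).2 (norm_nonneg _)⟩

/-- A Hecke operator `T` that contracts the kernel of `f` by the factor `ρ`. -/
structure Contracts (act : Sigma0 p L → Sigma0 p L → M →ₗ[L] M) (f : M →ₗ[L] M')
    (σ : Fin 2 → K →+* L) (I : Fin (NumberField.classNumber K) → (Ideal (𝓞 K))⁰)
    (T : Module.End L (Tuple K M)) (𝔮 : Ideal (𝓞 K))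
    (j : Fin (NumberField.classNumber K) → Fin (NumberField.classNumber K))
    (β : Fin (NumberField.classNumber K) → Kˣ) (ρ : ℝ) : Prop where
  isHecke : IsHecke act σ I T 𝔮 j β
  nonneg : 0 ≤ ρ
  norm_le : ∀ i, ∀ x ∈ ((I i : Ideal (𝓞 K)) : FractionalIdeal (𝓞 K)⁰ K), ∀ m, f m = 0 →
    ‖actGL act σ (heckeMatrix x (β i)) m‖ ≤ ρ * ‖m‖

variable {T : Module.End L (Tuple K M)} {𝔮 : Ideal (𝓞 K)}
    {j : Fin (NumberField.classNumber K) → Fin (NumberField.classNumber K)}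
    {β : Fin (NumberField.classNumber K) → Kˣ} {ρ : ℝ} [IsUltrametricDist M]

theorem _root_.Bianchi.IsHecke.norm_apply_le {f : M →ₗ[L] M'} (hf : IsSpecialisation act act' f s)
    (hT : IsHecke act σ I T 𝔮 j β) {Φ : Tuple K M} {B : ℝ} (hB : 0 ≤ B)
    (hΦ : ∀ i E, ‖Φ i E‖ ≤ B) (i) (E : Div0 K) : ‖T Φ i E‖ ≤ B := by
  obtain ⟨ι, _, x, hx, h⟩ := hT.exists_sum i
  rw [h, AddMonoidHom.finsetSum_apply]
  exact IsUltrametricDist.norm_sum_le_of_forall_le_of_nonneg hB fun t _ =>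
    (hf.norm_actGL_le _ _).trans (hΦ _ _)

theorem KernelBounded.apply (hf : IsSpecialisation act act' f s)
    (hT : Contracts act f σ I T 𝔮 j β ρ) {n : Tuple K M} {B : ℝ} (h : KernelBounded f n B) :
    KernelBounded f (T n) (ρ * B) := fun i E => by
  obtain ⟨ι, _, x, hx, hxT⟩ := hT.isHecke.exists_sum i
  rw [hxT, AddMonoidHom.finsetSum_apply]
  refine ⟨?_, IsUltrametricDist.norm_sum_le_of_forall_le_of_nonneg (mul_nonneg hT.nonneg h.nonneg)
    fun t _ => (hT.norm_le i _ (hx.mem t) _ (h _ _).1).trans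
      (mul_le_mul_of_nonneg_left (h _ _).2 hT.nonneg)⟩
  rw [map_sum]
  refine Finset.sum_eq_zero fun t _ => ?_
  rw [slash_apply, hf.map_actGL, (h _ _).1, map_zero]

theorem KernelBounded.pow_apply (hf : IsSpecialisation act act' f s)
    (hT : Contracts act f σ I T 𝔮 j β ρ) {n : Tuple K M} {B : ℝ} (h : KernelBounded f n B) (t : ℕ) :
    KernelBounded f ((T ^ t) n) (ρ ^ t * B) := by
  induction t with
  | zero => simpa using h
  | succ t ih =>
    rw [pow_succ', pow_succ', mul_assoc]
    exact ih.apply hf hT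

/-- From `n = μ⁻ᵐ Tᵐ n`, every bound for `n` improves by the factor `(ρ / ‖μ‖) ^ m`. A power of `T`
is allowed because only a power is shown to commute with the other Hecke operators. -/
theorem KernelBounded.eq_zero (hf : IsSpecialisation act act' f s)
    (hT : Contracts act f σ I T 𝔮 j β ρ) {μ : L} (hμ : ρ < ‖μ‖) {n : Tuple K M} {B : ℝ}
    (h : KernelBounded f n B) {m : ℕ} (hm : m ≠ 0) (hn : (T ^ m) n = μ ^ m • n) : n = 0 := by
  have hμ0 : 0 < ‖μ‖ := hT.nonneg.trans_lt hμ
  have hμ0' : μ ≠ 0 := norm_pos_iff.1 hμ0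
  have hn' : n = (μ ^ m)⁻¹ • (T ^ m) n := by rw [hn, inv_smul_smul₀ (pow_ne_zero _ hμ0')]
  ext i E
  refine eq_zero_of_forall_bound (r := (ρ / ‖μ‖) ^ m) (P := KernelBounded f n)
    (pow_nonneg (div_nonneg hT.nonneg hμ0.le) _)
    (pow_lt_one₀ (div_nonneg hT.nonneg hμ0.le) ((div_lt_one hμ0).2 hμ) hm) h (fun b hb => ?_)
    fun b hb => (hb i E).2
  have := (hb.pow_apply hf hT m).smul (μ ^ m)⁻¹
  rw [← hn'] at this
  convert this using 1
  rw [norm_inv, norm_pow, div_pow]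
  ring

variable [CompleteSpace M]

/-- On bounded tuples with values in the kernel, `T - μ` is surjective. -/
theorem KernelBounded.exists_apply_sub_smul (hf : IsSpecialisation act act' f s)
    (hT : Contracts act f σ I T 𝔮 j β ρ) {μ : L} (hμ : ρ < ‖μ‖) {n : Tuple K M} {B : ℝ}
    (h : KernelBounded f n B) :
    ∃ Ψ : Tuple K M, ∃ B', KernelBounded f Ψ B' ∧ T Ψ - μ • Ψ = -n := by
  have hμ0 : 0 < ‖μ‖ := hT.nonneg.trans_lt hμ
  have hμ0' : μ ≠ 0 := norm_pos_iff.1 hμ0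
  let r := ρ / ‖μ‖
  have hr0 : 0 ≤ r := div_nonneg hT.nonneg hμ0.le
  have hr1 : r < 1 := (div_lt_one hμ0).2 hμ
  -- Terms of the Neumann series for `-(T - μ)⁻¹ n`; the sum telescopes because `T (a t) = μ a (t +
  -- 1)`.
  let a : ℕ → Tuple K M := fun t => (μ ^ (t + 1))⁻¹ • (T ^ t) n
  have ha : ∀ t, KernelBounded f (a t) (r ^ t * (‖μ‖⁻¹ * B)) := fun t => by
    convert (h.pow_apply hf hT t).smul (μ ^ (t + 1))⁻¹ using 1
    rw [norm_inv, norm_pow, div_pow, pow_succ, mul_inv]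
    ring
  have hTa : ∀ t, T (a t) = μ • a (t + 1) := fun t => by
    simp only [a]
    rw [map_smul, smul_smul, ← Module.End.mul_apply, ← pow_succ', pow_succ μ (t + 1), mul_inv_rev,
      mul_inv_cancel_left₀ hμ0']
  have ha0 : μ • a 0 = n := by simp [a, smul_smul, hμ0']
  have hsum : ∀ i E, Summable fun t => a t i E := fun i E =>
    Summable.of_norm_bounded ((summable_geometric_of_lt_one hr0 hr1).mul_right _)
      fun t => (ha t i E).2
  let Ψ : Tuple K M := fun i =>
    { toFun := fun E => ∑' t, a t i E
      map_zero' := by simp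
      map_add' := fun E F => by
        rw [← (hsum i E).tsum_add (hsum i F)]
        exact tsum_congr fun t => map_add _ _ _ }
  have hΨ : ∀ i E, Ψ i E = ∑' t, a t i E := fun _ _ => rfl
  have hb : ∀ t i E, ‖a t i E‖ ≤ ‖μ‖⁻¹ * B := fun t i E => (ha t i E).2.trans
    (mul_le_of_le_one_left (mul_nonneg (inv_nonneg.2 hμ0.le) h.nonneg) (pow_le_one₀ hr0 hr1.le))
  refine ⟨Ψ, ‖μ‖⁻¹ * B, fun i E => ⟨?_, IsUltrametricDist.norm_tsum_le_of_forall_le_of_nonneg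
    (mul_nonneg (inv_nonneg.2 hμ0.le) h.nonneg) fun t => hb t i E⟩, ?_⟩
  -- The kernel of `f` equals that of `s ∘ f`, which is continuous, so sums of the series stay in it
  -- although `M'` has no topology.
  · let sf : M →L[L] M := (s ∘ₗ f).mkContinuous 1 fun m => by
      rw [one_mul]; exact hf.norm_section_le m
    have h1 : sf (Ψ i E) = 0 := by
      rw [hΨ, sf.map_tsum (hsum i E)]
      refine (tsum_congr fun t => ?_).trans tsum_zero
      change s (f _) = 0
      rw [(ha t i E).1, map_zero]
    rw [← hf.map_section (f (Ψ i E))]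
    change f (sf (Ψ i E)) = 0
    rw [h1, map_zero]
  · ext i E
    obtain ⟨ι, _, x, hx, hxT⟩ := hT.isHecke.exists_sum i
    let A : ι → M →L[L] M := fun t => (actGL act σ (heckeMatrix (x t) (β i))).mkContinuous 1
      fun m => by rw [one_mul]; exact hf.norm_actGL_le _ m
    -- Each component of `T` is a finite sum of continuous maps of values, hence passes through the
    -- series.
    have h1 : T Ψ i E = ∑' t, (T (a t)) i E := by
      have h2 : ∀ Φ : Tuple K M, T Φ i E =
          ∑ u, A u (Φ (j i) (moveDiv (heckeMatrix (x u) (β i)) E)) := fun Φ => by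
        rw [hxT, AddMonoidHom.finsetSum_apply]
        rfl
      simp only [h2, hΨ]
      rw [Summable.tsum_finsetSum fun u _ => (A u).summable (hsum _ _)]
      exact Finset.sum_congr rfl fun u _ => (A u).map_tsum (hsum _ _)
    have h3 : ∑' t, (T (a t)) i E = μ • ∑' t, a (t + 1) i E := by
      have h5 : Summable fun t => a (t + 1) i E :=
        (hsum i E).comp_injective (add_left_injective 1)
      rw [← h5.tsum_const_smul μ]
      exact tsum_congr fun t => by rw [hTa]; rfl
    have h4 : Ψ i E = a 0 i E + ∑' t, a (t + 1) i E := (hsum i E).tsum_eq_zero_add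
    change T Ψ i E - μ • Ψ i E = -n i E
    rw [h1, h3, h4, smul_add, ← ha0]
    change _ = -(μ • a 0 i E)
    abel

end IsSpecialisation
end Specialisation

/-! ### Lifting eigensymbols -/

section Lifting

variable {K : Type*} [Field K] [NumberField K] {p : ℕ} [Fact p.Prime] {L : Type*} [NormedField L]
  [NormedAlgebra ℚ_[p] L]

theorem mem_eigenSymbols {M : Type*} [AddCommGroup M] [Module L M]
    {act : Sigma0 p L → Sigma0 p L → M →ₗ[L] M} {σ : Fin 2 → K →+* L} {𝔫 : Ideal (𝓞 K)}
    {I : Fin (NumberField.classNumber K) → (Ideal (𝓞 K))⁰} {ι : Type*} {𝔭 : ι → Ideal (𝓞 K)}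
    {c : ∀ q, HeckeChoice I (𝔭 q)} {lam : ι → L} {Φ : Tuple K M} :
    Φ ∈ eigenSymbols act σ 𝔫 c lam ↔
      Φ ∈ bianchiSymbols act σ 𝔫 I ∧ ∀ q, heckeU act σ (c q) Φ = lam q • Φ := by
  simp only [eigenSymbols, Submodule.mem_inf, Submodule.mem_iInf, Module.End.mem_eigenspace_iff]

theorem exists_bound_of_mem_bianchiSymbols [Algebra.IsQuadraticExtension ℚ K]
    {M : Type*} [AddCommGroup M] [Module L M] {act : Sigma0 p L → Sigma0 p L → M →ₗ[L] M}
    {σ : Fin 2 → K →+* L} {𝔫 : Ideal (𝓞 K)} (h𝔫 : 𝔫 ≠ ⊥)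
    {I : Fin (NumberField.classNumber K) → (Ideal (𝓞 K))⁰} {ν : M → ℝ}
    (hsub : ∀ m m', ν (m - m') ≤ max (ν m) (ν m')) (hν : ∀ γ₁ γ₂ m, ν (act γ₁ γ₂ m) ≤ ν m)
    {Φ : Tuple K M} (hΦ : Φ ∈ bianchiSymbols act σ 𝔫 I) : ∃ B, ∀ i E, ν (Φ i E) ≤ B := by
  choose B hB using fun i => exists_bound_of_mem_Symb h𝔫 (I i) hsub hν (hΦ i (Set.mem_univ i))
  obtain ⟨B', hB'⟩ := (Set.finite_range B).bddAbove
  exact ⟨B', fun i E => (hB i E).trans (hB' (Set.mem_range_self i))⟩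

theorem norm_sub_le_max' {M : Type*} [NormedAddCommGroup M] [IsUltrametricDist M] (m m' : M) :
    ‖m - m'‖ ≤ max ‖m‖ ‖m'‖ := by
  rw [sub_eq_add_neg, ← norm_neg m']
  exact IsUltrametricDist.norm_add_le_max _ _

namespace IsSpecialisation

variable {M : Type*} [NormedAddCommGroup M] [NormedSpace L M]
  {M' : Type*} [AddCommGroup M'] [Module L M'] {act : Sigma0 p L → Sigma0 p L → M →ₗ[L] M}
  {act' : Sigma0 p L → Sigma0 p L → M' →ₗ[L] M'} {f : M →ₗ[L] M'} {s : M' →ₗ[L] M}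
  {σ : Fin 2 → K →+* L} {I : Fin (NumberField.classNumber K) → (Ideal (𝓞 K))⁰}
  {T : Module.End L (Tuple K M)} {𝔮 𝔫 : Ideal (𝓞 K)}
  {j : Fin (NumberField.classNumber K) → Fin (NumberField.classNumber K)}
  {β : Fin (NumberField.classNumber K) → Kˣ} {ρ : ℝ}

variable {ι : Type*} {𝔭 : ι → Ideal (𝓞 K)} {c : ∀ q, HeckeChoice I (𝔭 q)} {lam : ι → L}

theorem postcomp_mem_eigenSymbols (hf : IsSpecialisation act act' f s) (h𝔭 : ∀ q, 𝔭 q ≠ ⊥)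
    {Φ : Tuple K M} (hΦ : Φ ∈ eigenSymbols act σ 𝔫 c lam) :
    postcomp K f Φ ∈ eigenSymbols act' σ 𝔫 c lam := by
  rw [mem_eigenSymbols] at hΦ ⊢
  refine ⟨hf.postcomp_mem_bianchiSymbols hΦ.1, fun q => ?_⟩
  rw [hf.heckeU_postcomp (h𝔭 q), hΦ.2, map_smul]

variable [IsUltrametricDist M]

/-- A bounded eigenvector of `T` is invariant if its image under `f` is. -/
theorem mem_bianchiSymbols (hf : IsSpecialisation act act' f s)
    (hT : Contracts act f σ I T 𝔮 j β ρ) (hp𝔫 : Ideal.span {(p : 𝓞 K)} ∣ 𝔫) (h𝔮 : 𝔫 ≤ 𝔮)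
    (hI : ∀ i, IsCoprime (I i : Ideal (𝓞 K)) 𝔫) {μ : L} (hμ : ρ < ‖μ‖) {Φ : Tuple K M} {B : ℝ}
    (hB : ∀ i E, ‖Φ i E‖ ≤ B) (hΦ : T Φ = μ • Φ)
    (hfΦ : postcomp K f Φ ∈ bianchiSymbols act' σ 𝔫 I) : Φ ∈ bianchiSymbols act σ 𝔫 I := by
  have hIp : ∀ i, IsCoprime (I i : Ideal (𝓞 K)) (Ideal.span {(p : 𝓞 K)}) := fun i => by
    obtain ⟨r, hr⟩ := hp𝔫
    exact (hr ▸ hI i).of_mul_right_left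
  have hB0 : 0 ≤ B :=
    (norm_nonneg _).trans (hB ⟨0, Nat.pos_of_ne_zero (NumberField.classNumber_ne_zero K)⟩ 0)
  have hμ0 : 0 < ‖μ‖ := hT.nonneg.trans_lt hμ
  intro i _ γ hγ
  rw [← sub_eq_zero]
  ext E
  -- The bound must be uniform in the component, the group element and the divisor, since the
  -- recursion changes all three.
  refine eq_zero_of_forall_bound (r := ρ / ‖μ‖) (B := B)
    (P := fun b => ∀ i, ∀ γ ∈ levelGroup 𝔫 (I i), ∀ E,
      ‖(slash act σ (γ : GL (Fin 2) K) (Φ i) - Φ i) E‖ ≤ b)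
    (div_nonneg hT.nonneg hμ0.le) ((div_lt_one hμ0).2 hμ) ?_ ?_ fun b hb => hb i γ hγ E
  · intro i γ _ E
    rw [AddMonoidHom.sub_apply, sub_eq_add_neg]
    refine (IsUltrametricDist.norm_add_le_max _ _).trans (max_le ?_ ?_)
    · exact (hf.norm_actGL_le _ _).trans (hB _ _)
    · rw [norm_neg]
      exact hB _ _
  · intro b hb i γ hγ E
    have hb0 : 0 ≤ b := (norm_nonneg _).trans (hb i γ hγ E)
    obtain ⟨ι, _, x, hx, hxT⟩ := hT.isHecke.exists_sum i
    obtain ⟨e, he⟩ := (hx.add_right hγ.2.2.1).exists_equiv hx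
    choose γ' hγ' hγe using fun t => exists_heckeMatrix_mul_eq h𝔮 (hT.isHecke.mul_eq i) hγ
      (hx.mem t) (hx.mem (e t)) (he t)
    have hlev : ∀ {i} {γ : SL(2, K)}, γ ∈ levelGroup 𝔫 (I i) →
        ActsThrough p σ (γ : GL (Fin 2) K) := fun {i} {γ} h s =>
      levelGroup_mem_Sigma0 (σ s) hp𝔫 (hI i) h
    have hhecke : ∀ t, ActsThrough p σ (heckeMatrix (x t) (β i)) := fun t =>
      actsThrough_heckeMatrix (hIp _) (hT.isHecke.mul_eq i) (hx.mem t)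
    -- Expand both occurrences of `Φ i` by the eigenvalue equation; reindexing by the coset
    -- permutation `e` pairs the terms.
    have key : μ • (slash act σ (γ : GL (Fin 2) K) (Φ i) - Φ i) =
        ∑ t, slash act σ (heckeMatrix (x (e t)) (β i))
          (slash act σ (γ' t : GL (Fin 2) K) (Φ (j i)) - Φ (j i)) := by
      have h1 : μ • Φ i = T Φ i := by rw [hΦ]; rfl
      rw [smul_sub, ← map_smul, h1, hxT, map_sum]
      nth_rewrite 2 [← e.sum_comp]
      rw [← Finset.sum_sub_distrib]
      refine Finset.sum_congr rfl fun t _ => ?_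
      rw [map_sub, slash_slash hf.act_mul (hhecke t) (hlev hγ), hγe,
        slash_slash hf.act_mul (hlev (hγ' t)) (hhecke (e t))]
    have h2 : ‖μ‖ * ‖(slash act σ (γ : GL (Fin 2) K) (Φ i) - Φ i) E‖ ≤ ρ * b := by
      rw [← norm_smul]
      change ‖(μ • (slash act σ (γ : GL (Fin 2) K) (Φ i) - Φ i)) E‖ ≤ ρ * b
      rw [key, AddMonoidHom.finsetSum_apply]
      refine IsUltrametricDist.norm_sum_le_of_forall_le_of_nonneg (mul_nonneg hT.nonneg hb0)
        fun t _ => (hT.norm_le i _ (hx.mem _) _ ?_).trans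
          (mul_le_mul_of_nonneg_left (hb _ _ (hγ' t) _) hT.nonneg)
      -- The inner defect is killed by `f`, because the image of `Φ` is invariant; this is what
      -- permits the contraction estimate.
      have h3 := DFunLike.congr_fun ((hf.slash_comp (γ' t : GL (Fin 2) K) (Φ (j i))).symm.trans
        (hfΦ (j i) (Set.mem_univ _) _ (hγ' t))) (moveDiv (heckeMatrix (x (e t)) (β i)) E)
      rw [AddMonoidHom.comp_apply, AddMonoidHom.sub_apply, map_sub, sub_eq_zero]
      exact h3
    rw [div_mul_eq_mul_div, le_div_iff₀ hμ0, mul_comm]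
    exact h2

variable [Algebra.IsQuadraticExtension ℚ K]

/-- Invariance makes `Φ` bounded, so it is a bounded kernel-valued eigenvector of the contracting
operator. -/
theorem postcomp_injective (hf : IsSpecialisation act act' f s) (h𝔫 : 𝔫 ≠ ⊥) {q : ι}
    (hT : Contracts act f σ I (heckeU act σ (c q)) (𝔭 q) j β ρ) (hμ : ρ < ‖lam q‖)
    {Φ : Tuple K M} (hΦ : Φ ∈ eigenSymbols act σ 𝔫 c lam) (h0 : postcomp K f Φ = 0) : Φ = 0 := by
  rw [mem_eigenSymbols] at hΦ
  obtain ⟨B, hB⟩ := exists_bound_of_mem_bianchiSymbols h𝔫 norm_sub_le_max' hf.norm_act_le hΦ.1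
  have hK : KernelBounded f Φ B := fun i E =>
    ⟨DFunLike.congr_fun (congrFun h0 i) E, hB i E⟩
  exact hK.eq_zero hf hT hμ one_ne_zero (by simpa using hΦ.2 q)

theorem postcomp_injOn (hf : IsSpecialisation act act' f s) (h𝔫 : 𝔫 ≠ ⊥) {q : ι}
    (hT : Contracts act f σ I (heckeU act σ (c q)) (𝔭 q) j β ρ) (hμ : ρ < ‖lam q‖)
    {Φ Φ' : Tuple K M} (hΦ : Φ ∈ eigenSymbols act σ 𝔫 c lam)
    (hΦ' : Φ' ∈ eigenSymbols act σ 𝔫 c lam) (h : postcomp K f Φ = postcomp K f Φ') : Φ = Φ' := by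
  refine sub_eq_zero.1 (hf.postcomp_injective h𝔫 hT hμ (Submodule.sub_mem _ hΦ hΦ') ?_)
  rw [map_sub, h, sub_self]

/-- Only the eigenvalue at `q` is required to have small slope; the equations at the other primes
are inherited from `φ`. -/
theorem postcomp_surjective [CompleteSpace M] [NumberField.IsTotallyComplex K]
    (hf : IsSpecialisation act act' f s) (h𝔫 : 𝔫 ≠ ⊥)
    (hp𝔫 : Ideal.span {(p : 𝓞 K)} ∣ 𝔫) (hIbij : Function.Bijective fun i => ClassGroup.mk0 (I i))
    (hI : ∀ i, IsCoprime (I i : Ideal (𝓞 K)) 𝔫) (h𝔭 : ∀ q, 𝔫 ≤ 𝔭 q) {q : ι}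
    (hT : Contracts act f σ I (heckeU act σ (c q)) (𝔭 q) j β ρ) (hμ : ρ < ‖lam q‖)
    {φ : Tuple K M'} (hφ : φ ∈ eigenSymbols act' σ 𝔫 c lam) :
    ∃ Φ ∈ eigenSymbols act σ 𝔫 c lam, postcomp K f Φ = φ := by
  have h𝔭0 : ∀ q, 𝔭 q ≠ ⊥ := fun q h => h𝔫 (le_bot_iff.1 (h ▸ h𝔭 q))
  have hIp : ∀ i, IsCoprime (I i : Ideal (𝓞 K)) (Ideal.span {(p : 𝓞 K)}) := fun i => by
    obtain ⟨r, hr⟩ := hp𝔫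
    exact (hr ▸ hI i).of_mul_right_left
  have hI𝔭 : ∀ q i, IsCoprime (I i : Ideal (𝓞 K)) (𝔭 q) := fun q i => by
    obtain ⟨r, hr⟩ := Ideal.dvd_iff_le.2 (h𝔭 q)
    exact (hr ▸ hI i).of_mul_right_left
  rw [mem_eigenSymbols] at hφ
  obtain ⟨B, hB⟩ := exists_bound_of_mem_bianchiSymbols (ν := fun m => ‖s m‖) h𝔫
    (fun m m' => by rw [map_sub]; exact norm_sub_le_max' _ _) hf.norm_section_act_le hφ.1
  -- The section is not assumed equivariant, so this lift is only a bounded homomorphism, neither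
  -- invariant nor an eigenvector.
  let Φ₀ : Tuple K M := postcomp K s φ
  have hΦ₀ : ∀ i E, ‖Φ₀ i E‖ ≤ B := hB
  have hB0 : 0 ≤ B :=
    (norm_nonneg _).trans (hB ⟨0, Nat.pos_of_ne_zero (NumberField.classNumber_ne_zero K)⟩ 0)
  have hfΦ₀ : postcomp K f Φ₀ = φ := by
    ext i E
    exact hf.map_section _
  have hdiff : ∀ (R : Module.End L (Tuple K M)) {𝔯 l α} (_ : IsHecke act σ I R 𝔯 l α) (a : L)
      {Φ : Tuple K M} {B : ℝ} (_ : ∀ i E, ‖Φ i E‖ ≤ B) (_ : postcomp K f (R Φ - a • Φ) = 0),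
      KernelBounded f (R Φ - a • Φ) (max B (‖a‖ * B)) := by
    intro R 𝔯 l α hR a Φ B hΦ h0 i E
    have hB0 : 0 ≤ B := (norm_nonneg _).trans (hΦ i E)
    refine ⟨DFunLike.congr_fun (congrFun h0 i) E, (norm_sub_le_max' _ _).trans (max_le_max
      (hR.norm_apply_le hf hB0 hΦ i E) ?_)⟩
    change ‖a • Φ i E‖ ≤ _
    rw [norm_smul]
    exact mul_le_mul_of_nonneg_left (hΦ i E) (norm_nonneg _)
  have hcomp : ∀ q {Φ : Tuple K M}, postcomp K f Φ = φ →
      postcomp K f (heckeU act σ (c q) Φ - lam q • Φ) = 0 := fun q Φ h => by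
    rw [map_sub, map_smul, ← hf.heckeU_postcomp (h𝔭0 q), h, hφ.2, sub_self]
  obtain ⟨Ψ, B', hΨ, hTΨ⟩ := (hdiff _ hT.isHecke (lam q) hΦ₀
    (hcomp q hfΦ₀)).exists_apply_sub_smul hf hT hμ
  have hfΨ : postcomp K f Ψ = 0 := by
    ext i E
    exact (hΨ i E).1
  let Φ := Φ₀ + Ψ
  have hfΦ : postcomp K f Φ = φ := by rw [map_add, hfΦ₀, hfΨ, add_zero]
  have hΦB : ∀ i E, ‖Φ i E‖ ≤ max B B' := fun i E =>
    (IsUltrametricDist.norm_add_le_max _ _).trans (max_le_max (hΦ₀ i E) (hΨ i E).2)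
  have hTΦ : heckeU act σ (c q) Φ = lam q • Φ := by
    rw [← sub_eq_zero, map_add, smul_add, add_sub_add_comm, hTΨ, add_neg_cancel]
  have hmem : Φ ∈ bianchiSymbols act σ 𝔫 I :=
    hf.mem_bianchiSymbols hT hp𝔫 (h𝔭 q) hI hμ hΦB hTΦ (hfΦ ▸ hφ.1)
  refine ⟨Φ, mem_eigenSymbols.2 ⟨hmem, fun r => ?_⟩, hfΦ⟩
  have hR : IsHecke act σ I (heckeU act σ (c r)) (𝔭 r) (c r).j (c r).α :=
    isHecke_heckeU (h𝔭0 r) (hI𝔭 r) (c r)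
  obtain ⟨m, hm, hcomm⟩ := hT.isHecke.exists_pow_comm (𝔫 := 𝔫) hf.act_mul hIbij hIp (h𝔭0 q) hR
  have hpow : ∀ m, (heckeU act σ (c q) ^ m) Φ = lam q ^ m • Φ := fun m => by
    induction m with
    | zero => simp
    | succ m ih => rw [pow_succ', Module.End.mul_apply, ih, map_smul, hTΦ, smul_smul, pow_succ]
  rw [← sub_eq_zero]
  -- The defect of the equation at `r` is bounded and kernel-valued, and an eigenvector of a power
  -- of the operator at `q`.
  refine (hdiff _ hR (lam r) hΦB (hcomp r hfΦ)).eq_zero hf hT hμ hm ?_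
  rw [map_sub, map_smul, hcomm Φ hmem, hpow, map_smul, smul_sub, smul_comm (lam r)]

end IsSpecialisation
end Lifting

/-- The slope condition in multiplicative form. The value `vp p 0 = ⊤` excludes a zero eigenvalue.
-/
theorem rpow_lt_norm_of_vp_lt {p : ℕ} [Fact p.Prime] {L : Type*} [NormedField L] {x : L}
    {k e : ℕ}
    (h : vp p x < (((k + 1 : ℝ) / e : ℝ) : EReal)) :
    ((p : ℝ)⁻¹ ^ ((e : ℝ)⁻¹)) ^ (k + 1) < ‖x‖ := by
  have hp : (1 : ℝ) < p := by exact_mod_cast (Fact.out : p.Prime).one_lt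
  by_cases hx : x = 0
  · simp [vp, hx] at h
  · rw [vp, if_neg hx, EReal.coe_lt_coe_iff, neg_lt,
      Real.lt_logb_iff_rpow_lt hp (norm_pos_iff.2 hx)] at h
    convert h using 1
    rw [Real.inv_rpow (by positivity), ← Real.rpow_neg (by positivity), ← Real.rpow_natCast,
      ← Real.rpow_mul (by positivity)]
    congr 1
    push_cast
    ring

/-! ### The prime attached to an embedding -/

section PrimeOfEmbedding

variable {K : Type*} [Field K] (p : ℕ) [Fact p.Prime] {L : Type*} [NormedField L]
  [NormedAlgebra ℚ_[p] L]

/-- The prime ideal of integers of `K` of norm less than one under an embedding in `L`. -/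
def primeOfEmbedding (s : K →+* L) : Ideal (𝓞 K) where
  carrier := {x | ‖s x‖ < 1}
  zero_mem' := by simp
  add_mem' {x y} hx hy := by
    have : IsUltrametricDist L := IsUltrametricDist.of_normedAlgebra ℚ_[p]
    change ‖s ((x + y : 𝓞 K) : K)‖ < 1
    rw [show ((x + y : 𝓞 K) : K) = x + y from map_add _ _ _, map_add]
    exact (IsUltrametricDist.norm_add_le_max _ _).trans_lt (max_lt hx hy)
  smul_mem' a x hx := by
    change ‖s ((a * x : 𝓞 K) : K)‖ < 1
    rw [show ((a * x : 𝓞 K) : K) = a * x from map_mul _ _ _, map_mul, norm_mul]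
    exact (mul_le_of_le_one_left (norm_nonneg _) (norm_embedding_le_one p s a)).trans_lt hx

theorem mem_primeOfEmbedding {s : K →+* L} {x : 𝓞 K} : x ∈ primeOfEmbedding p s ↔ ‖s x‖ < 1 :=
  Iff.rfl

theorem norm_natCast_prime : ‖(p : L)‖ = (p : ℝ)⁻¹ := by
  have h : ‖algebraMap ℚ_[p] L (p : ℚ_[p])‖ = ‖(p : ℚ_[p])‖ := norm_algebraMap' L _
  rw [map_natCast] at h
  rw [h, Padic.norm_p]

theorem primeOfEmbedding_mem_primesOver (s : K →+* L) :
    primeOfEmbedding p s ∈ (Ideal.span {(p : ℤ)}).primesOver (𝓞 K) := by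
  have hprime : (primeOfEmbedding p s).IsPrime := by
    refine ⟨fun h => ?_, fun {x y} h => ?_⟩
    · have := (Ideal.eq_top_iff_one _).1 h
      rw [mem_primeOfEmbedding] at this
      simp at this
    · rw [mem_primeOfEmbedding, show ((x * y : 𝓞 K) : K) = x * y from map_mul _ _ _, map_mul,
        norm_mul] at h
      by_contra! H
      simp only [mem_primeOfEmbedding, not_lt] at H
      nlinarith [H.1, H.2]
  refine ⟨hprime, ⟨?_⟩⟩
  have hp : Prime (p : ℤ) := Nat.prime_iff_prime_int.1 Fact.out
  have hmax : (Ideal.span {(p : ℤ)}).IsMaximal :=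
    PrincipalIdealRing.isMaximal_of_irreducible hp.irreducible
  refine hmax.eq_of_le (Ideal.comap_ne_top _ hprime.ne_top) ?_
  rw [Ideal.span_singleton_le_iff_mem, Ideal.mem_comap, mem_primeOfEmbedding]
  simpa using norm_prime_lt_one p L

variable {p}

variable [NumberField K]

/-- The norm of the multipliers in a Hecke operator at the prime attached to an embedding. -/
theorem norm_embedding_le_rpow (s : K →+* L)
    {J J' : (Ideal (𝓞 K))⁰} {δ : K}
    (hJ' : IsCoprime (J' : Ideal (𝓞 K)) (Ideal.span {(p : 𝓞 K)}))
    (h : (primeOfEmbedding p s : FractionalIdeal (𝓞 K)⁰ K) *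
      ((J : Ideal (𝓞 K)) : FractionalIdeal (𝓞 K)⁰ K) =
        FractionalIdeal.spanSingleton (𝓞 K)⁰ δ *
          ((J' : Ideal (𝓞 K)) : FractionalIdeal (𝓞 K)⁰ K)) :
    ‖s δ‖ ≤ (p : ℝ)⁻¹ ^
      (((Ideal.span {(p : ℤ)}).ramificationIdx' (primeOfEmbedding p s) : ℝ)⁻¹) := by
  obtain ⟨hprime, hover⟩ := primeOfEmbedding_mem_primesOver p s
  set P := primeOfEmbedding p s with hP
  have hp0 : (p : 𝓞 K) ≠ 0 := by exact_mod_cast (Fact.out : p.Prime).ne_zero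
  have hmap : Ideal.map (algebraMap ℤ (𝓞 K)) (Ideal.span {(p : ℤ)}) = Ideal.span {(p : 𝓞 K)} := by
    rw [Ideal.map_span, Set.image_singleton, map_natCast]
  have hmap0 : Ideal.map (algebraMap ℤ (𝓞 K)) (Ideal.span {(p : ℤ)}) ≠ ⊥ := by
    rw [hmap]
    simpa using hp0
  set e := (Ideal.span {(p : ℤ)}).ramificationIdx' P with he
  have he0 : e ≠ 0 := by
    refine Ideal.IsDedekindDomain.ramificationIdx'_ne_zero hmap0 hprime ?_
    rw [Ideal.map_le_iff_le_comap]
    exact hover.over.le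
  -- Split off the full power of `P` in `(p)`; an element of `J₀` outside `P` then has norm one
  -- under `s`.
  obtain ⟨J₀, hJ₀, hnot⟩ : ∃ J₀ : Ideal (𝓞 K), Ideal.span {(p : 𝓞 K)} = P ^ e * J₀ ∧ ¬ P ∣ J₀ := by
    have hP0 : P ≠ ⊥ := fun h0 => hmap0 (by
      rw [← le_bot_iff, ← h0, Ideal.map_le_iff_le_comap]
      exact hover.over.le)
    have hfin : FiniteMultiplicity P (Ideal.span {(p : 𝓞 K)}) :=
      FiniteMultiplicity.of_prime_left (Ideal.prime_of_isPrime hP0 hprime) (by simpa using hp0)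
    obtain ⟨J₀, h1, h2⟩ := hfin.exists_eq_pow_mul_and_not_dvd
    rw [← hmap, ← Ideal.IsDedekindDomain.ramificationIdx'_eq_multiplicity hmap0 hprime, hmap] at h1
    exact ⟨J₀, h1, h2⟩
  obtain ⟨t, ht, htP⟩ : ∃ t ∈ J₀, t ∉ P := by
    rw [Ideal.dvd_iff_le] at hnot
    exact Set.not_subset.1 hnot
  have ht1 : ‖s t‖ = 1 := le_antisymm (norm_embedding_le_one p s t) (not_lt.1 htP)
  refine norm_embedding_le_of_coprime s hJ' fun u hu => ?_
  have h1 := FractionalIdeal.mul_mem_mul (FractionalIdeal.mem_spanSingleton_self (𝓞 K)⁰ δ)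
    (FractionalIdeal.mem_coeIdeal_of_mem (𝓞 K)⁰ hu)
  rw [← h, ← FractionalIdeal.coeIdeal_mul] at h1
  obtain ⟨v, hv, hv'⟩ := (FractionalIdeal.mem_coeIdeal _).1 h1
  -- For `v` in `P` this gives `‖s v‖ ^ e ≤ p⁻¹`; it is applied to `v = δ u` with `u` in `J'`.
  have hvt : v ^ e * t ∈ Ideal.span {(p : 𝓞 K)} := by
    rw [hJ₀]
    exact Ideal.mul_mem_mul (Ideal.pow_mem_pow (Ideal.mul_le_left hv) e) ht
  obtain ⟨w, hw⟩ := Ideal.mem_span_singleton'.1 hvt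
  have h2 : ‖s v‖ ^ e ≤ (p : ℝ)⁻¹ := by
    have h3 := congrArg (fun z : 𝓞 K => ‖s z‖) hw
    simp only [map_mul, map_pow, map_natCast, norm_mul, norm_pow, ht1, mul_one] at h3
    rw [← h3, norm_natCast_prime]
    exact mul_le_of_le_one_left (by positivity) (norm_embedding_le_one p s w)
  rw [← hv']
  have h4 := Real.rpow_le_rpow (by positivity) h2 (inv_nonneg.2 (Nat.cast_nonneg (α := ℝ) e))
  rwa [Real.pow_rpow_inv_natCast (norm_nonneg _) he0] at h4

end PrimeOfEmbedding

/-! ### Truncation to bounded degree -/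

section Truncation

variable {L : Type*} [NormedField L]

/-- The continuous projection that removes the monomials with exponents outside of `S`. -/
noncomputable def truncate (S : Set (ℕ × ℕ)) : A2 L →L[L] A2 L :=
  LinearMap.mkContinuous
    { toFun := fun f => A2.mk (S.indicator f) (by
        refine squeeze_zero_norm (fun x => ?_) (tendsto_zero_iff_norm_tendsto_zero.1 f.tendsto)
        exact norm_indicator_le_norm_self f x)
      map_add' := fun f g => by
        ext x
        exact congrFun (Set.indicator_add S f g) x
      map_smul' := fun c f => by
        ext x
        exact congrFun (Set.indicator_const_smul S c f) x } 1
    (fun f => by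
      rw [one_mul]
      exact A2.norm_le (norm_nonneg f) fun x =>
        (norm_indicator_le_norm_self f x).trans (A2.norm_apply_le f x))

theorem truncate_apply (S : Set (ℕ × ℕ)) (f : A2 L) (x : ℕ × ℕ) :
    truncate S f x = S.indicator f x := rfl

theorem norm_truncate_le (S : Set (ℕ × ℕ)) (f : A2 L) : ‖truncate S f‖ ≤ ‖f‖ :=
  A2.norm_le (norm_nonneg f) fun x =>
    (norm_indicator_le_norm_self f x).trans (A2.norm_apply_le f x)

theorem norm_sub_truncate_le {S : Set (ℕ × ℕ)} {f : A2 L} {C : ℝ} (hC : 0 ≤ C)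
    (h : ∀ x ∉ S, ‖f x‖ ≤ C) : ‖f - truncate S f‖ ≤ C := by
  refine A2.norm_le hC fun x => ?_
  rw [ZeroAtInftyContinuousMap.sub_apply, truncate_apply]
  by_cases hx : x ∈ S
  · rw [Set.indicator_of_mem hx, sub_self, norm_zero]
    exact hC
  · rw [Set.indicator_of_notMem hx, sub_zero]
    exact h x hx

variable (L) in
/-- Functions that are polynomial of degree at most `k` in the first variable, as a submodule. -/
def polynomialFst (k : ℕ) : Submodule L (A2 L) where
  carrier := {f | ∀ x : ℕ × ℕ, k < x.1 → f x = 0}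
  zero_mem' := fun _ _ => rfl
  add_mem' := fun {f g} hf hg x hx => by
    rw [ZeroAtInftyContinuousMap.add_apply, hf x hx, hg x hx, add_zero]
  smul_mem' := fun c f hf x hx => by
    rw [ZeroAtInftyContinuousMap.smul_apply, hf x hx, smul_zero]

theorem V_le_polynomialFst (k : ℕ) : V L k ≤ polynomialFst L k := fun _ hf x hx => hf x (Or.inl hx)

variable (L) in
/-- Functions that are polynomial of degree at most `k` in the first variable, as a normed space. -/
def A1 (k : ℕ) : Type _ := polynomialFst L k

noncomputable instance (k : ℕ) : NormedAddCommGroup (A1 L k) :=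
  inferInstanceAs (NormedAddCommGroup (polynomialFst L k))

noncomputable instance (k : ℕ) : NormedSpace L (A1 L k) :=
  inferInstanceAs (NormedSpace L (polynomialFst L k))

/-- Over complete `L` this makes algebraic functionals on the polynomials continuous, so that they
extend to distributions by truncation. -/
instance (k : ℕ) : FiniteDimensional L (V L k) := by
  let g : V L k →ₗ[L] (Fin (k + 1) × Fin (k + 1) → L) :=
    { toFun := fun f x => (f : A2 L) (x.1, x.2), map_add' := fun _ _ => rfl
      map_smul' := fun _ _ => rfl }
  refine FiniteDimensional.of_injective g fun f f' h => ?_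
  ext ⟨i, j⟩
  by_cases hx : k < i ∨ k < j
  · rw [f.2 _ hx, f'.2 _ hx]
  · push Not at hx
    exact congrFun h (⟨i, by lia⟩, ⟨j, by lia⟩)

/-- The inclusion of `A1 L k` in `A2 L`. -/
noncomputable def A1.incl (k : ℕ) : A1 L k →L[L] A2 L := (polynomialFst L k).subtypeL

theorem A1.incl_injective (k : ℕ) : Function.Injective (A1.incl (L := L) k) :=
  Subtype.val_injective

/-- The function `f`, as an element of `A1 L k`. -/
noncomputable def A1.lift {E : Type*} [NormedAddCommGroup E] [NormedSpace L E] {k : ℕ}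
    (u : E →L[L] A2 L) (hu : ∀ e, u e ∈ polynomialFst L k) : E →L[L] A1 L k :=
  u.codRestrict (polynomialFst L k) hu

/-- The projection to functions that are polynomial of degree at most `k` in the first variable. -/
noncomputable def toA1 (k : ℕ) : A2 L →L[L] A1 L k :=
  A1.lift (truncate {x | x.1 ≤ k}) fun _ _ hx =>
    Set.indicator_of_notMem (s := {x : ℕ × ℕ | x.1 ≤ k}) (not_le.2 hx) _

/-- The projection to polynomials of degree at most `k` in each variable. -/
noncomputable def toV (k : ℕ) : A2 L →L[L] V L k :=
  (truncate {x | x.1 ≤ k ∧ x.2 ≤ k}).codRestrict (V L k) fun _ _ hx =>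
    Set.indicator_of_notMem (s := {x : ℕ × ℕ | x.1 ≤ k ∧ x.2 ≤ k})
      (fun h => hx.elim h.1.not_gt h.2.not_gt) _

theorem truncate_of_mem_polynomialFst {k : ℕ} {f : A2 L} (hf : f ∈ polynomialFst L k) :
    truncate {x | x.1 ≤ k} f = f := by
  ext x
  rw [truncate_apply, Set.indicator_apply_eq_self]
  exact fun hx => hf x (not_le.1 hx)

theorem toA1_incl {k : ℕ} (f : A1 L k) : toA1 k (A1.incl k f) = f :=
  A1.incl_injective k (truncate_of_mem_polynomialFst f.2)

/-- The projection of `A1 L k` that removes the monomials of degree more than `k` in the second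
variable. -/
noncomputable def truncateV (k : ℕ) : A1 L k →L[L] A1 L k :=
  A1.lift ((truncate {x | x.1 ≤ k ∧ x.2 ≤ k}).comp (A1.incl k)) fun f =>
    V_le_polynomialFst k (toV k (A1.incl k f)).2

theorem toV_of_mem {k : ℕ} {f : A2 L} (hf : f ∈ V L k) : toV k f = ⟨f, hf⟩ := by
  refine Subtype.ext ?_
  ext x
  change truncate {x | x.1 ≤ k ∧ x.2 ≤ k} f x = f x
  rw [truncate_apply, Set.indicator_apply_eq_self]
  exact fun hx => hf x ((not_and_or.1 hx).imp not_le.1 not_le.1)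

variable {p : ℕ} [Fact p.Prime] [NormedAlgebra ℚ_[p] L] [FiniteDimensional ℚ_[p] L]

theorem actA_mem_polynomialFst (k : ℕ) (γ₁ γ₂ : Sigma0 p L) (f : A2 L) (hf : f ∈ polynomialFst L k) :
    actA k γ₁ γ₂ f ∈ polynomialFst L k := by
  intro m hm
  rw [actA_apply]
  refine (tsum_congr fun x => ?_).trans tsum_zero
  by_cases hx : k < x.1
  · rw [hf x hx, zero_mul]
  · rw [coeff_monomialSeries k γ₁ (not_lt.1 hx) hm, zero_mul, mul_zero]

/-- The action on functions that are polynomial of degree at most `k` in the first variable. -/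
noncomputable def actA1 (k : ℕ) (γ₁ γ₂ : Sigma0 p L) : A1 L k →L[L] A1 L k :=
  A1.lift ((actA k γ₁ γ₂).comp (A1.incl k)) fun f => actA_mem_polynomialFst k γ₁ γ₂ _ f.2

/-- Coefficients of degree at least `k + 1` in `x` carry the factor `d ^ (k + 1)` of the first
matrix; integrality suffices for the second. -/
theorem norm_actA_apply_le_of_lt_fst (k : ℕ) (γ₁ γ₂ : Sigma0 p L)
    (h0 : (γ₁ : Matrix (Fin 2) (Fin 2) L) 0 0 = 1) (h1 : (γ₁ : Matrix (Fin 2) (Fin 2) L) 1 0 = 0)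
    (f : A2 L) {m : ℕ × ℕ} (hm : k < m.1) :
    ‖actA k γ₁ γ₂ f m‖ ≤ ‖(γ₁ : Matrix (Fin 2) (Fin 2) L) 1 1‖ ^ (k + 1) * ‖f‖ :=
  norm_actA_apply_le k γ₁ γ₂ f m fun i j =>
    (mul_le_of_le_one_right (norm_nonneg _) ((monomialSeries_mem k γ₂ j).1 _)).trans
      ((norm_coeff_monomialSeries_le k γ₁ h0 h1 i _).trans
        (pow_le_pow_of_le_one (norm_nonneg _) (γ₁.2.1 1 1) hm))

theorem norm_actA_apply_le_of_lt_snd (k : ℕ) (γ₁ γ₂ : Sigma0 p L)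
    (h0 : (γ₂ : Matrix (Fin 2) (Fin 2) L) 0 0 = 1) (h1 : (γ₂ : Matrix (Fin 2) (Fin 2) L) 1 0 = 0)
    (f : A2 L) {m : ℕ × ℕ} (hm : k < m.2) :
    ‖actA k γ₁ γ₂ f m‖ ≤ ‖(γ₂ : Matrix (Fin 2) (Fin 2) L) 1 1‖ ^ (k + 1) * ‖f‖ :=
  norm_actA_apply_le k γ₁ γ₂ f m fun i j =>
    (mul_le_of_le_one_left (norm_nonneg _) ((monomialSeries_mem k γ₁ i).1 _)).trans
      ((norm_coeff_monomialSeries_le k γ₂ h0 h1 j _).trans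
        (pow_le_pow_of_le_one (norm_nonneg _) (γ₂.2.1 1 1) hm))

end Truncation

/-! ### Distributions and the two partial specialisations -/

section Dual

variable {p : ℕ} [Fact p.Prime] {L : Type*} [NontriviallyNormedField L] [NormedAlgebra ℚ_[p] L]

instance {A : Type*} [NormedAddCommGroup A] [NormedSpace L A] [IsUltrametricDist L] :
    IsUltrametricDist (A →L[L] L) :=
  IsUltrametricDist.isUltrametricDist_of_forall_norm_add_le_max_norm fun μ ν =>
    ContinuousLinearMap.opNorm_le_bound _ (le_max_of_le_left (norm_nonneg μ)) fun a => by
      refine (IsUltrametricDist.norm_add_le_max (μ a) (ν a)).trans ?_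
      rw [max_mul_of_nonneg _ _ (norm_nonneg a)]
      exact max_le_max (μ.le_opNorm a) (ν.le_opNorm a)

/-- The right action on the topological dual of a space with a left action. -/
def dualAct {A : Type*} [NormedAddCommGroup A] [NormedSpace L A]
    (ρ : Sigma0 p L → Sigma0 p L → A →L[L] A) (γ₁ γ₂ : Sigma0 p L) :
    (A →L[L] L) →ₗ[L] (A →L[L] L) where
  toFun μ := μ.comp (ρ γ₁ γ₂)
  map_add' _ _ := rfl
  map_smul' _ _ := rfl

variable {A : Type*} [NormedAddCommGroup A] [NormedSpace L A]
  {ρ : Sigma0 p L → Sigma0 p L → A →L[L] A} {N : Type*} [AddCommGroup N] [Module L N]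
  {act' : Sigma0 p L → Sigma0 p L → N →ₗ[L] N} {f : (A →L[L] L) →ₗ[L] N} {s : N →ₗ[L] (A →L[L] L)}

/-- The norm bounds pass to the dual: precomposing with a map that does not increase norms does not
increase operator norms. -/
theorem isSpecialisation_dualAct
    (hmul : ∀ γ₁ γ₂ δ₁ δ₂ a, ρ (γ₁ * δ₁) (γ₂ * δ₂) a = ρ γ₁ γ₂ (ρ δ₁ δ₂ a))
    (hρ : ∀ γ₁ γ₂ a, ‖ρ γ₁ γ₂ a‖ ≤ ‖a‖)
    (hact : ∀ γ₁ γ₂ μ, f (dualAct ρ γ₁ γ₂ μ) = act' γ₁ γ₂ (f μ)) (hfs : ∀ ν, f (s ν) = ν)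
    {π : A →L[L] A} (hπ : ∀ a, ‖π a‖ ≤ ‖a‖) (hsf : ∀ μ, s (f μ) = μ.comp π) :
    IsSpecialisation (dualAct ρ) act' f s := by
  have hcomp : ∀ (μ : A →L[L] L) (u : A →L[L] A), (∀ a, ‖u a‖ ≤ ‖a‖) → ‖μ.comp u‖ ≤ ‖μ‖ :=
    fun μ u hu => ContinuousLinearMap.opNorm_le_bound _ (norm_nonneg μ) fun a =>
      (μ.le_opNorm _).trans (mul_le_mul_of_nonneg_left (hu a) (norm_nonneg μ))
  refine ⟨fun γ₁ γ₂ δ₁ δ₂ μ => ?_, fun γ₁ γ₂ μ => hcomp μ _ (hρ γ₁ γ₂), hact, hfs, fun μ => ?_⟩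
  · ext a
    exact congrArg μ (hmul γ₁ γ₂ δ₁ δ₂ a)
  · rw [hsf]
    exact hcomp μ π hπ

/-- A functional that vanishes on the image of `π` sees only the part `u a - π (u a)`. -/
theorem norm_comp_le_of_comp_eq_zero {π u : A →L[L] A} {μ : A →L[L] L} (hμ : μ.comp π = 0) {C : ℝ}
    (hC : 0 ≤ C) (h : ∀ a, ‖u a - π (u a)‖ ≤ C * ‖a‖) : ‖μ.comp u‖ ≤ C * ‖μ‖ := by
  refine ContinuousLinearMap.opNorm_le_bound _ (by positivity) fun a => ?_
  have h1 : μ.comp u a = μ (u a - π (u a)) := by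
    rw [map_sub]
    exact (sub_eq_self.2 (DFunLike.congr_fun hμ (u a))).symm
  rw [h1, mul_comm C, mul_assoc]
  exact (μ.le_opNorm _).trans (mul_le_mul_of_nonneg_left (h a) (norm_nonneg μ))

variable (L) in
/-- The topological dual of the functions that are polynomial of degree at most `k` in the first
variable. -/
abbrev D1 (k : ℕ) : Type _ := A1 L k →L[L] L

variable (L) in
/-- Restriction of distributions to functions of degree at most `k` in the first variable. -/
noncomputable def restrictD1 (k : ℕ) : D L →ₗ[L] D1 L k where
  toFun μ := μ.comp (A1.incl k)
  map_add' _ _ := rfl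
  map_smul' _ _ := rfl

variable (L) in
/-- Extension of a distribution by zero on monomials of degree more than `k` in the first variable. -/
noncomputable def extendD1 (k : ℕ) : D1 L k →ₗ[L] D L where
  toFun μ := μ.comp (toA1 k)
  map_add' _ _ := rfl
  map_smul' _ _ := rfl

variable (L) in
/-- Restriction of functionals to polynomials of degree at most `k` in each variable. -/
noncomputable def restrictV (k : ℕ) : D1 L k →ₗ[L] VDual L k where
  toFun μ := (μ : A1 L k →ₗ[L] L) ∘ₗ (Submodule.inclusion (V_le_polynomialFst k) : V L k →ₗ[L] A1 L k)
  map_add' _ _ := rfl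
  map_smul' _ _ := rfl

variable (L) in
/-- Extension of a functional by zero on monomials of degree more than `k` in the second variable. -/
noncomputable def extendV [CompleteSpace L] (k : ℕ) : VDual L k →ₗ[L] D1 L k where
  toFun ν := (LinearMap.toContinuousLinearMap (E := V L k) ν).comp ((toV k).comp (A1.incl k))
  map_add' ν ν' := by ext; rfl
  map_smul' a ν := by ext; rfl

variable [FiniteDimensional ℚ_[p] L]

theorem isSpecialisation_restrictD1 (k : ℕ) :
    IsSpecialisation (M := D L) (M' := D1 L k) (p := p) (actD k) (dualAct (actA1 k))
      (restrictD1 L k) (extendD1 L k) := by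
  refine isSpecialisation_dualAct (A := A2 L) (ρ := actA (p := p) k) (π := truncate {x | x.1 ≤ k})
    (fun γ₁ γ₂ δ₁ δ₂ f => actA_mul k γ₁ γ₂ δ₁ δ₂ f) (fun γ₁ γ₂ f => norm_actA_le k γ₁ γ₂ f)
    (fun _ _ _ => rfl) (fun ν => ?_) (norm_truncate_le _) fun μ => ?_
  · ext f
    exact congrArg ν (toA1_incl f)
  · ext f
    rfl

theorem isSpecialisation_restrictV [CompleteSpace L] (k : ℕ) :
    IsSpecialisation (M := D1 L k) (M' := VDual L k) (p := p) (dualAct (actA1 k)) (actVDual k)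
      (restrictV L k) (extendV L k) := by
  refine isSpecialisation_dualAct (π := truncateV k)
    (fun γ₁ γ₂ δ₁ δ₂ f => A1.incl_injective k (actA_mul k γ₁ γ₂ δ₁ δ₂ (A1.incl k f)))
    (fun γ₁ γ₂ f => norm_actA_le k γ₁ γ₂ (A1.incl k f)) (fun _ _ _ => rfl) (fun ν => ?_)
    (fun f => norm_truncate_le {x | x.1 ≤ k ∧ x.2 ≤ k} (A1.incl k f)) fun μ => ?_
  · ext f
    exact congrArg ν (toV_of_mem f.2)
  · ext f
    rfl

theorem norm_sub_truncate_actA_le (k : ℕ) (γ₁ γ₂ : Sigma0 p L)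
    (h0 : (γ₁ : Matrix (Fin 2) (Fin 2) L) 0 0 = 1) (h1 : (γ₁ : Matrix (Fin 2) (Fin 2) L) 1 0 = 0)
    (f : A2 L) : ‖actA k γ₁ γ₂ f - truncate {x | x.1 ≤ k} (actA k γ₁ γ₂ f)‖ ≤
      ‖(γ₁ : Matrix (Fin 2) (Fin 2) L) 1 1‖ ^ (k + 1) * ‖f‖ :=
  norm_sub_truncate_le (by positivity) fun _ hx =>
    norm_actA_apply_le_of_lt_fst k γ₁ γ₂ h0 h1 f (not_le.1 hx)

theorem norm_sub_truncateV_actA1_le (k : ℕ) (γ₁ γ₂ : Sigma0 p L)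
    (h0 : (γ₂ : Matrix (Fin 2) (Fin 2) L) 0 0 = 1) (h1 : (γ₂ : Matrix (Fin 2) (Fin 2) L) 1 0 = 0)
    (f : A1 L k) : ‖actA1 k γ₁ γ₂ f - truncateV k (actA1 k γ₁ γ₂ f)‖ ≤
      ‖(γ₂ : Matrix (Fin 2) (Fin 2) L) 1 1‖ ^ (k + 1) * ‖f‖ := by
  refine norm_sub_truncate_le (S := {x | x.1 ≤ k ∧ x.2 ≤ k}) (f := actA k γ₁ γ₂ (A1.incl k f))
    (by positivity) fun x hx => ?_
  -- Degrees above `k` in `x` do not occur here, so only an excess in `y` contributes.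
  by_cases h : k < x.1
  · refine (norm_eq_zero.2 (actA_mem_polynomialFst k γ₁ γ₂ _ f.2 x h)).le.trans ?_
    positivity
  · exact norm_actA_apply_le_of_lt_snd k γ₁ γ₂ h0 h1 (A1.incl k f)
      (not_le.1 fun h2 => hx ⟨not_lt.1 h, h2⟩)

theorem norm_actD_le (k : ℕ) (γ₁ γ₂ : Sigma0 p L)
    (h0 : (γ₁ : Matrix (Fin 2) (Fin 2) L) 0 0 = 1) (h1 : (γ₁ : Matrix (Fin 2) (Fin 2) L) 1 0 = 0)
    {μ : D L} (hμ : restrictD1 L k μ = 0) :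
    ‖actD k γ₁ γ₂ μ‖ ≤ ‖(γ₁ : Matrix (Fin 2) (Fin 2) L) 1 1‖ ^ (k + 1) * ‖μ‖ := by
  have h : μ.comp (truncate {x | x.1 ≤ k}) = 0 := by
    ext f
    exact DFunLike.congr_fun hμ (toA1 k f)
  exact norm_comp_le_of_comp_eq_zero (u := actA k γ₁ γ₂) h (by positivity) fun f =>
    norm_sub_truncate_actA_le k γ₁ γ₂ h0 h1 f

theorem norm_dualAct_actA1_le (k : ℕ) (γ₁ γ₂ : Sigma0 p L)
    (h0 : (γ₂ : Matrix (Fin 2) (Fin 2) L) 0 0 = 1) (h1 : (γ₂ : Matrix (Fin 2) (Fin 2) L) 1 0 = 0)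
    {μ : D1 L k} (hμ : restrictV L k μ = 0) :
    ‖dualAct (actA1 k) γ₁ γ₂ μ‖ ≤ ‖(γ₂ : Matrix (Fin 2) (Fin 2) L) 1 1‖ ^ (k + 1) * ‖μ‖ := by
  have h : μ.comp (truncateV k) = 0 := by
    ext f
    exact DFunLike.congr_fun hμ (toV k (A1.incl k f))
  exact norm_comp_le_of_comp_eq_zero h (by positivity) fun f =>
    norm_sub_truncateV_actA1_le k γ₁ γ₂ h0 h1 f

variable {K : Type*} [Field K] [NumberField K] {σ : Fin 2 → K →+* L}
  {I : Fin (NumberField.classNumber K) → (Ideal (𝓞 K))⁰} {𝔭 : Ideal (𝓞 K)}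

/-- The prime has to be the one cut out by `σ 0`, so that its multipliers have norm at most `p ^
(-1/e)` under `σ 0`, the embedding acting on `x`. -/
theorem contracts_restrictD1 (h𝔭 : 𝔭 = primeOfEmbedding p (σ 0)) (h𝔭0 : 𝔭 ≠ ⊥)
    (hI : ∀ i, IsCoprime (I i : Ideal (𝓞 K)) (Ideal.span {(p : 𝓞 K)}))
    (hI𝔭 : ∀ i, IsCoprime (I i : Ideal (𝓞 K)) 𝔭) (c : HeckeChoice I 𝔭) (k : ℕ) :
    IsSpecialisation.Contracts (M := D L) (M' := D1 L k) (p := p) (actD k) (restrictD1 L k) σ I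
      (heckeU (p := p) (M := D L) (actD k) σ c) 𝔭 c.j c.α
      (((p : ℝ)⁻¹ ^ (((Ideal.span {(p : ℤ)}).ramificationIdx' 𝔭 : ℝ)⁻¹)) ^ (k + 1)) := by
  refine ⟨isHecke_heckeU h𝔭0 hI𝔭 c, by positivity, fun i x hx μ hμ => ?_⟩
  have hg : ActsThrough p σ (heckeMatrix x (c.α i)) :=
    actsThrough_heckeMatrix (hI (c.j i)) (c.mul_eq i) hx
  have hα : ‖σ 0 (c.α i)‖ ≤ (p : ℝ)⁻¹ ^ (((Ideal.span {(p : ℤ)}).ramificationIdx' 𝔭 : ℝ)⁻¹) := by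
    subst h𝔭
    exact norm_embedding_le_rpow (σ 0) (hI (c.j i)) (c.mul_eq i)
  rw [actGL_apply hg]
  refine (norm_actD_le k _ _ (by simp [heckeMatrix]) (by simp [heckeMatrix]) hμ).trans ?_
  simp only [heckeMatrix, Matrix.GeneralLinearGroup.mkOfDetNeZero, Matrix.map_apply]
  gcongr
  simpa using hα

theorem contracts_restrictV (h𝔭 : 𝔭 = primeOfEmbedding p (σ 1)) (h𝔭0 : 𝔭 ≠ ⊥)
    (hI : ∀ i, IsCoprime (I i : Ideal (𝓞 K)) (Ideal.span {(p : 𝓞 K)}))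
    (hI𝔭 : ∀ i, IsCoprime (I i : Ideal (𝓞 K)) 𝔭) (c : HeckeChoice I 𝔭) (k : ℕ) :
    IsSpecialisation.Contracts (M := D1 L k) (M' := VDual L k) (p := p) (dualAct (actA1 k))
      (restrictV L k) σ I (heckeU (p := p) (M := D1 L k) (dualAct (actA1 k)) σ c) 𝔭 c.j c.α
      (((p : ℝ)⁻¹ ^ (((Ideal.span {(p : ℤ)}).ramificationIdx' 𝔭 : ℝ)⁻¹)) ^ (k + 1)) := by
  refine ⟨isHecke_heckeU h𝔭0 hI𝔭 c, by positivity, fun i x hx μ hμ => ?_⟩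
  have hg : ActsThrough p σ (heckeMatrix x (c.α i)) :=
    actsThrough_heckeMatrix (hI (c.j i)) (c.mul_eq i) hx
  have hα : ‖σ 1 (c.α i)‖ ≤ (p : ℝ)⁻¹ ^ (((Ideal.span {(p : ℤ)}).ramificationIdx' 𝔭 : ℝ)⁻¹) := by
    subst h𝔭
    exact norm_embedding_le_rpow (σ 1) (hI (c.j i)) (c.mul_eq i)
  rw [actGL_apply hg]
  refine (norm_dualAct_actA1_le k _ _ (by simp [heckeMatrix]) (by simp [heckeMatrix]) hμ).trans ?_
  simp only [heckeMatrix, Matrix.GeneralLinearGroup.mkOfDetNeZero, Matrix.map_apply]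
  gcongr
  simpa using hα

end Dual

theorem exists_linearEquiv_of_injOn_of_surjOn {R M N : Type*} [Semiring R] [AddCommMonoid M]
    [AddCommMonoid N] [Module R M] [Module R N] (f : M →ₗ[R] N) {S : Submodule R M}
    {T : Submodule R N} (hf : ∀ x ∈ S, f x ∈ T) (hinj : ∀ x ∈ S, ∀ y ∈ S, f x = f y → x = y)
    (hsurj : ∀ y ∈ T, ∃ x ∈ S, f x = y) : ∃ e : S ≃ₗ[R] T, ∀ x, (e x : N) = f x := by
  refine ⟨LinearEquiv.ofBijective (f.restrict hf) ⟨fun x y h => ?_, fun y => ?_⟩, fun _ => rfl⟩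
  · exact Subtype.ext (hinj x x.2 y y.2 (congrArg Subtype.val h))
  · obtain ⟨x, hx, hxy⟩ := hsurj y y.2
    exact ⟨⟨x, hx⟩, Subtype.ext hxy⟩

/-! ### The control theorem -/

section Control

variable {K : Type*} [Field K] {p : ℕ}

theorem span_natCast_le_of_mem_primesOver {𝔭 : Ideal (𝓞 K)}
    (h𝔭 : 𝔭 ∈ (Ideal.span {(p : ℤ)}).primesOver (𝓞 K)) : Ideal.span {(p : 𝓞 K)} ≤ 𝔭 := by
  have h : Ideal.map (algebraMap ℤ (𝓞 K)) (Ideal.span {(p : ℤ)}) ≤ 𝔭 :=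
    Ideal.map_le_iff_le_comap.2 h𝔭.2.over.le
  rwa [Ideal.map_span, Set.image_singleton, map_natCast] at h

variable [NumberField K] [Fact p.Prime] [Algebra.IsQuadraticExtension ℚ K]
  [NumberField.IsTotallyComplex K] {L : Type*} [NontriviallyNormedField L] [NormedAlgebra ℚ_[p] L]
  [FiniteDimensional ℚ_[p] L]

/-- The specialisation map is an isomorphism on simultaneous eigenspaces of small slope. -/
theorem exists_equiv_eigenSymbols (σ : Fin 2 → K →+* L)
    {𝔫 : Ideal (𝓞 K)} (h𝔫 : 𝔫 ≠ ⊥) (hp𝔫 : Ideal.span {(p : 𝓞 K)} ∣ 𝔫)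
    {I : Fin (NumberField.classNumber K) → (Ideal (𝓞 K))⁰}
    (hI : Function.Bijective fun i => ClassGroup.mk0 (I i))
    (hI𝔫 : ∀ i, IsCoprime (I i : Ideal (𝓞 K)) 𝔫)
    (c : ∀ 𝔭 : (Ideal.span {(p : ℤ)}).primesOver (𝓞 K), HeckeChoice I (𝔭 : Ideal (𝓞 K)))
    (k : ℕ) {lam : (Ideal.span {(p : ℤ)}).primesOver (𝓞 K) → L}
    (hlam : ∀ 𝔭 : (Ideal.span {(p : ℤ)}).primesOver (𝓞 K), vp p (lam 𝔭) <
      (((k + 1 : ℝ) / Ideal.ramificationIdx' (Ideal.span {(p : ℤ)}) (𝔭 : Ideal (𝓞 K)) : ℝ) : EReal)) :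
    ∃ e : eigenSymbols (p := p) (M := D L) (actD k) σ 𝔫 c lam ≃ₗ[L]
        eigenSymbols (p := p) (M := VDual L k) (actVDual k) σ 𝔫 c lam,
      ∀ Φ, (e Φ : Fin (NumberField.classNumber K) → Div0 K →+ VDual L k) =
          specialisation K L k Φ := by
  have : IsUltrametricDist L := IsUltrametricDist.of_normedAlgebra ℚ_[p]
  have : CompleteSpace L := FiniteDimensional.complete ℚ_[p] L
  have h𝔭 : ∀ q : (Ideal.span {(p : ℤ)}).primesOver (𝓞 K), 𝔫 ≤ (q : Ideal (𝓞 K)) := fun q =>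
    (Ideal.le_of_dvd hp𝔫).trans (span_natCast_le_of_mem_primesOver q.2)
  have h𝔭0 : ∀ q : (Ideal.span {(p : ℤ)}).primesOver (𝓞 K), (q : Ideal (𝓞 K)) ≠ ⊥ := fun q h =>
    h𝔫 (le_bot_iff.1 (h ▸ h𝔭 q))
  have hIp : ∀ i, IsCoprime (I i : Ideal (𝓞 K)) (Ideal.span {(p : 𝓞 K)}) := fun i => by
    obtain ⟨r, hr⟩ := hp𝔫
    exact (hr ▸ hI𝔫 i).of_mul_right_left
  have hI𝔭 : ∀ (q : (Ideal.span {(p : ℤ)}).primesOver (𝓞 K)) i,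
      IsCoprime (I i : Ideal (𝓞 K)) (q : Ideal (𝓞 K)) := fun q i => by
    obtain ⟨r, hr⟩ := Ideal.dvd_iff_le.2 (h𝔭 q)
    exact (hr ▸ hI𝔫 i).of_mul_right_left
  -- The two primes may coincide; both steps then contract with the same Hecke operator, in
  -- different variables.
  let q : Fin 2 → (Ideal.span {(p : ℤ)}).primesOver (𝓞 K) := fun s =>
    ⟨primeOfEmbedding p (σ s), primeOfEmbedding_mem_primesOver p (σ s)⟩
  have hf₁ := isSpecialisation_restrictD1 (p := p) (L := L) k
  have hf₂ := isSpecialisation_restrictV (p := p) (L := L) k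
  have hT₁ := contracts_restrictD1 (σ := σ) rfl (h𝔭0 (q 0)) hIp (hI𝔭 (q 0)) (c (q 0)) k
  have hT₂ := contracts_restrictV (σ := σ) rfl (h𝔭0 (q 1)) hIp (hI𝔭 (q 1)) (c (q 1)) k
  have hμ₁ := rpow_lt_norm_of_vp_lt (hlam (q 0))
  have hμ₂ := rpow_lt_norm_of_vp_lt (hlam (q 1))
  have hmap : ∀ Φ ∈ eigenSymbols (p := p) (M := D L) (actD k) σ 𝔫 c lam,
      specialisation K L k Φ ∈ eigenSymbols (p := p) (M := VDual L k) (actVDual k) σ 𝔫 c lam :=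
    fun Φ hΦ => hf₂.postcomp_mem_eigenSymbols h𝔭0 (hf₁.postcomp_mem_eigenSymbols h𝔭0 hΦ)
  refine exists_linearEquiv_of_injOn_of_surjOn _ hmap (fun Φ hΦ Φ' hΦ' h => ?_) fun φ hφ => ?_
  · exact hf₁.postcomp_injOn h𝔫 hT₁ hμ₁ hΦ hΦ' (hf₂.postcomp_injOn h𝔫 hT₂ hμ₂
      (hf₁.postcomp_mem_eigenSymbols h𝔭0 hΦ) (hf₁.postcomp_mem_eigenSymbols h𝔭0 hΦ') h)
  -- Lift first in `y` and then in `x`. The intermediate lift satisfies the eigenvalue equations at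
  -- all primes above `p`, so the second lift can use `q 0`.
  · obtain ⟨Ψ, hΨ, hΨφ⟩ := hf₂.postcomp_surjective h𝔫 hp𝔫 hI hI𝔫 h𝔭 hT₂ hμ₂ hφ
    obtain ⟨Φ, hΦ, hΦΨ⟩ := hf₁.postcomp_surjective h𝔫 hp𝔫 hI hI𝔫 h𝔭 hT₁ hμ₁ hΨ
    exact ⟨Φ, hΦ, (congrArg (postcomp (N := D1 L k) K (restrictV L k)) hΦΨ).trans hΨφ⟩

end Control
end Bianchi

theorem mainTheorem1 (K : Type*) [Field K] [NumberField K] [Algebra.IsQuadraticExtension ℚ K]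
    [NumberField.IsTotallyComplex K] (p : ℕ) [Fact p.Prime]
    (L : Type*) [NormedField L] [NormedAlgebra ℚ_[p] L] [FiniteDimensional ℚ_[p] L]
    (σ : Fin 2 → K →+* L) (hσ : Function.Injective σ)
    (𝔫 : Ideal (𝓞 K)) (h𝔫 : 𝔫 ≠ ⊥) (hp𝔫 : Ideal.span {(p : 𝓞 K)} ∣ 𝔫)
    (I : Fin (NumberField.classNumber K) → (Ideal (𝓞 K))⁰)
    (hI : Function.Bijective fun i => ClassGroup.mk0 (I i))
    (hI𝔫 : ∀ i, IsCoprime (I i : Ideal (𝓞 K)) 𝔫)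
    (c : ∀ 𝔭 : (Ideal.span {(p : ℤ)}).primesOver (𝓞 K), HeckeChoice I (𝔭 : Ideal (𝓞 K)))
    (k : ℕ) (lam : (Ideal.span {(p : ℤ)}).primesOver (𝓞 K) → L)
    (hlam : ∀ 𝔭 : (Ideal.span {(p : ℤ)}).primesOver (𝓞 K), vp p (lam 𝔭) <
      (((k + 1 : ℝ) / Ideal.ramificationIdx' (Ideal.span {(p : ℤ)}) (𝔭 : Ideal (𝓞 K)) : ℝ) : EReal)) :
    ∃ e : eigenSymbols (p := p) (M := D L) (actD k) σ 𝔫 c lam ≃ₗ[L]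
        eigenSymbols (p := p) (M := VDual L k) (actVDual k) σ 𝔫 c lam,
      ∀ Φ, (e Φ : Fin (NumberField.classNumber K) → Div0 K →+ VDual L k) =
          specialisation K L k Φ := by
  -- The operator norm on duals uses a nontrivially normed field; `p⁻¹` is an element of norm
  -- greater than one.
  have hp : 1 < ‖(p : L)⁻¹‖ := by
    rw [norm_inv, norm_natCast_prime p, inv_inv]
    exact_mod_cast (Fact.out : p.Prime).one_lt
  let : NontriviallyNormedField L := { ‹NormedField L› with non_trivial := ⟨_, hp⟩ }
  exact exists_equiv_eigenSymbols σ h𝔫 hp𝔫 hI hI𝔫 c k hlam
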